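/- Let $N\ge 1$, let $\Omega\subset\mathbb{R}^N$ be a bounded Lipschitz domain, i.e. a bounded open set such that every $x\in\partial\Omega$ has an open neighbourhood $W$ and a bi-Lipschitz map $\psi$ of $W$ onto $(-1,1)^N$ with $\psi(W\cap\Omega)=(-1,1)^{N-1}\times(0,1)$, and let $1<p<\infty$. Let $\sigma$ be the $(N-1)$-dimensional Hausdorff (surface) measure on $\partial\Omega$. For $u\in W^{1,p}(\Omega)$ (real-valued functions) let $u|_{\partial\Omega}\in L^p(\partial\Omega,\sigma)$ denote its trace, i.e. the $L^p(\partial\Omega)$-limit of $\varphi_n|_{\partial\Omega}$ for functions $\varphi_n\in C^\infty(\overline\Omega)$ with $\varphi_n\to u$ in $W^{1,p}(\Omega)$; it exists and is unique up to $\sigma$-null sets. (i) The space $V:=W^{1,p}(\Omega)\cap L^2(\Omega)$ is a separable, reflexive Banach space for the norm $\|u\|_V:=\|u\|_{W^{1,p}(\Omega)}+\|u\|_{L^2(\Omega)}$. (ii) Let $a:\Omega\times\mathbb{R}^N\to\mathbb{R}^N$, $b:\Omega\times\mathbb{R}\to\mathbb{R}$ and $h:\partial\Omega\times\mathbb{R}\to\mathbb{R}$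 be measurable in the first argument and continuous in the second. Assume that there are constants $0<\nu\le\mu$ and non-negative functions $\psi_1,\psi_2$ on $\Omega$ and $\psi_4$ on $\partial\Omega$ such that $$z\cdot a(x,z)\ge\nu|z|^p-\psi_1(x),\qquad |a(x,z)|\le\mu|z|^{p-1}+\psi_2(x),\qquad |b(x,t)|\le\psi_1(x)|t|^{p-1}+\psi_1(x)$$ for all $x\in\Omega$, $z\in\mathbb{R}^N$, $t\in\mathbb{R}$, and $|h(x,t)|\le\psi_4(x)|t|^{p-1}+\psi_4(x)$ for all $x\in\partial\Omega$, $t\in\mathbb{R}$, where - if $p<N$: $\psi_1\in L^{N/(p-\varepsilon)}(\Omega)$, $\psi_2\in L^{N/(p-1)}(\Omega)$, $\psi_4\in L^{(N-1)/(p-1-\varepsilon)}(\partial\Omega)$ for some $0<\varepsilon<\min\{1,p-1\}$; - if $p=N$: $\psi_1\in L^{N/(N-\varepsilon)}(\Omega)$, $\psi_2\in L^{N/(N-1-\varepsilon)}(\Omega)$, $\psi_4\in L^{(N-1)/(N-1-\varepsilon)}(\partial\Omega)$ for some $0<\varepsilon<1$; - if $p>N$: $\psi_1\in L^1(\Omega)$,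 $\psi_2\in L^{p/(p-1)}(\Omega)$, $\psi_4\in L^1(\partial\Omega)$. Assume moreover the monotonicity conditions $$(z_1-z_2)\cdot(a(x,z_1)-a(x,z_2))\ge0,\qquad (t_1-t_2)(b(x,t_1)-b(x,t_2))\ge0\qquad(x\in\Omega),$$ $$(t_1-t_2)(h(x,t_1)-h(x,t_2))\ge0\qquad(x\in\partial\Omega)$$ for all $z_1,z_2\in\mathbb{R}^N$ and $t_1,t_2\in\mathbb{R}$. Then for all $u,v\in V$ the three integrals in $$\langle\mathcal{A}u,v\rangle:=\int_\Omega\nabla v\cdot a(x,\nabla u)\,dx+\int_\Omega v\,b(x,u)\,dx+\int_{\partial\Omega}v\,h(x,u)\,d\sigma$$ exist (in the boundary integral $u$ and $v$ stand for their traces), and this formula defines an operator $\mathcal{A}:V\to V'$ that is bounded (it maps bounded sets to bounded sets), continuous with respect to the norm topologies, and monotone: $\langle\mathcal{A}u-\mathcal{A}v,u-v\rangle\ge0$ for all $u,v\in V$. -/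

import Mathlib

open MeasureTheory Filter Topology
open scoped ENNReal NNReal ContDiff

/-- The `N`-dimensional Euclidean space `ℝ^N`. -/
abbrev EucSp (N : ℕ) : Type := EuclideanSpace ℝ (Fin N)

/-- The open cube `(-1,1)^N`. -/
def openCube (N : ℕ) : Set (EucSp N) := {y | ∀ i, y i ∈ Set.Ioo (-1 : ℝ) 1}

/-- The upper half cube `(-1,1)^(N-1) × (0,1)`; `⊤ : Fin N` is the last index. -/
def upperHalfCube (N : ℕ) [NeZero N] : Set (EucSp N) := {y | y ∈ openCube N ∧ 0 < y ⊤}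

/-- A bounded Lipschitz domain: a bounded open set such that every boundary point has an open
neighbourhood `W` and a bi-Lipschitz map `ψ` of `W` onto the cube `(-1,1)^N` that maps `W ∩ Ω` onto
the upper half cube. (Connectedness is not required.) -/
structure IsBoundedLipschitzDomain {N : ℕ} [NeZero N] (Ω : Set (EucSp N)) : Prop where
  isOpen : IsOpen Ω
  isBounded : Bornology.IsBounded Ω
  chart : ∀ x ∈ frontier Ω, ∃ (W : Set (EucSp N)) (ψ : EucSp N → EucSp N) (K K' : ℝ≥0),
    IsOpen W ∧ x ∈ W ∧ LipschitzOnWith K ψ W ∧ AntilipschitzWith K' (W.domRestrict ψ) ∧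
      ψ '' W = openCube N ∧ ψ '' (W ∩ Ω) = upperHalfCube N

/-- Lebesgue measure on `Ω`. -/
noncomputable def domMeasure {N : ℕ} (Ω : Set (EucSp N)) : Measure (EucSp N) :=
  volume.restrict Ω

/-- The surface measure `σ` on `∂Ω`: the `(N-1)`-dimensional Hausdorff measure, normalized so that it
agrees with Lebesgue measure on `ℝ^(N-1)`. -/
noncomputable def bdryMeasure {N : ℕ} (Ω : Set (EucSp N)) : Measure (EucSp N) :=
  (Measure.euclideanHausdorffMeasure (N - 1)).restrict (frontier Ω)

/-- `g` is a weak gradient of `u` on `Ω` (used for `u` and `g` in Lebesgue spaces over `Ω`):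
`∫_Ω u ∂_v φ = - ∫_Ω φ (g · v)` for all `φ ∈ C_c^∞(Ω)` and all directions `v`. -/
def HasWeakGradient {N : ℕ} (Ω : Set (EucSp N)) (u : EucSp N → ℝ) (g : EucSp N → EucSp N) : Prop :=
  ∀ φ : EucSp N → ℝ, ContDiff ℝ ∞ φ → HasCompactSupport φ → tsupport φ ⊆ Ω →
    ∀ v : EucSp N,
      ∫ x, u x * fderiv ℝ φ x v ∂(domMeasure Ω) = - ∫ x, φ x * inner ℝ (g x) v ∂(domMeasure Ω)

instance fact_one_le_ofReal (p : ℝ) [hp : Fact (1 < p)] : Fact (1 ≤ ENNReal.ofReal p) :=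
  ⟨by simpa using hp.out.le⟩

section Integrability

variable {N : ℕ} {Ω : Set (EucSp N)} {q : ℝ≥0∞} [hq : Fact (1 ≤ q)]

theorem memLp_of_continuous_compactSupport {φ : EucSp N → ℝ} (h : Continuous φ)
    (hc : HasCompactSupport φ) (r : ℝ≥0∞) : MemLp φ r (domMeasure Ω) :=
  (h.memLp_of_hasCompactSupport (μ := volume) hc).restrict Ω

theorem integrable_mul_of_Lp (u : Lp ℝ q (domMeasure Ω)) {φ : EucSp N → ℝ} (h : Continuous φ)
    (hc : HasCompactSupport φ) : Integrable (fun x => u x * φ x) (domMeasure Ω) := by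
  have : ENNReal.HolderConjugate q (ENNReal.conjExponent q) :=
    ENNReal.HolderConjugate.conjExponent hq.out
  exact (Lp.memLp u).integrable_mul
    (memLp_of_continuous_compactSupport h hc (ENNReal.conjExponent q))

theorem integrable_mul_inner_of_Lp (g : Lp (EucSp N) q (domMeasure Ω)) {φ : EucSp N → ℝ}
    (h : Continuous φ) (hc : HasCompactSupport φ) (v : EucSp N) :
    Integrable (fun x => φ x * inner ℝ (g x) v) (domMeasure Ω) := by
  have : ENNReal.HolderConjugate q (ENNReal.conjExponent q) :=
    ENNReal.HolderConjugate.conjExponent hq.out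
  have h1 : MemLp (fun x => inner ℝ (g x) v) q (domMeasure Ω) := by
    have := (innerSL ℝ v).comp_memLp' (Lp.memLp g)
    refine this.congr_norm ?_ ?_
    · exact (Lp.aestronglyMeasurable g).inner aestronglyMeasurable_const
    · exact Eventually.of_forall fun x => by simp [real_inner_comm]
  have := h1.integrable_mul (memLp_of_continuous_compactSupport h hc
    (ENNReal.conjExponent q))
  exact this.congr (Eventually.of_forall fun x => mul_comm _ _)

end Integrability

/-- The real Sobolev space `W^{1,p}(Ω)`, realized as the set of pairs `(u, ∇u)` with `u ∈ L^p(Ω)` and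
weak gradient `∇u ∈ L^p(Ω; ℝ^N)`, with the norm `(‖u‖_p ^ p + ‖∇u‖_p ^ p)^(1/p)`. (For open `Ω` the
weak gradient is determined by `u`, so such a pair is the same thing as the function `u`.) -/
noncomputable def sobolevSubmodule {N : ℕ} (Ω : Set (EucSp N)) (p : ℝ) [Fact (1 < p)] :
    Submodule ℝ (WithLp (ENNReal.ofReal p)
      (Lp ℝ (ENNReal.ofReal p) (domMeasure Ω) × Lp (EucSp N) (ENNReal.ofReal p) (domMeasure Ω))) where
  carrier := {w | HasWeakGradient Ω w.fst w.snd}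
  zero_mem' := by
    intro φ _ _ _ v
    have h1 : ∫ x, (0 : Lp ℝ (ENNReal.ofReal p) (domMeasure Ω)) x * fderiv ℝ φ x v
        ∂(domMeasure Ω) = 0 := by
      apply integral_eq_zero_of_ae
      filter_upwards [Lp.coeFn_zero ℝ (ENNReal.ofReal p) (domMeasure Ω)] with x hx
      simp only [hx, Pi.zero_apply, zero_mul]
    have h2 : ∫ x, φ x * inner ℝ
        ((0 : Lp (EucSp N) (ENNReal.ofReal p) (domMeasure Ω)) x) v ∂(domMeasure Ω) = 0 := by
      apply integral_eq_zero_of_ae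
      filter_upwards [Lp.coeFn_zero (EucSp N) (ENNReal.ofReal p) (domMeasure Ω)] with x hx
      simp only [hx, Pi.zero_apply, inner_zero_left, mul_zero]
    exact h1.trans (by rw [← neg_zero, ← h2]; rfl)
  add_mem' := by
    intro w w' hw hw' φ hφ hc hs v
    have hd : Continuous fun x => fderiv ℝ φ x v :=
      (hφ.continuous_fderiv (by simp)).clm_apply continuous_const
    have hdc : HasCompactSupport fun x => fderiv ℝ φ x v := hc.fderiv_apply ℝ v
    have e1 : ∫ x, (w + w').fst x * fderiv ℝ φ x v ∂(domMeasure Ω) =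
        ∫ x, (w.fst x * fderiv ℝ φ x v + w'.fst x * fderiv ℝ φ x v) ∂(domMeasure Ω) := by
      apply integral_congr_ae
      filter_upwards [Lp.coeFn_add w.fst w'.fst] with x hx
      rw [WithLp.add_fst, hx, Pi.add_apply, add_mul]
    have e2 : ∫ x, φ x * inner ℝ ((w + w').snd x) v ∂(domMeasure Ω) =
        ∫ x, (φ x * inner ℝ (w.snd x) v + φ x * inner ℝ (w'.snd x) v) ∂(domMeasure Ω) := by
      apply integral_congr_ae
      filter_upwards [Lp.coeFn_add w.snd w'.snd] with x hx
      rw [WithLp.add_snd, hx, Pi.add_apply, inner_add_left, mul_add]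
    rw [e1, e2, integral_add (integrable_mul_of_Lp _ hd hdc) (integrable_mul_of_Lp _ hd hdc),
      integral_add (integrable_mul_inner_of_Lp _ hφ.continuous hc v)
        (integrable_mul_inner_of_Lp _ hφ.continuous hc v), hw φ hφ hc hs v, hw' φ hφ hc hs v]
    ring
  smul_mem' := by
    intro c w hw φ hφ hc hs v
    have e1 : ∫ x, (c • w).fst x * fderiv ℝ φ x v ∂(domMeasure Ω) =
        ∫ x, c * (w.fst x * fderiv ℝ φ x v) ∂(domMeasure Ω) := by
      apply integral_congr_ae
      filter_upwards [Lp.coeFn_smul c w.fst] with x hx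
      rw [WithLp.smul_fst, hx, Pi.smul_apply, smul_eq_mul, mul_assoc]
    have e2 : ∫ x, φ x * inner ℝ ((c • w).snd x) v ∂(domMeasure Ω) =
        ∫ x, c * (φ x * inner ℝ (w.snd x) v) ∂(domMeasure Ω) := by
      apply integral_congr_ae
      filter_upwards [Lp.coeFn_smul c w.snd] with x hx
      rw [WithLp.smul_snd, hx, Pi.smul_apply, real_inner_smul_left]
      ring
    rw [e1, e2, integral_const_mul, integral_const_mul, hw φ hφ hc hs v]
    ring

/-- The Sobolev space `W^{1,p}(Ω)` as a type; its norm is inherited from the ambient direct sum. -/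
abbrev SobolevW1p {N : ℕ} (Ω : Set (EucSp N)) (p : ℝ) [Fact (1 < p)] : Type :=
  sobolevSubmodule Ω p

namespace SobolevW1p

variable {N : ℕ} {Ω : Set (EucSp N)} {p : ℝ} [Fact (1 < p)]

/-- The function `u` underlying an element of `W^{1,p}(Ω)`. -/
noncomputable def fn (u : SobolevW1p Ω p) : EucSp N → ℝ := u.1.fst

/-- The weak gradient of an element of `W^{1,p}(Ω)`. -/
noncomputable def grad (u : SobolevW1p Ω p) : EucSp N → EucSp N := u.1.snd

/-- `g` is the trace of `u ∈ W^{1,p}(Ω)`: `g ∈ L^p(∂Ω)`, and there are functions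
`φ n ∈ C^∞(Ω̄)` (restrictions of smooth functions on `ℝ^N`) which converge to `u` in `W^{1,p}(Ω)`
and whose restrictions to `∂Ω` converge to `g` in `L^p(∂Ω)`. In other words, the trace operator
is the closure of the restriction map of functions in `C^∞(Ω̄)`. -/
def IsTrace (u : SobolevW1p Ω p) (g : EucSp N → ℝ) : Prop :=
  MemLp g (ENNReal.ofReal p) (bdryMeasure Ω) ∧
  ∃ φ : ℕ → EucSp N → ℝ, (∀ n, ContDiff ℝ ∞ (φ n)) ∧
    Tendsto (fun n => eLpNorm (fun x => φ n x - u.fn x) (ENNReal.ofReal p) (domMeasure Ω))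
      atTop (𝓝 0) ∧
    Tendsto (fun n => eLpNorm (fun x => gradient (φ n) x - u.grad x) (ENNReal.ofReal p)
      (domMeasure Ω)) atTop (𝓝 0) ∧
    Tendsto (fun n => eLpNorm (fun x => φ n x - g x) (ENNReal.ofReal p) (bdryMeasure Ω))
      atTop (𝓝 0)

open Classical in
/-- The trace `u|_{∂Ω}` of `u ∈ W^{1,p}(Ω)` (a chosen representative; only its values on `∂Ω` matter). -/
noncomputable def trace (u : SobolevW1p Ω p) : EucSp N → ℝ :=
  if h : ∃ g, IsTrace u g then h.choose else 0

end SobolevW1p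

/-- The space `V = W^{1,p}(Ω) ∩ L²(Ω)` with the norm `‖u‖_{W^{1,p}(Ω)} + ‖u‖_{L²(Ω)}`, as the space of
pairs in the `ℓ¹`-direct sum `W^{1,p}(Ω) ⊕ L²(Ω)` both of whose components are the same function. -/
noncomputable def spaceVSubmodule {N : ℕ} (Ω : Set (EucSp N)) (p : ℝ) [Fact (1 < p)] :
    Submodule ℝ (WithLp 1 (SobolevW1p Ω p × Lp ℝ 2 (domMeasure Ω))) where
  carrier := {w | w.fst.fn =ᵐ[domMeasure Ω] w.snd}
  zero_mem' := by
    have h1 := Lp.coeFn_zero ℝ (ENNReal.ofReal p) (domMeasure Ω)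
    have h2 := Lp.coeFn_zero ℝ 2 (domMeasure Ω)
    exact EventuallyEq.trans h1 h2.symm
  add_mem' := by
    intro w w' (hw : w.fst.fn =ᵐ[domMeasure Ω] w.snd) (hw' : w'.fst.fn =ᵐ[domMeasure Ω] w'.snd)
    have h1 := Lp.coeFn_add w.fst.1.fst w'.fst.1.fst
    have h2 := Lp.coeFn_add w.snd w'.snd
    exact EventuallyEq.trans h1 ((hw.add hw').trans h2.symm)
  smul_mem' := by
    intro c w (hw : w.fst.fn =ᵐ[domMeasure Ω] w.snd)
    have h1 := Lp.coeFn_smul c w.fst.1.fst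
    have h2 := Lp.coeFn_smul c w.snd
    exact EventuallyEq.trans h1 ((hw.const_smul c).trans h2.symm)

/-- The space `V` as a type; its norm is inherited from the ambient direct sum. -/
abbrev SpaceV {N : ℕ} (Ω : Set (EucSp N)) (p : ℝ) [Fact (1 < p)] : Type :=
  spaceVSubmodule Ω p

namespace SpaceV

variable {N : ℕ} {Ω : Set (EucSp N)} {p : ℝ} [Fact (1 < p)]

/-- An element of `V`, regarded as an element of `W^{1,p}(Ω)`. -/
noncomputable def toW1p (u : SpaceV Ω p) : SobolevW1p Ω p := u.1.fst

/-- The function `u` underlying an element of `V`. -/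
noncomputable def fn (u : SpaceV Ω p) : EucSp N → ℝ := u.toW1p.fn

/-- The weak gradient of an element of `V`. -/
noncomputable def grad (u : SpaceV Ω p) : EucSp N → EucSp N := u.toW1p.grad

/-- The trace of an element of `V`. -/
noncomputable def trace (u : SpaceV Ω p) : EucSp N → ℝ := u.toW1p.trace

end SpaceV

/-- Integrability of the (non-negative) structure functions `ψ₁, ψ₂` on `Ω` and `ψ₄` on `∂Ω`.
For `p < N` the number `ε` has to satisfy `ε < p - 1`, so that `(N-1)/(p-1-ε)` is an exponent. -/
def StructureFunctions {N : ℕ} (Ω : Set (EucSp N)) (p : ℝ) (ψ₁ ψ₂ ψ₄ : EucSp N → ℝ) : Prop :=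
  (∀ x ∈ Ω, 0 ≤ ψ₁ x) ∧ (∀ x ∈ Ω, 0 ≤ ψ₂ x) ∧ (∀ x ∈ frontier Ω, 0 ≤ ψ₄ x) ∧
  (p < N → ∃ ε : ℝ, 0 < ε ∧ ε < 1 ∧ ε < p - 1 ∧
    MemLp ψ₁ (ENNReal.ofReal (N / (p - ε))) (domMeasure Ω) ∧
    MemLp ψ₂ (ENNReal.ofReal (N / (p - 1))) (domMeasure Ω) ∧
    MemLp ψ₄ (ENNReal.ofReal ((N - 1) / (p - 1 - ε))) (bdryMeasure Ω)) ∧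
  (p = N → ∃ ε : ℝ, 0 < ε ∧ ε < 1 ∧
    MemLp ψ₁ (ENNReal.ofReal (N / (N - ε))) (domMeasure Ω) ∧
    MemLp ψ₂ (ENNReal.ofReal (N / (N - 1 - ε))) (domMeasure Ω) ∧
    MemLp ψ₄ (ENNReal.ofReal ((N - 1) / (N - 1 - ε))) (bdryMeasure Ω)) ∧
  (N < p →
    MemLp ψ₁ 1 (domMeasure Ω) ∧
    MemLp ψ₂ (ENNReal.ofReal (p / (p - 1))) (domMeasure Ω) ∧
    MemLp ψ₄ 1 (bdryMeasure Ω))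

/-- Carathéodory condition: the coefficients are measurable in `x` and continuous in the second
argument. -/
structure CaratheodoryCoeffs {N : ℕ} (Ω : Set (EucSp N)) (a : EucSp N → EucSp N → EucSp N)
    (b h : EucSp N → ℝ → ℝ) : Prop where
  meas_a : ∀ z, AEStronglyMeasurable (fun x => a x z) (domMeasure Ω)
  cont_a : ∀ x ∈ Ω, Continuous (a x)
  meas_b : ∀ t, AEStronglyMeasurable (fun x => b x t) (domMeasure Ω)
  cont_b : ∀ x ∈ Ω, Continuous (b x)
  meas_h : ∀ t, AEStronglyMeasurable (fun x => h x t) (bdryMeasure Ω)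
  cont_h : ∀ x ∈ frontier Ω, Continuous (h x)

/-- The structure conditions on the coefficients `a`, `b` (on `Ω`) and `h` (on `∂Ω`). -/
def StructureConditions {N : ℕ} (Ω : Set (EucSp N)) (p : ℝ) (a : EucSp N → EucSp N → EucSp N)
    (b h : EucSp N → ℝ → ℝ) : Prop :=
  ∃ (ν μ : ℝ) (ψ₁ ψ₂ ψ₄ : EucSp N → ℝ), 0 < ν ∧ ν ≤ μ ∧ StructureFunctions Ω p ψ₁ ψ₂ ψ₄ ∧
    (∀ x ∈ Ω, ∀ z, ν * ‖z‖ ^ p - ψ₁ x ≤ inner ℝ z (a x z)) ∧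
    (∀ x ∈ Ω, ∀ z, ‖a x z‖ ≤ μ * ‖z‖ ^ (p - 1) + ψ₂ x) ∧
    (∀ x ∈ Ω, ∀ t, |b x t| ≤ ψ₁ x * |t| ^ (p - 1) + ψ₁ x) ∧
    (∀ x ∈ frontier Ω, ∀ t, |h x t| ≤ ψ₄ x * |t| ^ (p - 1) + ψ₄ x)

/-- The monotonicity conditions on the coefficients. -/
structure MonotoneCoeffs {N : ℕ} (Ω : Set (EucSp N)) (a : EucSp N → EucSp N → EucSp N)
    (b h : EucSp N → ℝ → ℝ) : Prop where
  mono_a : ∀ x ∈ Ω, ∀ z₁ z₂, 0 ≤ inner ℝ (z₁ - z₂) (a x z₁ - a x z₂)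
  mono_b : ∀ x ∈ Ω, ∀ t₁ t₂, 0 ≤ (t₁ - t₂) * (b x t₁ - b x t₂)
  mono_h : ∀ x ∈ frontier Ω, ∀ t₁ t₂, 0 ≤ (t₁ - t₂) * (h x t₁ - h x t₂)

/-! Each of the three integrals has the form ∫ ⟨τv, f(x, τu)⟩ dμ with τ linear: the gradient, the
inclusion, or the trace. If |f(x,z)| ≤ w(x)(K|z|^(p-1) + c(x)), then f/w has ordinary (p-1)-growth
relative to the measure w dμ, so its superposition operator S maps L^p(w dμ) to L^{p'}(w dμ) and is
bounded on bounded sets and continuous (Nemytskii). When τ is a bounded map T into L^p(w dμ), the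
term equals T' ∘ S ∘ T. Boundedness and continuity follow, and monotonicity holds pointwise under
the integral. This is `exists_operator`. The operator is built on W^{1,p}(Ω) and pulled back to V by
the projection V → W^{1,p}(Ω).

It remains to bound W^{1,p}(Ω) in L^p(ψ₁ dx) and L^p(ψ₄ dσ). A single inequality,
`LipChart.exists_lintegral_le`, serves all relations between p and N: if a finite measure m gives
mass at most C r^β to balls of radius r in a chart, and β > N - p, then ∫|u|^p dm is bounded by the
p-th power of the Sobolev norm. For the proof, u(x) is compared with u at a variable point along
segments of the convex model domain; Hölder with a weight t^a and Fubini reduce the claim to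
convergence of ∫₀¹ t^(ap+β-N) dt. By Hölder, a density in L^s over a measure of growth r^d has
growth r^(d(1-1/s)), and the exponents imposed on ψ₁ and ψ₄ are those for which d(1-1/s) > N - p.
With density 1 on ∂Ω the same inequality is the trace inequality.

Passing from C¹ functions to W^{1,p}(Ω), and constructing traces, needs density of smooth functions.
The charts are merely bi-Lipschitz, so Ω need not lie locally above a graph and the usual argument
by translation is not available. Instead the energy ∬_{|x-y|≤δ} |w(y)-w(x)|^p is used. For a Sobolev
function it is O(δ^(p+N)); this survives bi-Lipschitz maps, folding across the flat boundary, and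
cut-offs, without any chain rule for weak derivatives. Conversely, if the energy of F is O(δ^(p+N)),
then mollification at scale δ is O(δ) close to F in L^p and has bounded gradient. So every u is an
L^p limit of smooth functions bounded in W^{1,p}(Ω). Reflexivity gives a weak cluster point, it must
be u, and a norm-closed subspace is weakly closed: u lies in the closure of the smooth functions
(`SobolevW1p.mem_closure_smoothSubmodule`).

Part (i) holds because V is a closed subspace of a finite product of spaces L^p and L², whose
reflexivity follows from the duality of L^p and L^{p'}, obtained here by Radon–Nikodym. -/

/-! ### Duality of L^p and L^q over a finite measure -/

section LpDuality

variable {X : Type*} [MeasurableSpace X] {μ : Measure X}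

/-- Continuous linear functionals on `L^P` that agree on indicator functions are equal. -/
theorem Lp_functional_ext [IsFiniteMeasure μ] {P : ℝ≥0∞} [Fact (1 ≤ P)] (hP : P ≠ ⊤)
    {ℓ₁ ℓ₂ : Lp ℝ P μ →L[ℝ] ℝ}
    (h : ∀ (s : Set X) (hs : MeasurableSet s),
      ℓ₁ (indicatorConstLp P hs (measure_ne_top μ s) 1)
        = ℓ₂ (indicatorConstLp P hs (measure_ne_top μ s) 1)) : ℓ₁ = ℓ₂ := by
  ext f
  refine Lp.induction hP (fun f => ℓ₁ f = ℓ₂ f) ?_ ?_ (isClosed_eq ℓ₁.continuous ℓ₂.continuous) f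
  · intro c s hs hμs
    have : ((Lp.simpleFunc.indicatorConst P hs hμs.ne c : Lp.simpleFunc ℝ P μ) : Lp ℝ P μ)
        = c • indicatorConstLp P hs (measure_ne_top μ s) (1 : ℝ) := by
      rw [Lp.simpleFunc.coe_indicatorConst]
      apply Lp.ext
      filter_upwards [Lp.coeFn_smul c (indicatorConstLp P hs (measure_ne_top μ s) (1 : ℝ)),
        indicatorConstLp_coeFn (p := P) (hs := hs) (hμs := measure_ne_top μ s) (c := (1 : ℝ)),
        indicatorConstLp_coeFn (p := P) (hs := hs) (hμs := hμs.ne) (c := c)] with x h1 h2 h3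
      rw [h1, h3, Pi.smul_apply, h2]
      by_cases hx : x ∈ s <;> simp [hx]
    rw [this, map_smul, map_smul, h s hs]
  · intro f g hf hg _ h1 h2
    rw [map_add, map_add, h1, h2]

/-- For P < ∞ indicators converge in L^P as soon as the measure of the symmetric difference tends to
0, which here is continuity of a finite measure. This is what makes s ↦ ℓ(1_s) countably additive.
-/
theorem hasSum_indicatorConstLp_iUnion [IsFiniteMeasure μ] {P : ℝ≥0∞} [Fact (1 ≤ P)] (hP : P ≠ ⊤)
    {f : ℕ → Set X} (hf : ∀ i, MeasurableSet (f i)) (hd : Pairwise (Function.onFun Disjoint f)) :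
    HasSum (fun i => indicatorConstLp P (hf i) (measure_ne_top μ (f i)) (1 : ℝ))
      (indicatorConstLp P (MeasurableSet.iUnion hf) (measure_ne_top μ _) (1 : ℝ)) := by
  have hfin : ∀ s : Finset ℕ, ∑ i ∈ s, indicatorConstLp P (hf i) (measure_ne_top μ (f i)) (1 : ℝ)
      = indicatorConstLp P (s.measurableSet_biUnion fun i _ => hf i) (measure_ne_top μ _) (1 : ℝ) := by
    intro s
    induction s using Finset.induction_on with
    | empty => simp [indicatorConstLp_empty]
    | insert a s ha ih =>
      rw [Finset.sum_insert ha, ih]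
      have hdis : Disjoint (f a) (⋃ i ∈ s, f i) := by
        simp only [Set.disjoint_iUnion_right]
        intro i hi
        exact hd (fun h => ha (h ▸ hi))
      rw [← indicatorConstLp_disjoint_union (hf a) (s.measurableSet_biUnion fun i _ => hf i)
        (measure_ne_top μ _) (measure_ne_top μ _) hdis]
      congr 1
      simp
  unfold HasSum
  simp_rw [hfin]
  refine tendsto_indicatorConstLp_set hP ?_
  have hsub : ∀ s : Finset ℕ, (⋃ i ∈ s, f i) ⊆ ⋃ i, f i := fun s =>
    Set.iUnion₂_subset fun i _ => Set.subset_iUnion f i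
  have hs : ∀ s : Finset ℕ, symmDiff (⋃ i ∈ s, f i) (⋃ i, f i) = (⋃ i, f i) \ ⋃ i ∈ s, f i := by
    intro s
    rw [Set.symmDiff_def, Set.sdiff_eq_empty.2 (hsub s), Set.empty_union]
  simp_rw [hs]
  have hd' : ∀ s : Finset ℕ, μ ((⋃ i, f i) \ ⋃ i ∈ s, f i)
      = μ (⋃ i, f i) - ∑ i ∈ s, μ (f i) := by
    intro s
    rw [measure_sdiff (hsub s) (s.measurableSet_biUnion fun i _ => hf i).nullMeasurableSet
      (measure_ne_top μ _), measure_biUnion_finset (fun i _ j _ hij => hd hij) (fun i _ => hf i)]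
  simp_rw [hd']
  have : Tendsto (fun s : Finset ℕ => ∑ i ∈ s, μ (f i)) atTop (𝓝 (μ (⋃ i, f i))) := by
    rw [measure_iUnion hd hf]
    exact ENNReal.summable.hasSum
  have h2 := ENNReal.Tendsto.sub (tendsto_const_nhds (x := μ (⋃ i, f i)) (f := atTop)) this
    (Or.inl (measure_ne_top μ _))
  simpa using h2

/-- A bounded functional on `L^P`, restricted to indicator functions, is given by an integrable
density. -/
theorem exists_density_of_functional [IsFiniteMeasure μ] {P : ℝ≥0∞} [hP1 : Fact (1 ≤ P)]
    (hP : P ≠ ⊤) (ℓ : Lp ℝ P μ →L[ℝ] ℝ) :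
    ∃ g : X → ℝ, Measurable g ∧ Integrable g μ ∧ ∀ (s : Set X) (hs : MeasurableSet s),
      ℓ (indicatorConstLp P hs (measure_ne_top μ s) 1) = ∫ x in s, g x ∂μ := by
  classical
  -- The set function s ↦ ℓ(1_s). A signed measure must vanish on non-measurable sets, hence the
  -- default value 0.
  let ν : SignedMeasure X :=
    { measureOf' := fun s => if hs : MeasurableSet s then
        ℓ (indicatorConstLp P hs (measure_ne_top μ s) 1) else 0
      empty' := by
        simp
      not_measurable' := fun s hs => by simp [hs]
      m_iUnion' := fun f hf hd => by
        have := (hasSum_indicatorConstLp_iUnion (μ := μ) hP hf hd).mapL ℓ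
        simpa [hf, MeasurableSet.iUnion hf] using this }
  have hν : ∀ (s : Set X) (hs : MeasurableSet s),
      ν s = ℓ (indicatorConstLp P hs (measure_ne_top μ s) 1) := fun s hs => dif_pos hs
  have hac : ν ≪ᵥ μ.toENNRealVectorMeasure := by
    refine VectorMeasure.AbsolutelyContinuous.mk fun s hs h0 => ?_
    rw [Measure.toENNRealVectorMeasure_apply_measurable hs] at h0
    rw [hν s hs]
    have : (indicatorConstLp P hs (measure_ne_top μ s) (1 : ℝ) : Lp ℝ P μ) = 0 := by
      rw [← norm_eq_zero, norm_indicatorConstLp (by have := hP1.out; positivity) hP]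
      have : (1 / P.toReal) ≠ 0 := by
        have := ENNReal.toReal_pos (by have := hP1.out; positivity) hP
        positivity
      rw [Measure.real, h0, ENNReal.toReal_zero, Real.zero_rpow this, mul_zero]
    rw [this, map_zero]
  refine ⟨ν.rnDeriv μ, SignedMeasure.measurable_rnDeriv _ _, SignedMeasure.integrable_rnDeriv _ _,
    fun s hs => ?_⟩
  rw [← withDensityᵥ_apply (SignedMeasure.integrable_rnDeriv _ _) hs,
    SignedMeasure.withDensityᵥ_rnDeriv_eq ν μ hac, hν s hs]

/-- Converse Hölder inequality for a bounded function. -/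
theorem eLpNorm_le_of_pairing_bound [IsFiniteMeasure μ] {p q : ℝ} (hpq : p.HolderConjugate q)
    {g : X → ℝ} (hg : Measurable g) {M : ℝ} (hM : ∀ x, |g x| ≤ M) {C : ℝ} (hC : 0 ≤ C)
    (h : ∀ f : X → ℝ, MemLp f (ENNReal.ofReal p) μ →
      |∫ x, g x * f x ∂μ| ≤ C * (eLpNorm f (ENNReal.ofReal p) μ).toReal) :
    eLpNorm g (ENNReal.ofReal q) μ ≤ ENNReal.ofReal C := by
  have hp := hpq.pos
  have hq := hpq.symm.pos
  have hq1 : 1 < q := hpq.symm.lt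
  -- The extremal function of Hölder's inequality: g f = |g|^q = |f|^p, so the pairing bound reads I
  -- ≤ C I^(1/p) with I = ∫|g|^q.
  set f : X → ℝ := fun x => SignType.sign (g x) * |g x| ^ (q - 1) with hf
  have hsm : Measurable fun x => ((SignType.sign (g x) : SignType) : ℝ) := by
    have : (fun x => ((SignType.sign (g x) : SignType) : ℝ)) =
        fun x => if 0 < g x then 1 else if g x < 0 then -1 else 0 := by
      ext x; rw [sign_apply]; split_ifs <;> simp
    rw [this]
    exact Measurable.ite (measurableSet_lt measurable_const hg) measurable_const
      (Measurable.ite (measurableSet_lt hg measurable_const) measurable_const measurable_const)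
  have hfm : Measurable f := hsm.mul (hg.abs.pow_const _)
  have hgf : ∀ x, g x * f x = |g x| ^ q := by
    intro x
    rw [hf]
    dsimp only
    rw [mul_comm, mul_right_comm, sign_mul_self]
    by_cases h0 : g x = 0
    · simp [h0, hq.ne']
    · rw [← Real.rpow_one_add' (abs_nonneg _) (by linarith)]
      ring_nf
  have hfa : ∀ x, |f x| = |g x| ^ (q - 1) := by
    intro x
    rw [hf]
    dsimp only
    rw [abs_mul, abs_of_nonneg (Real.rpow_nonneg (abs_nonneg _) _)]
    rcases lt_trichotomy (g x) 0 with h0 | h0 | h0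
    · simp [sign_neg h0]
    · simp [h0, Real.zero_rpow (by linarith : q - 1 ≠ 0)]
    · simp [sign_pos h0]
  have hfp : ∀ x, |f x| ^ p = |g x| ^ q := by
    intro x
    rw [hfa, ← Real.rpow_mul (abs_nonneg _), hpq.symm.sub_one_mul_conj]
  have hfL : MemLp f (ENNReal.ofReal p) μ := by
    refine MemLp.of_bound hfm.aestronglyMeasurable (M ^ (q - 1)) (Eventually.of_forall fun x => ?_)
    rw [Real.norm_eq_abs, hfa]
    exact Real.rpow_le_rpow (abs_nonneg _) (hM x) (by linarith)
  set I : ℝ := ∫ x, |g x| ^ q ∂μ with hI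
  have hI0 : 0 ≤ I := integral_nonneg fun x => Real.rpow_nonneg (abs_nonneg _) _
  have hgL : MemLp g (ENNReal.ofReal q) μ :=
    MemLp.of_bound hg.aestronglyMeasurable M (Eventually.of_forall hM)
  have e1 : eLpNorm f (ENNReal.ofReal p) μ = ENNReal.ofReal (I ^ (1 / p)) := by
    rw [hfL.eLpNorm_eq_integral_rpow_norm (by simpa using hp) ENNReal.ofReal_ne_top,
      ENNReal.toReal_ofReal hp.le]
    simp_rw [Real.norm_eq_abs, hfp, one_div]
    rfl
  have e2 : eLpNorm g (ENNReal.ofReal q) μ = ENNReal.ofReal (I ^ (1 / q)) := by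
    rw [hgL.eLpNorm_eq_integral_rpow_norm (by simpa using hq) ENNReal.ofReal_ne_top,
      ENNReal.toReal_ofReal hq.le]
    simp_rw [Real.norm_eq_abs, one_div]
    rfl
  have h1 := h f hfL
  simp_rw [hgf] at h1
  rw [e1, ENNReal.toReal_ofReal (Real.rpow_nonneg hI0 _), abs_of_nonneg hI0] at h1
  rw [e2]
  refine ENNReal.ofReal_le_ofReal ?_
  -- Dividing I ≤ C I^(1/p) by I^(1/p) leaves I^(1/q) ≤ C; this needs I > 0, and I is finite because
  -- g is bounded.
  rcases hI0.eq_or_lt with h0 | h0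
  · rw [← h0, Real.zero_rpow (by positivity)]; exact hC
  · have h2 : I = I ^ (1 / q) * I ^ (1 / p) := by
      rw [← Real.rpow_add h0, one_div, one_div, add_comm, hpq.inv_add_inv_eq_one, Real.rpow_one]
    have h3 : I ^ (1 / q) * I ^ (1 / p) ≤ C * I ^ (1 / p) := by rw [← h2]; exact h1
    exact le_of_mul_le_mul_right h3 (Real.rpow_pos_of_pos h0 _)

/-- The dual of `L^p` for a finite measure. -/
theorem exists_lpPairing_eq [IsFiniteMeasure μ] {p q : ℝ} (hpq : p.HolderConjugate q)
    [Fact (1 ≤ ENNReal.ofReal p)] (ℓ : Lp ℝ (ENNReal.ofReal p) μ →L[ℝ] ℝ) :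
    ∃ g : Lp ℝ (ENNReal.ofReal q) μ, ∀ f, ℓ f = ∫ x, g x * f x ∂μ := by
  have hPQ : ENNReal.HolderConjugate (ENNReal.ofReal q) (ENNReal.ofReal p) := hpq.symm.ennrealOfReal
  have : Fact (1 ≤ ENNReal.ofReal q) := ⟨hPQ.one_le⟩
  have hP : ENNReal.ofReal p ≠ ⊤ := ENNReal.ofReal_ne_top
  obtain ⟨g, hgm, hgi, hg⟩ := exists_density_of_functional hP ℓ
  -- The density g is known only to be integrable. Its truncations to these sets are bounded,
  -- represent ℓ composed with multiplication by the indicator (a contraction), and therefore have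
  -- L^q norm at most ‖ℓ‖ for every n.
  let E : ℕ → Set X := fun n => {x | |g x| ≤ n}
  have hE : ∀ n, MeasurableSet (E n) := fun n => measurableSet_le hgm.abs measurable_const
  let gn : ℕ → X → ℝ := fun n => (E n).indicator g
  have hgn : ∀ n x, |gn n x| ≤ n := by
    intro n x
    by_cases hx : x ∈ E n
    · simp only [gn, Set.indicator_of_mem hx]; exact hx
    · simp [gn, hx]
  have hgnm : ∀ n, Measurable (gn n) := fun n => hgm.indicator (hE n)
  have hgnL : ∀ n, MemLp (gn n) (ENNReal.ofReal q) μ := fun n =>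
    MemLp.of_bound (hgnm n).aestronglyMeasurable n (Eventually.of_forall (hgn n))
  -- multiplication by the indicator of `E n`
  let M : ℕ → Lp ℝ (ENNReal.ofReal p) μ →L[ℝ] Lp ℝ (ENNReal.ofReal p) μ := fun n =>
    (ContinuousLinearMap.mul ℝ ℝ).holderL μ ⊤ (ENNReal.ofReal p) (ENNReal.ofReal p)
      (indicatorConstLp ⊤ (hE n) (measure_ne_top μ _) (1 : ℝ))
  have hM : ∀ n f, M n f =ᵐ[μ] fun x => (E n).indicator (fun _ => (1 : ℝ)) x * f x := by
    intro n f
    have h1 := (ContinuousLinearMap.mul ℝ ℝ).coeFn_holder (r := ENNReal.ofReal p)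
      (indicatorConstLp ⊤ (hE n) (measure_ne_top μ _) (1 : ℝ)) f
    filter_upwards [h1, indicatorConstLp_coeFn (p := ⊤) (hs := hE n) (hμs := measure_ne_top μ _)
      (c := (1 : ℝ))] with x hx hx'
    change (ContinuousLinearMap.mul ℝ ℝ).holder _ _ _ x = _
    rw [hx, hx']
    rfl
  have hMind : ∀ n (s : Set X) (hs : MeasurableSet s),
      M n (indicatorConstLp _ hs (measure_ne_top μ s) 1)
        = indicatorConstLp _ ((hE n).inter hs) (measure_ne_top μ _) 1 := by
    intro n s hs
    apply Lp.ext
    filter_upwards [hM n (indicatorConstLp _ hs (measure_ne_top μ s) 1),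
      indicatorConstLp_coeFn (p := ENNReal.ofReal p) (hs := hs) (hμs := measure_ne_top μ _)
        (c := (1 : ℝ)), indicatorConstLp_coeFn (p := ENNReal.ofReal p) (hs := (hE n).inter hs)
        (hμs := measure_ne_top μ _) (c := (1 : ℝ))] with x h1 h2 h3
    rw [h1, h2, h3]
    by_cases h4 : x ∈ E n <;> by_cases h5 : x ∈ s <;> simp [h4, h5]
  let B : ∀ _ : Lp ℝ (ENNReal.ofReal q) μ, Lp ℝ (ENNReal.ofReal p) μ →L[ℝ] ℝ :=
    fun k => (ContinuousLinearMap.mul ℝ ℝ).lpPairing μ (ENNReal.ofReal q) (ENNReal.ofReal p) k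
  have hB : ∀ k f, B k f = ∫ x, k x * f x ∂μ := fun k f =>
    (ContinuousLinearMap.mul ℝ ℝ).lpPairing_eq_integral k f
  have hBind : ∀ (k : Lp ℝ (ENNReal.ofReal q) μ) (s : Set X) (hs : MeasurableSet s),
      B k (indicatorConstLp _ hs (measure_ne_top μ s) 1) = ∫ x in s, k x ∂μ := by
    intro k s hs
    rw [hB, ← integral_indicator hs]
    apply integral_congr_ae
    filter_upwards [indicatorConstLp_coeFn (p := ENNReal.ofReal p) (hs := hs)
      (hμs := measure_ne_top μ _) (c := (1 : ℝ))] with x h1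
    rw [h1]
    by_cases h5 : x ∈ s <;> simp [h5]
  have key : ∀ n, ℓ.comp (M n) = B ((hgnL n).toLp _) := by
    intro n
    refine Lp_functional_ext hP fun s hs => ?_
    rw [ContinuousLinearMap.comp_apply, hMind, hg, hBind,
      setIntegral_congr_ae (g := gn n) hs (by
        filter_upwards [(hgnL n).coeFn_toLp] with x hx _ using hx),
      setIntegral_indicator (hE n), Set.inter_comm]
  have hMn : ∀ n f, ‖M n f‖ ≤ ‖f‖ := by
    intro n f
    rw [Lp.norm_def, Lp.norm_def]
    refine ENNReal.toReal_mono (Lp.eLpNorm_ne_top f) (eLpNorm_mono_ae ?_)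
    filter_upwards [hM n f] with x hx
    rw [hx, norm_mul]
    refine mul_le_of_le_one_left (norm_nonneg _) ?_
    by_cases h4 : x ∈ E n <;> simp [h4]
  have hbd : ∀ n, eLpNorm (gn n) (ENNReal.ofReal q) μ ≤ ENNReal.ofReal ‖ℓ‖ := by
    intro n
    refine eLpNorm_le_of_pairing_bound hpq (hgnm n) (hgn n) (norm_nonneg _) fun f hf => ?_
    have h1 : ∫ x, gn n x * f x ∂μ = ℓ (M n (hf.toLp f)) := by
      rw [← ContinuousLinearMap.comp_apply, key, hB]
      apply integral_congr_ae
      filter_upwards [(hgnL n).coeFn_toLp, hf.coeFn_toLp] with x h1 h2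
      rw [h1, h2]
    rw [h1, ← Real.norm_eq_abs]
    refine (ℓ.le_opNorm _).trans (mul_le_mul_of_nonneg_left ((hMn n _).trans ?_) (norm_nonneg _))
    rw [Lp.norm_toLp]
  have hgL : MemLp g (ENNReal.ofReal q) μ := by
    refine ⟨hgm.aestronglyMeasurable, ?_⟩
    -- Fatou: the uniform bound on the truncations passes to g.
    refine lt_of_le_of_lt (Lp.eLpNorm_lim_le_liminf_eLpNorm (f := gn)
      (fun n => (hgnm n).aestronglyMeasurable) g (Eventually.of_forall fun x => ?_))
      (lt_of_le_of_lt (b := ENNReal.ofReal ‖ℓ‖) ?_ ENNReal.ofReal_lt_top)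
    · obtain ⟨m, hm⟩ := exists_nat_ge |g x|
      refine tendsto_const_nhds.congr' ?_
      filter_upwards [eventually_ge_atTop m] with n hn
      have : x ∈ E n := hm.trans (by exact_mod_cast hn)
      simp [gn, this]
    · refine (liminf_le_liminf (Eventually.of_forall hbd)).trans ?_
      simp
  refine ⟨hgL.toLp g, fun f => ?_⟩
  rw [← hB]
  congr 1
  refine Lp_functional_ext hP fun s hs => ?_
  rw [hg, hBind]
  refine setIntegral_congr_ae hs ?_
  filter_upwards [hgL.coeFn_toLp] with x hx _ using hx.symm

end LpDuality

/-! ### Reflexive spaces: subspaces, products, L^p, weak cluster points -/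

section Reflexive

variable {X Y : Type*} [NormedAddCommGroup X] [NormedSpace ℝ X] [NormedAddCommGroup Y]
  [NormedSpace ℝ Y]

/-- A normed space is reflexive if the canonical map into its bidual is onto. -/
def IsReflexiveSpace (X : Type*) [NormedAddCommGroup X] [NormedSpace ℝ X] : Prop :=
  Function.Surjective (NormedSpace.inclusionInDoubleDual ℝ X)

theorem IsReflexiveSpace.exists_eq (h : IsReflexiveSpace X)
    (Φ : StrongDual ℝ (StrongDual ℝ X)) : ∃ x, ∀ f, Φ f = f x := by
  obtain ⟨x, hx⟩ := h Φ
  exact ⟨x, fun f => by rw [← hx, NormedSpace.dual_def]⟩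

theorem isReflexiveSpace_of_forall
    (h : ∀ Φ : StrongDual ℝ (StrongDual ℝ X), ∃ x, ∀ f, Φ f = f x) : IsReflexiveSpace X := by
  intro Φ
  obtain ⟨x, hx⟩ := h Φ
  exact ⟨x, by ext f; rw [NormedSpace.dual_def, hx]⟩

/-- A point outside a closed subspace is separated from it by a functional. -/
theorem exists_dual_separating (S : Submodule ℝ X) (hS : IsClosed (S : Set X)) {x : X}
    (hx : x ∉ S) : ∃ f : StrongDual ℝ X, (∀ y ∈ S, f y = 0) ∧ f x ≠ 0 := by
  obtain ⟨f, u, h1, h2⟩ := geometric_hahn_banach_closed_point S.convex hS hx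
  have h0 : ∀ y ∈ S, f y = 0 := by
    intro y hy
    by_contra hne
    -- On this multiple of y the functional takes the value 2|u| + 1 > u, against the separation
    -- bound: a functional bounded above on a subspace vanishes there.
    have h3 := h1 (((2 * |u| + 1) / f y) • y) (S.smul_mem _ hy)
    rw [map_smul, smul_eq_mul, div_mul_cancel₀ _ hne] at h3
    have := le_abs_self u
    have := abs_nonneg u
    linarith
  refine ⟨f, h0, ?_⟩
  have := h1 0 S.zero_mem
  rw [map_zero] at this
  linarith

/-- A complete space that embeds into a reflexive space is reflexive. -/
theorem IsReflexiveSpace.of_antilipschitz [CompleteSpace X] [CompleteSpace Y] (hY : IsReflexiveSpace Y)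
    (T : X →L[ℝ] Y) {K : ℝ≥0} (hT : AntilipschitzWith K T) : IsReflexiveSpace X := by
  refine isReflexiveSpace_of_forall fun Φ => ?_
  let Ψ : StrongDual ℝ (StrongDual ℝ Y) := Φ.comp ((ContinuousLinearMap.compL ℝ X Y ℝ).flip T)
  have hΨ : ∀ f, Ψ f = Φ (f.comp T) := fun f => rfl
  obtain ⟨y, hy⟩ := hY.exists_eq Ψ
  have hcl : IsClosed (T.range : Set Y) := by
    rw [show (T.range : Set Y) = Set.range T from rfl]
    exact hT.isClosed_range T.uniformContinuous
  -- Functionals that vanish on the closed range of T pull back to 0 and so are annihilated by Ψ; by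
  -- separation y cannot lie outside the range.
  have hyr : y ∈ T.range := by
    by_contra hny
    obtain ⟨f, hf, hfy⟩ := exists_dual_separating _ hcl hny
    refine hfy ?_
    rw [← hy, hΨ]
    have : f.comp T = 0 := by
      ext x
      exact hf _ ⟨x, rfl⟩
    rw [this, map_zero]
  obtain ⟨x, rfl⟩ := hyr
  refine ⟨x, fun g => ?_⟩
  let e : X ≃L[ℝ] T.range := T.equivRange hT.injective hcl
  -- Hahn–Banach on the range of T shows that every functional on X is of the form f ∘ T, so it
  -- suffices to know Φ on these.
  obtain ⟨f, hf, -⟩ := exists_extension_norm_eq T.range (g.comp e.symm.toContinuousLinearMap)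
  have hfT : f.comp T = g := by
    ext z
    have h := hf (e z)
    rw [ContinuousLinearMap.comp_apply, ContinuousLinearEquiv.coe_coe, e.symm_apply_apply] at h
    exact h
  rw [← hfT, ← hΨ, hy]
  rfl

/-- A functional on the product is the sum of its restrictions to the factors, so the bidual splits
in the same way. -/
theorem IsReflexiveSpace.prod (hX : IsReflexiveSpace X) (hY : IsReflexiveSpace Y) :
    IsReflexiveSpace (X × Y) := by
  refine isReflexiveSpace_of_forall fun Φ => ?_
  obtain ⟨x, hx⟩ := hX.exists_eq
    (Φ.comp ((ContinuousLinearMap.compL ℝ (X × Y) X ℝ).flip (ContinuousLinearMap.fst ℝ X Y)))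
  obtain ⟨y, hy⟩ := hY.exists_eq
    (Φ.comp ((ContinuousLinearMap.compL ℝ (X × Y) Y ℝ).flip (ContinuousLinearMap.snd ℝ X Y)))
  refine ⟨(x, y), fun f => ?_⟩
  have h1 : f = (f.comp (ContinuousLinearMap.inl ℝ X Y)).comp (ContinuousLinearMap.fst ℝ X Y)
      + (f.comp (ContinuousLinearMap.inr ℝ X Y)).comp (ContinuousLinearMap.snd ℝ X Y) := by
    ext z <;> simp [← map_add]
  have h2 : Φ f = f.comp (ContinuousLinearMap.inl ℝ X Y) x
      + f.comp (ContinuousLinearMap.inr ℝ X Y) y := by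
    conv_lhs => rw [h1, map_add]
    rw [← hx, ← hy]
    rfl
  rw [h2, ContinuousLinearMap.comp_apply, ContinuousLinearMap.comp_apply, ← map_add]
  simp

theorem IsReflexiveSpace.pi {ι : Type*} [Fintype ι] [DecidableEq ι] (hX : IsReflexiveSpace X) :
    IsReflexiveSpace (ι → X) := by
  refine isReflexiveSpace_of_forall fun Φ => ?_
  choose x hx using fun i => hX.exists_eq
    (Φ.comp ((ContinuousLinearMap.compL ℝ (ι → X) X ℝ).flip
      (ContinuousLinearMap.proj (φ := fun _ : ι => X) i)))
  refine ⟨x, fun f => ?_⟩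
  have h1 : f = ∑ i, (f.comp (ContinuousLinearMap.single ℝ (fun _ : ι => X) i)).comp
      (ContinuousLinearMap.proj (φ := fun _ : ι => X) i) := by
    ext z
    rw [_root_.sum_apply]
    conv_lhs => rw [← Finset.univ_sum_single z, map_sum]
    rfl
  have h2 : Φ f = ∑ i, f (Pi.single i (x i)) := by
    conv_lhs => rw [h1, map_sum]
    refine Finset.sum_congr rfl fun i _ => ?_
    have := hx i (f.comp (ContinuousLinearMap.single ℝ (fun _ : ι => X) i))
    simpa using this
  rw [h2, ← map_sum, Finset.univ_sum_single]

/-- In a reflexive space, a bounded sequence has a weak cluster point along an ultrafilter. -/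
theorem IsReflexiveSpace.exists_tendsto_ultrafilter (hX : IsReflexiveSpace X) {x : ℕ → X} {C : ℝ}
    (hC : ∀ n, ‖x n‖ ≤ C) (U : Ultrafilter ℕ) :
    ∃ y, ∀ f : StrongDual ℝ X, Tendsto (fun n => f (x n)) U (𝓝 (f y)) := by
  have hb : ∀ f : StrongDual ℝ X, ∃ l, |l| ≤ C * ‖f‖ ∧ Tendsto (fun n => f (x n)) U (𝓝 l) := by
    intro f
    have hmem : ∀ n, f (x n) ∈ Metric.closedBall (0 : ℝ) (C * ‖f‖) := by
      intro n
      rw [mem_closedBall_zero_iff, mul_comm]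
      exact (f.le_opNorm _).trans (mul_le_mul_of_nonneg_left (hC n) (norm_nonneg _))
    obtain ⟨l, hl, hlim⟩ := (isCompact_closedBall (0 : ℝ) (C * ‖f‖)).ultrafilter_le_nhds
      (U.map fun n => f (x n)) (by
        rw [Ultrafilter.coe_map, le_principal_iff]
        exact Filter.mem_map.2 (Eventually.of_forall hmem))
    exact ⟨l, by simpa using hl, hlim⟩
  choose L hL1 hL2 using hb
  -- Limits along an ultrafilter depend linearly on f and keep the bound C‖f‖, so they form an
  -- element of the bidual; reflexivity turns it into a point.
  let Φ : StrongDual ℝ (StrongDual ℝ X) := LinearMap.mkContinuous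
    { toFun := L
      map_add' := fun f g => tendsto_nhds_unique (hL2 (f + g)) ((hL2 f).add (hL2 g))
      map_smul' := fun c f => tendsto_nhds_unique (hL2 (c • f)) ((hL2 f).const_mul c) } C hL1
  obtain ⟨y, hy⟩ := hX.exists_eq Φ
  refine ⟨y, fun f => ?_⟩
  rw [← hy]
  exact hL2 f

/-- Restricted along L^q → (L^p)', an element of the bidual is a functional on L^q, hence given by
some f in L^p. Since L^q → (L^p)' is onto, f represents it on all of (L^p)'. -/
theorem isReflexiveSpace_Lp {α : Type*} [MeasurableSpace α] {μ : Measure α} [IsFiniteMeasure μ]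
    {p q : ℝ} (hpq : p.HolderConjugate q) [Fact (1 ≤ ENNReal.ofReal p)] :
    IsReflexiveSpace (Lp ℝ (ENNReal.ofReal p) μ) := by
  have hPQ : ENNReal.HolderConjugate (ENNReal.ofReal q) (ENNReal.ofReal p) := hpq.symm.ennrealOfReal
  have : Fact (1 ≤ ENNReal.ofReal q) := ⟨hPQ.one_le⟩
  refine isReflexiveSpace_of_forall fun Φ => ?_
  let B : Lp ℝ (ENNReal.ofReal q) μ →L[ℝ] StrongDual ℝ (Lp ℝ (ENNReal.ofReal p) μ) :=
    (ContinuousLinearMap.mul ℝ ℝ).lpPairing μ (ENNReal.ofReal q) (ENNReal.ofReal p)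
  have hB : ∀ k f, B k f = ∫ x, k x * f x ∂μ := fun k f =>
    (ContinuousLinearMap.mul ℝ ℝ).lpPairing_eq_integral k f
  obtain ⟨f, hf⟩ := exists_lpPairing_eq hpq.symm (Φ.comp B)
  refine ⟨f, fun ℓ => ?_⟩
  obtain ⟨g, hg⟩ := exists_lpPairing_eq hpq ℓ
  have : ℓ = B g := by
    ext k
    rw [hg, hB]
  rw [this, hB]
  have h1 := hf g
  rw [ContinuousLinearMap.comp_apply] at h1
  rw [h1]
  simp_rw [mul_comm]

end Reflexive

/-! ### W^{1,p}(Ω) and V: completeness, reflexivity, separability -/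

section SobolevSpace

variable {N : ℕ} {Ω : Set (EucSp N)} {p : ℝ}

theorem isFiniteMeasure_domMeasure (hb : Bornology.IsBounded Ω) : IsFiniteMeasure (domMeasure Ω) :=
  isFiniteMeasure_restrict.2 hb.measure_lt_top.ne

theorem inner_gradient (φ : EucSp N → ℝ) (x v : EucSp N) :
    inner ℝ (gradient φ x) v = fderiv ℝ φ x v := by
  rw [← toDual_gradient, InnerProductSpace.toDual_apply_apply]

theorem norm_gradient_eq (φ : EucSp N → ℝ) (x : EucSp N) : ‖gradient φ x‖ = ‖fderiv ℝ φ x‖ := by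
  rw [← toDual_gradient, LinearIsometryEquiv.norm_map]

theorem continuous_gradient {φ : EucSp N → ℝ} (h : ContDiff ℝ 1 φ) : Continuous (gradient φ) :=
  (InnerProductSpace.toDual ℝ (EucSp N)).symm.continuous.comp (h.continuous_fderiv one_ne_zero)

theorem memLp_domMeasure_of_continuous {F : Type*} [NormedAddCommGroup F] 
    [SecondCountableTopologyEither (EucSp N) F]
    (hb : Bornology.IsBounded Ω) {f : EucSp N → F} (hf : Continuous f) (P : ℝ≥0∞) :
    MemLp f P (domMeasure Ω) := by
  have := isFiniteMeasure_domMeasure hb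
  obtain ⟨C, hC⟩ := hb.isCompact_closure.exists_bound_of_continuousOn hf.continuousOn
  refine MemLp.of_bound hf.aestronglyMeasurable C ?_
  have h1 : ∀ᵐ x ∂(domMeasure Ω), x ∈ closure Ω := by
    refine ae_restrict_of_ae_restrict_of_subset subset_closure ?_
    exact ae_restrict_mem isClosed_closure.measurableSet
  filter_upwards [h1] with x hx using hC x hx

/-- `C¹` functions satisfy the weak gradient identity. -/
theorem hasWeakGradient_of_contDiff {φ : EucSp N → ℝ}
    (h : ContDiff ℝ 1 φ) : HasWeakGradient Ω φ (gradient φ) := by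
  intro χ hχ hc hs v
  have hχ1 : ContDiff ℝ 1 χ := hχ.of_le (by simp)
  have hd : Continuous fun x => fderiv ℝ χ x v :=
    (hχ1.continuous_fderiv one_ne_zero).clm_apply continuous_const
  have hdφ : Continuous fun x => fderiv ℝ φ x v :=
    (h.continuous_fderiv one_ne_zero).clm_apply continuous_const
  have hdc : HasCompactSupport fun x => fderiv ℝ χ x v := hc.fderiv_apply ℝ v
  have e1 : ∫ x, φ x * fderiv ℝ χ x v ∂(domMeasure Ω) = ∫ x, φ x * fderiv ℝ χ x v := by
    refine setIntegral_eq_integral_of_forall_compl_eq_zero fun x hx => ?_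
    have : x ∉ tsupport (fderiv ℝ χ) := fun h' => hx (hs (tsupport_fderiv_subset ℝ h'))
    rw [image_eq_zero_of_notMem_tsupport this]
    simp
  have e2 : ∫ x, χ x * inner ℝ (gradient φ x) v ∂(domMeasure Ω) = ∫ x, fderiv ℝ φ x v * χ x := by
    rw [domMeasure, setIntegral_eq_integral_of_forall_compl_eq_zero fun x hx => ?_]
    · refine integral_congr_ae (Eventually.of_forall fun x => ?_)
      simp only [inner_gradient, mul_comm]
    · have : x ∉ tsupport χ := fun h' => hx (hs h')
      rw [image_eq_zero_of_notMem_tsupport this, zero_mul]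
  rw [e1, e2]
  refine integral_mul_fderiv_eq_neg_fderiv_mul_of_integrable ?_ ?_ ?_
    (fun x _ => h.differentiable one_ne_zero x) (fun x _ => hχ1.differentiable one_ne_zero x)
  · exact (hdφ.mul hχ.continuous).integrable_of_hasCompactSupport hc.mul_left
  · exact (h.continuous.mul hd).integrable_of_hasCompactSupport hdc.mul_left
  · exact (h.continuous.mul hχ.continuous).integrable_of_hasCompactSupport hc.mul_left

/-- The fundamental lemma of the calculus of variations, with integrals over Ω as in
`HasWeakGradient` instead of over the whole space. -/
theorem ae_eq_zero_of_forall_test {F : Type*} [NormedAddCommGroup F] [NormedSpace ℝ F]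
    [CompleteSpace F] (ho : IsOpen Ω)
    {f : EucSp N → F} (hf : LocallyIntegrableOn f Ω)
    (h : ∀ φ : EucSp N → ℝ, ContDiff ℝ ∞ φ → HasCompactSupport φ → tsupport φ ⊆ Ω →
      ∫ x, φ x • f x ∂(domMeasure Ω) = 0) : f =ᵐ[domMeasure Ω] 0 := by
  have := ho.ae_eq_zero_of_integral_contDiff_smul_eq_zero (μ := volume) hf (fun φ h1 h2 h3 => by
    rw [← h φ h1 h2 h3]
    refine (setIntegral_eq_integral_of_forall_compl_eq_zero fun x hx => ?_).symm
    have : x ∉ tsupport φ := fun h' => hx (h3 h')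
    rw [image_eq_zero_of_notMem_tsupport this, zero_smul])
  exact (ae_restrict_iff' ho.measurableSet).2 this

theorem locallyIntegrableOn_of_memLp {F : Type*} [NormedAddCommGroup F] 
    {f : EucSp N → F} {P : ℝ≥0∞} (hP : 1 ≤ P)
    (hf : MemLp f P (domMeasure Ω)) : LocallyIntegrableOn f Ω := by
  intro x _
  refine ⟨Metric.ball x 1 ∩ Ω, inter_mem (mem_nhdsWithin_of_mem_nhds (Metric.ball_mem_nhds _ one_pos))
    self_mem_nhdsWithin, ?_⟩
  have : IsFiniteMeasure ((volume : Measure (EucSp N)).restrict (Metric.ball x 1 ∩ Ω)) :=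
    isFiniteMeasure_restrict.2
      ((measure_mono Set.inter_subset_left).trans_lt measure_ball_lt_top).ne
  have h2 : MemLp f P (volume.restrict (Metric.ball x 1 ∩ Ω)) :=
    hf.mono_measure (Measure.restrict_mono Set.inter_subset_right le_rfl)
  exact h2.integrable hP

variable [hp : Fact (1 < p)]

theorem one_le_ofReal_of_fact : 1 ≤ ENNReal.ofReal p := by simpa using hp.out.le

namespace SobolevW1p

theorem memLp_fn (u : SobolevW1p Ω p) : MemLp u.fn (ENNReal.ofReal p) (domMeasure Ω) := Lp.memLp _

theorem memLp_grad (u : SobolevW1p Ω p) : MemLp u.grad (ENNReal.ofReal p) (domMeasure Ω) :=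
  Lp.memLp _

theorem hasWeakGradient (u : SobolevW1p Ω p) : HasWeakGradient Ω u.fn u.grad := u.2

theorem fn_add (u v : SobolevW1p Ω p) : (u + v).fn =ᵐ[domMeasure Ω] u.fn + v.fn :=
  Lp.coeFn_add _ _

theorem fn_sub (u v : SobolevW1p Ω p) : (u - v).fn =ᵐ[domMeasure Ω] u.fn - v.fn :=
  Lp.coeFn_sub _ _

theorem fn_smul (c : ℝ) (u : SobolevW1p Ω p) : (c • u).fn =ᵐ[domMeasure Ω] c • u.fn :=
  Lp.coeFn_smul _ _

theorem grad_add (u v : SobolevW1p Ω p) : (u + v).grad =ᵐ[domMeasure Ω] u.grad + v.grad :=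
  Lp.coeFn_add _ _

theorem grad_sub (u v : SobolevW1p Ω p) : (u - v).grad =ᵐ[domMeasure Ω] u.grad - v.grad :=
  Lp.coeFn_sub _ _

theorem grad_smul (c : ℝ) (u : SobolevW1p Ω p) : (c • u).grad =ᵐ[domMeasure Ω] c • u.grad :=
  Lp.coeFn_smul _ _

/-- The element of `W^{1,p}(Ω)` given by a function and its weak gradient. -/
noncomputable def mk {f : EucSp N → ℝ} {g : EucSp N → EucSp N}
    (hf : MemLp f (ENNReal.ofReal p) (domMeasure Ω))
    (hg : MemLp g (ENNReal.ofReal p) (domMeasure Ω)) (h : HasWeakGradient Ω f g) :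
    SobolevW1p Ω p :=
  ⟨WithLp.toLp _ (hf.toLp f, hg.toLp g), by
    intro φ h1 h2 h3 v
    have := h φ h1 h2 h3 v
    have e1 : ∫ x, (hf.toLp f) x * fderiv ℝ φ x v ∂(domMeasure Ω)
        = ∫ x, f x * fderiv ℝ φ x v ∂(domMeasure Ω) := integral_congr_ae (by
      filter_upwards [hf.coeFn_toLp] with x hx
      rw [hx])
    have e2 : ∫ x, φ x * inner ℝ ((hg.toLp g) x) v ∂(domMeasure Ω)
        = ∫ x, φ x * inner ℝ (g x) v ∂(domMeasure Ω) := integral_congr_ae (by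
      filter_upwards [hg.coeFn_toLp] with x hx
      rw [hx])
    exact e1.trans (this.trans (by rw [← e2]; rfl))⟩

theorem fn_mk {f : EucSp N → ℝ} {g : EucSp N → EucSp N}
    (hf : MemLp f (ENNReal.ofReal p) (domMeasure Ω))
    (hg : MemLp g (ENNReal.ofReal p) (domMeasure Ω)) (h : HasWeakGradient Ω f g) :
    (mk hf hg h).fn =ᵐ[domMeasure Ω] f := hf.coeFn_toLp

theorem grad_mk {f : EucSp N → ℝ} {g : EucSp N → EucSp N}
    (hf : MemLp f (ENNReal.ofReal p) (domMeasure Ω))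
    (hg : MemLp g (ENNReal.ofReal p) (domMeasure Ω)) (h : HasWeakGradient Ω f g) :
    (mk hf hg h).grad =ᵐ[domMeasure Ω] g := hg.coeFn_toLp

/-- The weak gradient of u - v, paired with any fixed vector, annihilates all test functions because
u - v vanishes almost everywhere. -/
theorem grad_unique (ho : IsOpen Ω) {u v : SobolevW1p Ω p} (h : u.fn =ᵐ[domMeasure Ω] v.fn) :
    u.grad =ᵐ[domMeasure Ω] v.grad := by
  have h1 : (u - v).grad =ᵐ[domMeasure Ω] 0 := by
    refine ae_eq_zero_of_forall_test ho
      (locallyIntegrableOn_of_memLp one_le_ofReal_of_fact (u - v).memLp_grad) fun φ hφ hc hs => ?_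
    refine ext_inner_right ℝ fun w => ?_
    have hint : Integrable (fun x => φ x • (u - v).grad x) (domMeasure Ω) := by
      have : ENNReal.HolderConjugate (ENNReal.ofReal p) (ENNReal.conjExponent (ENNReal.ofReal p)) :=
        ENNReal.HolderConjugate.conjExponent one_le_ofReal_of_fact
      have := MemLp.smul (r := 1) (u - v).memLp_grad
        (memLp_of_continuous_compactSupport (Ω := Ω) hφ.continuous hc
          (ENNReal.conjExponent (ENNReal.ofReal p)))
      exact memLp_one_iff_integrable.1 this
    rw [real_inner_comm, ← integral_inner hint, inner_zero_left]
    have h2 := (u - v).hasWeakGradient φ hφ hc hs w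
    have h3 : ∫ x, (u - v).fn x * fderiv ℝ φ x w ∂(domMeasure Ω) = 0 := by
      refine integral_eq_zero_of_ae ?_
      filter_upwards [fn_sub u v, h] with x h4 h5
      rw [h4, Pi.sub_apply, h5]
      simp
    rw [h3] at h2
    rw [← neg_eq_zero, h2]
    congr 1
    refine integral_congr_ae (Eventually.of_forall fun x => ?_)
    simp only [real_inner_smul_right, real_inner_comm]
  filter_upwards [h1, grad_sub u v] with x h2 h3
  rw [h2] at h3
  exact (sub_eq_zero.1 h3.symm)

/-- Elements are pairs (u, ∇u); openness of Ω makes the second entry redundant. This later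
identifies a weak limit from its function component alone. -/
protected theorem ext (ho : IsOpen Ω) {u v : SobolevW1p Ω p} (h : u.fn =ᵐ[domMeasure Ω] v.fn) :
    u = v := by
  apply Subtype.ext
  apply (WithLp.equiv _ _).injective
  exact Prod.ext (Lp.ext h) (Lp.ext (grad_unique ho h))

end SobolevW1p

/-- Testing against a compactly supported continuous function, as a functional on `L^p(Ω)`. -/
noncomputable def testFunctional (Ω : Set (EucSp N)) (P : ℝ≥0∞) [hP : Fact (1 ≤ P)]
    {φ : EucSp N → ℝ} (h : Continuous φ) (hc : HasCompactSupport φ) : Lp ℝ P (domMeasure Ω) →L[ℝ] ℝ :=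
  haveI : ENNReal.HolderConjugate (ENNReal.conjExponent P) P :=
    (ENNReal.HolderConjugate.conjExponent hP.out).symm
  haveI : Fact (1 ≤ ENNReal.conjExponent P) := ⟨ENNReal.HolderConjugate.one_le _ P⟩
  (ContinuousLinearMap.mul ℝ ℝ).lpPairing (domMeasure Ω) (ENNReal.conjExponent P) P
    ((memLp_of_continuous_compactSupport h hc (ENNReal.conjExponent P)).toLp φ)

theorem testFunctional_apply (P : ℝ≥0∞) [hP : Fact (1 ≤ P)] {φ : EucSp N → ℝ} (h : Continuous φ)
    (hc : HasCompactSupport φ) (f : Lp ℝ P (domMeasure Ω)) :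
    testFunctional Ω P h hc f = ∫ x, f x * φ x ∂(domMeasure Ω) := by
  have : ENNReal.HolderConjugate (ENNReal.conjExponent P) P :=
    (ENNReal.HolderConjugate.conjExponent hP.out).symm
  have : Fact (1 ≤ ENNReal.conjExponent P) := ⟨ENNReal.HolderConjugate.one_le _ P⟩
  rw [testFunctional, ContinuousLinearMap.lpPairing_eq_integral]
  refine integral_congr_ae ?_
  filter_upwards [(memLp_of_continuous_compactSupport h hc (Ω := Ω)
    (ENNReal.conjExponent P)).coeFn_toLp] with x hx
  rw [hx, ContinuousLinearMap.mul_apply', mul_comm]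

/-- For a fixed test function and direction, both sides of the weak gradient identity are continuous
in the pair (u, ∇u), so the space is an intersection of closed sets. -/
theorem isClosed_sobolevSubmodule (Ω : Set (EucSp N)) (p : ℝ) [Fact (1 < p)] :
    IsClosed (sobolevSubmodule Ω p : Set (WithLp (ENNReal.ofReal p)
      (Lp ℝ (ENNReal.ofReal p) (domMeasure Ω) × Lp (EucSp N) (ENNReal.ofReal p) (domMeasure Ω)))) := by
  have : (sobolevSubmodule Ω p : Set (WithLp (ENNReal.ofReal p)
      (Lp ℝ (ENNReal.ofReal p) (domMeasure Ω) × Lp (EucSp N) (ENNReal.ofReal p) (domMeasure Ω))))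
      = ⋂ (φ : EucSp N → ℝ) (h1 : ContDiff ℝ ∞ φ) (h2 : HasCompactSupport φ) (_ : tsupport φ ⊆ Ω)
        (v : EucSp N), {w | testFunctional Ω (ENNReal.ofReal p)
          ((h1.continuous_fderiv (by simp)).clm_apply continuous_const)
          (h2.fderiv_apply ℝ v) w.fst = - testFunctional Ω (ENNReal.ofReal p) h1.continuous h2
            ((innerSL ℝ v).compLpL (ENNReal.ofReal p) (domMeasure Ω) w.snd)} := by
    ext w
    simp only [Set.mem_iInter, Set.mem_ofPred_eq, testFunctional_apply]
    refine forall_congr' fun φ => forall_congr' fun h1 => forall_congr' fun h2 =>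
      forall_congr' fun h3 => forall_congr' fun v => ?_
    have e : ∫ x, ((innerSL ℝ v).compLpL (ENNReal.ofReal p) (domMeasure Ω) w.snd) x * φ x
        ∂(domMeasure Ω) = ∫ x, φ x * inner ℝ (w.snd x) v ∂(domMeasure Ω) := by
      refine integral_congr_ae ?_
      filter_upwards [(innerSL ℝ v).coeFn_compLpL w.snd] with x hx
      rw [hx, innerSL_apply_apply, real_inner_comm, mul_comm]
    rw [e]
  rw [this]
  refine isClosed_iInter fun φ => isClosed_iInter fun h1 => isClosed_iInter fun h2 =>
    isClosed_iInter fun h3 => isClosed_iInter fun v => ?_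
  refine isClosed_eq ?_ ?_
  · exact (ContinuousLinearMap.continuous _).comp (WithLp.continuous_fst _ _ _)
  · exact ((ContinuousLinearMap.continuous _).comp ((ContinuousLinearMap.continuous _).comp
      (WithLp.continuous_snd _ _ _))).neg

instance completeSpace_sobolevW1p : CompleteSpace (SobolevW1p Ω p) :=
  (isClosed_sobolevSubmodule Ω p).completeSpace_coe

/-- The ℓ^P norm on a product is equivalent to the maximum norm. Reflexivity and second countability
can therefore be transferred from the plain product. -/
theorem exists_antilipschitz_prod_subtype {A B : Type*} [NormedAddCommGroup A] [NormedSpace ℝ A]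
    [NormedAddCommGroup B] [NormedSpace ℝ B] (P : ℝ≥0∞) [Fact (1 ≤ P)]
    (S : Submodule ℝ (WithLp P (A × B))) :
    ∃ K, AntilipschitzWith K
      ((WithLp.prodContinuousLinearEquiv P ℝ A B).toContinuousLinearMap.comp S.subtypeL) := by
  obtain ⟨K, hK⟩ : ∃ K, AntilipschitzWith K (WithLp.prodContinuousLinearEquiv P ℝ A B) :=
    ⟨_, (WithLp.prodContinuousLinearEquiv P ℝ A B).antilipschitz⟩
  refine ⟨K, fun x y => ?_⟩
  exact hK x.1 y.1

/-- Splitting of `W^{1,p}(Ω)` into function and gradient. -/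
noncomputable def SobolevW1p.split (Ω : Set (EucSp N)) (p : ℝ) [Fact (1 < p)] : SobolevW1p Ω p →L[ℝ]
    Lp ℝ (ENNReal.ofReal p) (domMeasure Ω) × Lp (EucSp N) (ENNReal.ofReal p) (domMeasure Ω) :=
  (WithLp.prodContinuousLinearEquiv (ENNReal.ofReal p) ℝ _ _).toContinuousLinearMap.comp
    (sobolevSubmodule Ω p).subtypeL

theorem SobolevW1p.exists_antilipschitz_split (Ω : Set (EucSp N)) (p : ℝ) [Fact (1 < p)] :
    ∃ K, AntilipschitzWith K (SobolevW1p.split Ω p) :=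
  exists_antilipschitz_prod_subtype _ _

/-- Taking coordinates embeds the space into a finite power of scalar L^p, and reassembling the
coordinates is a bounded left inverse. -/
theorem isReflexiveSpace_Lp_euclidean (hb : Bornology.IsBounded Ω) :
    IsReflexiveSpace (Lp (EucSp N) (ENNReal.ofReal p) (domMeasure Ω)) := by
  have := isFiniteMeasure_domMeasure hb
  let T : Lp (EucSp N) (ENNReal.ofReal p) (domMeasure Ω) →L[ℝ]
      (Fin N → Lp ℝ (ENNReal.ofReal p) (domMeasure Ω)) :=
    ContinuousLinearMap.pi fun i =>
      (EuclideanSpace.proj (𝕜 := ℝ) i).compLpL (ENNReal.ofReal p) (domMeasure Ω)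
  let e : Fin N → EucSp N := fun i => EuclideanSpace.single i 1
  let S : (Fin N → Lp ℝ (ENNReal.ofReal p) (domMeasure Ω)) →L[ℝ]
      Lp (EucSp N) (ENNReal.ofReal p) (domMeasure Ω) :=
    ∑ i, ((ContinuousLinearMap.toSpanSingleton ℝ (e i)).compLpL (ENNReal.ofReal p)
      (domMeasure Ω)).comp (ContinuousLinearMap.proj i)
  have hST : ∀ g, S (T g) = g := by
    intro g
    have h1 : S (T g) = ∑ i, (ContinuousLinearMap.toSpanSingleton ℝ (e i)).compLpL
        (ENNReal.ofReal p) (domMeasure Ω) ((EuclideanSpace.proj (𝕜 := ℝ) i).compLpL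
          (ENNReal.ofReal p) (domMeasure Ω) g) := by
      simp only [S, T, _root_.sum_apply]
      rfl
    rw [h1]
    apply Lp.ext
    have h2 : ∀ᵐ x ∂(domMeasure Ω), ∀ i, ((ContinuousLinearMap.toSpanSingleton ℝ (e i)).compLpL
        (ENNReal.ofReal p) (domMeasure Ω) ((EuclideanSpace.proj (𝕜 := ℝ) i).compLpL
          (ENNReal.ofReal p) (domMeasure Ω) g)) x = g x i • e i := by
      rw [ae_all_iff]
      intro i
      filter_upwards [(ContinuousLinearMap.toSpanSingleton ℝ (e i)).coeFn_compLpL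
        ((EuclideanSpace.proj (𝕜 := ℝ) i).compLpL (ENNReal.ofReal p) (domMeasure Ω) g),
        (EuclideanSpace.proj (𝕜 := ℝ) i).coeFn_compLpL g] with x h3 h4
      rw [h3, h4]
      rfl
    filter_upwards [h2, Lp.coeFn_finsetSum Finset.univ (fun i =>
      (ContinuousLinearMap.toSpanSingleton ℝ (e i)).compLpL
        (ENNReal.ofReal p) (domMeasure Ω) ((EuclideanSpace.proj (𝕜 := ℝ) i).compLpL
          (ENNReal.ofReal p) (domMeasure Ω) g))] with x h3 h4
    rw [h4, Finset.sum_apply]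
    simp_rw [h3]
    ext j
    simp [e, Pi.single_apply]
  have hT : AntilipschitzWith ‖S‖₊ T := S.lipschitz.to_rightInverse hST
  exact IsReflexiveSpace.of_antilipschitz
    (IsReflexiveSpace.pi (isReflexiveSpace_Lp (Real.HolderConjugate.conjExponent hp.out))) T hT

theorem isReflexiveSpace_sobolevW1p (hb : Bornology.IsBounded Ω) :
    IsReflexiveSpace (SobolevW1p Ω p) := by
  have := isFiniteMeasure_domMeasure hb
  obtain ⟨K, hK⟩ := SobolevW1p.exists_antilipschitz_split Ω p
  exact IsReflexiveSpace.of_antilipschitz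
    ((isReflexiveSpace_Lp (Real.HolderConjugate.conjExponent hp.out)).prod
      (isReflexiveSpace_Lp_euclidean hb)) _ hK

theorem secondCountable_sobolevW1p (hb : Bornology.IsBounded Ω) :
    SecondCountableTopology (SobolevW1p Ω p) := by
  have := isFiniteMeasure_domMeasure hb
  have : Fact (ENNReal.ofReal p ≠ ⊤) := ⟨ENNReal.ofReal_ne_top⟩
  have : SecondCountableTopology (Lp ℝ (ENNReal.ofReal p) (domMeasure Ω)) := inferInstance
  have : SecondCountableTopology (Lp (EucSp N) (ENNReal.ofReal p) (domMeasure Ω)) := inferInstance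
  obtain ⟨K, hK⟩ := SobolevW1p.exists_antilipschitz_split Ω p
  exact (hK.isUniformEmbedding (SobolevW1p.split Ω p).uniformContinuous).isEmbedding.secondCountableTopology

/-- Agreement of an L^p function with an L² function can be tested against compactly supported
smooth functions, and each such condition is continuous for both norms. -/
theorem isClosed_spaceVSubmodule (ho : IsOpen Ω) :
    IsClosed (spaceVSubmodule Ω p : Set (WithLp 1 (SobolevW1p Ω p × Lp ℝ 2 (domMeasure Ω)))) := by
  have : (spaceVSubmodule Ω p : Set (WithLp 1 (SobolevW1p Ω p × Lp ℝ 2 (domMeasure Ω))))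
      = ⋂ (φ : EucSp N → ℝ) (h1 : ContDiff ℝ ∞ φ) (h2 : HasCompactSupport φ) (_ : tsupport φ ⊆ Ω),
        {w | testFunctional Ω (ENNReal.ofReal p) h1.continuous h2 (SobolevW1p.split Ω p w.fst).1 =
          testFunctional Ω 2 h1.continuous h2 w.snd} := by
    ext w
    simp only [Set.mem_iInter, Set.mem_ofPred_eq, testFunctional_apply]
    constructor
    · intro h φ _ _ _
      refine integral_congr_ae ?_
      have h' : w.fst.fn =ᵐ[domMeasure Ω] w.snd := h
      filter_upwards [h'] with x hx
      rw [← hx]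
      rfl
    · intro h
      have h1 : (fun x => w.fst.fn x - w.snd x) =ᵐ[domMeasure Ω] 0 := by
        refine ae_eq_zero_of_forall_test ho ?_ fun φ hφ hc hs => ?_
        · exact (locallyIntegrableOn_of_memLp one_le_ofReal_of_fact w.fst.memLp_fn).sub
            (locallyIntegrableOn_of_memLp one_le_two (Lp.memLp w.snd))
        · have h2 := h φ hφ hc hs
          have e1 := integrable_mul_of_Lp (SobolevW1p.split Ω p w.fst).1 hφ.continuous hc
          have e2 := integrable_mul_of_Lp w.snd hφ.continuous hc
          rw [← sub_eq_zero, ← integral_sub e1 e2] at h2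
          rw [← h2]
          refine integral_congr_ae (Eventually.of_forall fun x => ?_)
          simp only [smul_eq_mul]
          rw [mul_sub, mul_comm, mul_comm (φ x)]
          rfl
      change w.fst.fn =ᵐ[domMeasure Ω] w.snd
      filter_upwards [h1] with x hx using sub_eq_zero.1 hx
  rw [this]
  refine isClosed_iInter fun φ => isClosed_iInter fun h1 => isClosed_iInter fun h2 =>
    isClosed_iInter fun h3 => ?_
  refine isClosed_eq ?_ ?_
  · exact (ContinuousLinearMap.continuous _).comp (continuous_fst.comp
      ((SobolevW1p.split Ω p).continuous.comp (WithLp.continuous_fst _ _ _)))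
  · exact (ContinuousLinearMap.continuous _).comp (WithLp.continuous_snd _ _ _)

theorem completeSpace_spaceV (ho : IsOpen Ω) : CompleteSpace (SpaceV Ω p) :=
  (isClosed_spaceVSubmodule ho).completeSpace_coe

/-- Splitting of `V` into its components in `W^{1,p}(Ω)` and `L²(Ω)`. -/
noncomputable def SpaceV.split (Ω : Set (EucSp N)) (p : ℝ) [Fact (1 < p)] : SpaceV Ω p →L[ℝ]
    SobolevW1p Ω p × Lp ℝ 2 (domMeasure Ω) :=
  (WithLp.prodContinuousLinearEquiv 1 ℝ _ _).toContinuousLinearMap.comp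
    (spaceVSubmodule Ω p).subtypeL

theorem SpaceV.exists_antilipschitz_split (Ω : Set (EucSp N)) (p : ℝ) [Fact (1 < p)] :
    ∃ K, AntilipschitzWith K (SpaceV.split Ω p) :=
  exists_antilipschitz_prod_subtype _ _

theorem isReflexiveSpace_spaceV (ho : IsOpen Ω) (hb : Bornology.IsBounded Ω) :
    IsReflexiveSpace (SpaceV Ω p) := by
  have := isFiniteMeasure_domMeasure hb
  have := completeSpace_spaceV (p := p) ho
  obtain ⟨K, hK⟩ := SpaceV.exists_antilipschitz_split Ω p
  -- The exponents `2` and `ENNReal.ofReal 2` are equal but not the same term; a variable exponent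
  -- allows the substitution.
  have h2 : ∀ (P : ℝ≥0∞) [Fact (1 ≤ P)], P = ENNReal.ofReal 2 →
      IsReflexiveSpace (Lp ℝ P (domMeasure Ω)) := by
    intro P _ h
    subst h
    exact isReflexiveSpace_Lp (Real.HolderConjugate.conjExponent one_lt_two)
  exact IsReflexiveSpace.of_antilipschitz
    ((isReflexiveSpace_sobolevW1p (p := p) hb).prod (h2 2 (by simp))) _ hK

theorem separableSpace_spaceV (hb : Bornology.IsBounded Ω) :
    TopologicalSpace.SeparableSpace (SpaceV Ω p) := by
  have := isFiniteMeasure_domMeasure hb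
  have := secondCountable_sobolevW1p (p := p) hb
  have : Fact ((2 : ℝ≥0∞) ≠ ⊤) := ⟨ENNReal.ofNat_ne_top⟩
  obtain ⟨K, hK⟩ := SpaceV.exists_antilipschitz_split Ω p
  have : SecondCountableTopology (SpaceV Ω p) :=
    (hK.isUniformEmbedding (SpaceV.split Ω p).uniformContinuous).isEmbedding.secondCountableTopology
  infer_instance

end SobolevSpace

/-! ### Differences of C¹ functions along Lipschitz curves -/

section UpperGradient

/-- The fundamental estimate along a Lipschitz curve: the derivative is an upper gradient. -/
theorem abs_sub_le_integral_of_lipschitz {E : Type*} [NormedAddCommGroup E] [NormedSpace ℝ E]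
    {u : E → ℝ} (hu : ContDiff ℝ 1 u) {γ : ℝ → E} {L : ℝ≥0} (hγ : LipschitzWith L γ) :
    |u (γ 1) - u (γ 0)| ≤ ∫ t in (0 : ℝ)..1, L * ‖fderiv ℝ u (γ t)‖ := by
  have hG : Continuous fun t => (L : ℝ) * ‖fderiv ℝ u (γ t)‖ :=
    continuous_const.mul ((hu.continuous_fderiv one_ne_zero).comp hγ.continuous).norm
  have hf : Continuous fun t => |u (γ t) - u (γ 0)| :=
    ((hu.continuous.comp hγ.continuous).sub continuous_const).abs
  -- The curve is only Lipschitz, so u ∘ γ need not be differentiable. Instead the right slopes of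
  -- |u(γ t) - u(γ 0)| are compared with the derivative of the integral.
  refine image_le_of_liminf_slope_right_le_deriv_boundary (a := 0) (b := 1)
    (f := fun t => |u (γ t) - u (γ 0)|)
    (B := fun x => ∫ t in (0 : ℝ)..x, L * ‖fderiv ℝ u (γ t)‖)
    (B' := fun t => L * ‖fderiv ℝ u (γ t)‖) hf.continuousOn (by simp) ?_ ?_ ?_
    (Set.right_mem_Icc.2 zero_le_one)
  · exact (continuous_iff_continuousAt.2 fun x =>
      (hG.integral_hasStrictDerivAt 0 x).hasDerivAt.continuousAt).continuousOn
  · intro x _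
    exact (hG.integral_hasStrictDerivAt 0 x).hasDerivAt.hasDerivWithinAt
  · intro x _ r hr
    refine Eventually.frequently ?_
    obtain ⟨ε, hε, hεr⟩ : ∃ ε > 0, (L : ℝ) * (‖fderiv ℝ u (γ x)‖ + ε) < r := by
      have h1 : Tendsto (fun ε => (L : ℝ) * (‖fderiv ℝ u (γ x)‖ + ε)) (𝓝[>] 0)
          (𝓝 (L * (‖fderiv ℝ u (γ x)‖ + 0))) :=
        ((continuous_const.mul (continuous_const.add continuous_id)).tendsto 0).mono_left
          nhdsWithin_le_nhds
      rw [add_zero] at h1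
      obtain ⟨ε, h2, h3⟩ := ((h1.eventually_lt_const hr).and self_mem_nhdsWithin).exists
      exact ⟨ε, h3, h2⟩
    have h1 := ((hu.differentiable one_ne_zero) (γ x)).hasFDerivAt.isLittleO.def hε
    have h2 := (hγ.continuous.tendsto x).eventually h1
    filter_upwards [h2.filter_mono nhdsWithin_le_nhds, self_mem_nhdsWithin] with z hz hxz
    have hxz' : 0 < z - x := sub_pos.2 hxz
    have h3 : |u (γ z) - u (γ x)| ≤ (‖fderiv ℝ u (γ x)‖ + ε) * ‖γ z - γ x‖ := by
      have h4 := norm_sub_norm_le (u (γ z) - u (γ x)) (fderiv ℝ u (γ x) (γ z - γ x))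
      have h5 := (fderiv ℝ u (γ x)).le_opNorm (γ z - γ x)
      rw [← Real.norm_eq_abs, add_mul]
      linarith
    have h4 : ‖γ z - γ x‖ ≤ L * (z - x) := by
      have := hγ.norm_sub_le z x
      rwa [Real.norm_eq_abs, abs_of_pos hxz'] at this
    have h5 : |u (γ z) - u (γ 0)| - |u (γ x) - u (γ 0)| ≤ |u (γ z) - u (γ x)| := by
      have := abs_sub_abs_le_abs_sub (u (γ z) - u (γ 0)) (u (γ x) - u (γ 0))
      simpa using this
    rw [slope_def_field, div_lt_iff₀ hxz']
    refine lt_of_le_of_lt (h5.trans (h3.trans (mul_le_mul_of_nonneg_left h4 (by positivity)))) ?_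
    rw [← mul_assoc]
    refine mul_lt_mul_of_pos_right ?_ hxz'
    rw [mul_comm]
    exact hεr

/-- The curve is the φ-image of the segment from y to z, whose Lipschitz constant is K‖z - y‖. -/
theorem enorm_sub_le_lintegral_segment {E F : Type*} [NormedAddCommGroup E] [NormedSpace ℝ E]
    [NormedAddCommGroup F] [NormedSpace ℝ F]
    {u : E → ℝ} (hu : ContDiff ℝ 1 u) {φ : F → E} {K : ℝ≥0} (hφ : LipschitzWith K φ) (y z : F) :
    ‖u (φ z) - u (φ y)‖ₑ ≤ K * ‖z - y‖ₑ *
      ∫⁻ t in Set.Ioc (0 : ℝ) 1, ‖fderiv ℝ u (φ (y + t • (z - y)))‖ₑ := by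
  have hγ : LipschitzWith (K * ‖z - y‖₊) fun t : ℝ => φ (y + t • (z - y)) := by
    refine hφ.comp (LipschitzWith.of_dist_le_mul fun s t => ?_)
    rw [dist_add_left, dist_eq_norm, ← sub_smul, norm_smul, mul_comm]
    rfl
  have h1 := abs_sub_le_integral_of_lipschitz hu hγ
  have hG : Continuous fun t : ℝ => ((K * ‖z - y‖₊ : ℝ≥0) : ℝ) *
      ‖fderiv ℝ u (φ (y + t • (z - y)))‖ :=
    continuous_const.mul ((hu.continuous_fderiv one_ne_zero).comp hγ.continuous).norm
  rw [intervalIntegral.integral_of_le zero_le_one] at h1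
  simp only [one_smul, zero_smul, add_zero, add_sub_cancel] at h1
  rw [← ofReal_norm, Real.norm_eq_abs]
  refine (ENNReal.ofReal_le_ofReal h1).trans ?_
  rw [ofReal_integral_eq_lintegral_ofReal]
  · simp_rw [ENNReal.ofReal_mul NNReal.zero_le_coe, ofReal_norm, ENNReal.ofReal_coe_nnreal]
    rw [lintegral_const_mul' _ _ ENNReal.coe_ne_top, ENNReal.coe_mul]
    rfl
  · exact hG.integrableOn_Ioc
  · exact Eventually.of_forall fun t => by positivity

end UpperGradient

/-! ### Hölder's inequality with a power weight -/

section Holder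

theorem lintegral_rpow_lt_top {r : ℝ} (hr : -1 < r) :
    ∫⁻ t in Set.Ioc (0 : ℝ) 1, ENNReal.ofReal (t ^ r) < ⊤ := by
  have h := (intervalIntegral.intervalIntegrable_rpow' (a := 0) (b := 1) hr).1
  exact h.lintegral_lt_top

/-- Hölder's inequality with a power weight on the unit interval. -/
theorem exists_weighted_holder {p : ℝ} (hp : 1 < p) {a : ℝ} (ha : a < 1 - 1 / p) :
    ∃ C : ℝ≥0∞, C ≠ ⊤ ∧ ∀ F : ℝ → ℝ≥0∞, AEMeasurable F (volume.restrict (Set.Ioc (0 : ℝ) 1)) →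
      (∫⁻ t in Set.Ioc (0 : ℝ) 1, F t) ^ p ≤
        C * ∫⁻ t in Set.Ioc (0 : ℝ) 1, ENNReal.ofReal (t ^ (a * p)) * F t ^ p := by
  have hpq := Real.HolderConjugate.conjExponent hp
  set q := p.conjExponent with hq
  have hp0 : 0 < p := by linarith
  have hq0 : 0 < q := hpq.symm.pos
  -- The dual weight is t^(-aq); it is integrable at 0 exactly when a < 1/q = 1 - 1/p.
  have haq : -1 < -a * q := by
    have : 1 - 1 / p = 1 / q := by
      have := hpq.inv_add_inv_eq_one
      rw [one_div, one_div]; linarith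
    rw [this, lt_div_iff₀ hq0] at ha
    linarith
  refine ⟨(∫⁻ t in Set.Ioc (0 : ℝ) 1, ENNReal.ofReal (t ^ (-a * q))) ^ (1 / q * p),
    ENNReal.rpow_ne_top_of_nonneg (by positivity) (lintegral_rpow_lt_top haq).ne, fun F hF => ?_⟩
  have hm : ∀ r : ℝ, Measurable fun t : ℝ => ENNReal.ofReal (t ^ r) := fun r =>
    ENNReal.measurable_ofReal.comp (measurable_id.pow_const r)
  have h1 := ENNReal.lintegral_mul_le_Lp_mul_Lq (volume.restrict (Set.Ioc (0 : ℝ) 1)) hpq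
    (f := fun t => ENNReal.ofReal (t ^ a) * F t) (g := fun t => ENNReal.ofReal (t ^ (-a)))
    ((hm a).aemeasurable.mul hF) (hm (-a)).aemeasurable
  have e1 : ∫⁻ t in Set.Ioc (0 : ℝ) 1,
      ((fun t => ENNReal.ofReal (t ^ a) * F t) * fun t => ENNReal.ofReal (t ^ (-a))) t
      = ∫⁻ t in Set.Ioc (0 : ℝ) 1, F t := by
    refine setLIntegral_congr_fun measurableSet_Ioc fun t ht => ?_
    simp only [Pi.mul_apply]
    rw [mul_right_comm, ← ENNReal.ofReal_mul (Real.rpow_nonneg ht.1.le _), ← Real.rpow_add ht.1]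
    simp
  have e2 : ∫⁻ t in Set.Ioc (0 : ℝ) 1, (ENNReal.ofReal (t ^ a) * F t) ^ p
      = ∫⁻ t in Set.Ioc (0 : ℝ) 1, ENNReal.ofReal (t ^ (a * p)) * F t ^ p := by
    refine setLIntegral_congr_fun measurableSet_Ioc fun t ht => ?_
    rw [ENNReal.mul_rpow_of_nonneg _ _ hp0.le,
      ENNReal.ofReal_rpow_of_nonneg (Real.rpow_nonneg ht.1.le _) hp0.le, ← Real.rpow_mul ht.1.le]
  have e3 : ∫⁻ t in Set.Ioc (0 : ℝ) 1, (ENNReal.ofReal (t ^ (-a))) ^ q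
      = ∫⁻ t in Set.Ioc (0 : ℝ) 1, ENNReal.ofReal (t ^ (-a * q)) := by
    refine setLIntegral_congr_fun measurableSet_Ioc fun t ht => ?_
    rw [ENNReal.ofReal_rpow_of_nonneg (Real.rpow_nonneg ht.1.le _) hq0.le, ← Real.rpow_mul ht.1.le]
  rw [e1, e2, e3] at h1
  have h2 := ENNReal.rpow_le_rpow h1 hp0.le
  rw [ENNReal.mul_rpow_of_nonneg _ _ hp0.le, ← ENNReal.rpow_mul, ← ENNReal.rpow_mul,
    one_div_mul_cancel hp0.ne', ENNReal.rpow_one, mul_comm] at h2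
  exact h2

end Holder

/-! ### Charts and the weighted Sobolev inequality -/

section Chart

variable {N : ℕ} {Ω W : Set (EucSp N)}

/-- A bi-Lipschitz chart of `Ω` near `W`, flattening `W ∩ closure Ω` to a subset of the closure of a
convex set. The map `P` also folds the exterior part of `W` onto the interior part. -/
structure LipChart {N : ℕ} (Ω W : Set (EucSp N)) where
  /-- the convex model domain -/
  Q : Set (EucSp N)
  /-- the parametrization -/
  φ : EucSp N → EucSp N
  /-- the folded chart map -/
  P : EucSp N → EucSp N
  /-- a Lipschitz constant of both maps -/
  K : ℝ≥0
  /-- a bound for volume distortion and surface growth -/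
  C : ℝ≥0
  isOpen_W : IsOpen W
  isOpen_Q : IsOpen Q
  convex_Q : Convex ℝ Q
  bounded_Q : Bornology.IsBounded Q
  nonempty_Q : Q.Nonempty
  lip_φ : LipschitzWith K φ
  lip_P : LipschitzWith K P
  mapsTo : Set.MapsTo φ Q Ω
  mem_closure : ∀ x ∈ W ∩ closure Ω, P x ∈ closure Q
  left_inv : ∀ x ∈ W ∩ closure Ω, φ (P x) = x
  volume_φ : ∀ s, MeasurableSet s → volume (Q ∩ φ ⁻¹' s) ≤ C * volume (s ∩ Ω)
  volume_P : ∀ s, MeasurableSet s → volume (W ∩ P ⁻¹' s) ≤ C * volume (s ∩ Q)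
  growth : ∀ z, ∀ r : ℝ, 0 < r →
    bdryMeasure Ω (W ∩ {x | dist (P x) z ≤ r}) ≤ C * ENNReal.ofReal (r ^ ((N : ℝ) - 1))

/-- The substitution ξ = η + t(ζ - η) costs the Jacobian t^(-N). Convexity keeps ξ in Q, and ξ lies
within tD of η: this localization is what is later paid for by the growth of the measure. -/
theorem lintegral_homothety_le {Q : Set (EucSp N)} (hQ : IsOpen Q) (hQc : Convex ℝ Q) {D : ℝ}
    {η : EucSp N} (hη : η ∈ closure Q) (hD : ∀ ζ ∈ Q, ‖ζ - η‖ ≤ D) {t : ℝ} (ht : 0 < t)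
    (ht1 : t ≤ 1) {H : EucSp N → ℝ≥0∞} (hH : Measurable H) :
    ∫⁻ ζ in Q, H (η + t • (ζ - η)) ≤
      ENNReal.ofReal (t ^ (-(N : ℝ))) * ∫⁻ ξ in Q, {ξ | dist η ξ ≤ t * D}.indicator H ξ := by
  set B : Set (EucSp N) := {ξ | dist η ξ ≤ t * D} with hB
  have hBm : MeasurableSet B := measurableSet_le (measurable_const.dist measurable_id) measurable_const
  set H' : EucSp N → ℝ≥0∞ := Q.indicator (B.indicator H) with hH'
  have hH'm : Measurable H' := (hH.indicator hBm).indicator hQ.measurableSet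
  have h1 : ∀ ζ ∈ Q, H (η + t • (ζ - η)) = H' (η + t • (ζ - η)) := by
    intro ζ hζ
    have hm : η + t • (ζ - η) ∈ Q := by
      -- η may lie on the boundary of Q; the half-open segment towards an interior point still stays
      -- in the interior, which is why t > 0 matters.
      have := hQc.add_smul_sub_mem_interior' hη (hQ.interior_eq.symm ▸ hζ) ⟨ht, ht1⟩
      rwa [hQ.interior_eq] at this
    have hb : η + t • (ζ - η) ∈ B := by
      change dist η (η + t • (ζ - η)) ≤ t * D
      rw [dist_self_add_right, norm_smul, Real.norm_eq_abs, abs_of_pos ht]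
      exact mul_le_mul_of_nonneg_left (hD ζ hζ) ht.le
    rw [hH', Set.indicator_of_mem hm, Set.indicator_of_mem hb]
  have h2 : ∫⁻ ζ, H' (η + t • (ζ - η)) = ENNReal.ofReal (t ^ (-(N : ℝ))) * ∫⁻ ξ, H' ξ := by
    have e1 : ∫⁻ ζ, H' (η + t • (ζ - η)) = ∫⁻ ζ, H' (η + t • ζ) :=
      lintegral_sub_right_eq_self (fun ζ => H' (η + t • ζ)) η
    have e2 : ∫⁻ ζ, H' (η + t • ζ) = ∫⁻ ξ, H' (η + ξ) ∂(Measure.map (t • ·) volume) :=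
      (lintegral_map (f := fun ξ => H' (η + ξ)) (hH'm.comp (measurable_const_add η))
        (measurable_const_smul t)).symm
    rw [e1, e2, Measure.map_addHaar_smul volume ht.ne', lintegral_smul_measure,
      lintegral_add_left_eq_self]
    rw [smul_eq_mul, finrank_euclideanSpace_fin, abs_of_pos (by positivity), Real.rpow_neg ht.le,
      Real.rpow_natCast]
  calc ∫⁻ ζ in Q, H (η + t • (ζ - η)) = ∫⁻ ζ in Q, H' (η + t • (ζ - η)) :=
        setLIntegral_congr_fun hQ.measurableSet h1
    _ ≤ ∫⁻ ζ, H' (η + t • (ζ - η)) := setLIntegral_le_lintegral _ _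
    _ = _ := by rw [h2, hH', lintegral_indicator hQ.measurableSet]

theorem add_rpow_le_two_rpow_mul (a b : ℝ≥0∞) {p : ℝ} (hp : 1 < p) :
    (a + b) ^ p ≤ 2 ^ (p - 1) * (a ^ p + b ^ p) := by
  have := ENNReal.rpow_add_le_mul_rpow_add_rpow a b hp.le
  exact this

namespace LipChart

variable (c : LipChart Ω W)

include c in
theorem measurableSet_inter : MeasurableSet (W ∩ closure Ω) :=
  c.isOpen_W.measurableSet.inter isClosed_closure.measurableSet

/-- The field `volume_φ` says that the image under φ of Lebesgue measure on Q is at most C times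
Lebesgue measure on Ω; no Jacobian is needed. -/
theorem lintegral_comp_φ_le {f : EucSp N → ℝ≥0∞} (hf : Measurable f) :
    ∫⁻ y in c.Q, f (c.φ y) ≤ c.C * ∫⁻ x, f x ∂(domMeasure Ω) := by
  have hφ := c.lip_φ.continuous.measurable
  rw [← lintegral_map hf hφ, ← smul_eq_mul, ← lintegral_smul_measure]
  refine lintegral_mono' ?_ le_rfl
  refine Measure.le_iff.2 fun s hs => ?_
  rw [Measure.map_apply hφ hs, Measure.restrict_apply (hφ hs), Set.inter_comm, Measure.smul_apply,
    domMeasure, Measure.restrict_apply hs]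
  exact c.volume_φ s hs

theorem lintegral_comp_P_le {f : EucSp N → ℝ≥0∞} (hf : Measurable f) :
    ∫⁻ x in W, f (c.P x) ≤ c.C * ∫⁻ y in c.Q, f y := by
  have hP := c.lip_P.continuous.measurable
  rw [← lintegral_map hf hP, ← smul_eq_mul, ← lintegral_smul_measure]
  refine lintegral_mono' ?_ le_rfl
  refine Measure.le_iff.2 fun s hs => ?_
  rw [Measure.map_apply hP hs, Measure.restrict_apply (hP hs), Set.inter_comm, Measure.smul_apply,
    Measure.restrict_apply hs]
  exact c.volume_P s hs

/-- The weighted Sobolev inequality in a chart: if the measure `μ` has growth of order `β > N - p`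
on balls in the chart, then `C¹` functions are bounded in `L^p(μ)` by their Sobolev norm. -/
theorem exists_lintegral_le {p : ℝ} (hp : 1 < p) {β : ℝ} (hβ : (N : ℝ) - p < β)
    (μ : Measure (EucSp N)) [IsFiniteMeasure μ] {Cμ : ℝ≥0}
    (hg : ∀ z, ∀ r : ℝ, 0 < r →
      μ ((W ∩ closure Ω) ∩ {x | dist (c.P x) z ≤ r}) ≤ Cμ * ENNReal.ofReal (r ^ β)) :
    ∃ C : ℝ≥0, ∀ u : EucSp N → ℝ, ContDiff ℝ 1 u →
      ∫⁻ x in W ∩ closure Ω, ‖u x‖ₑ ^ p ∂μ ≤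
        C * (∫⁻ x, ‖u x‖ₑ ^ p ∂(domMeasure Ω) + ∫⁻ x, ‖fderiv ℝ u x‖ₑ ^ p ∂(domMeasure Ω)) := by
  have hp0 : 0 < p := by linarith
  set S := W ∩ closure Ω with hS
  have hSm : MeasurableSet S := c.measurableSet_inter
  -- diameter bound
  obtain ⟨D, hD0, hD⟩ : ∃ D : ℝ, 0 < D ∧ ∀ η ∈ closure c.Q, ∀ ζ ∈ c.Q, ‖ζ - η‖ ≤ D := by
    have hb := c.bounded_Q.closure
    refine ⟨Metric.diam (closure c.Q) + 1, by positivity, fun η hη ζ hζ => ?_⟩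
    rw [← dist_eq_norm]
    have := Metric.dist_le_diam_of_mem hb (subset_closure hζ) hη
    linarith
  -- the exponent of the weight
  obtain ⟨a, ha1, ha2⟩ : ∃ a : ℝ, a < 1 - 1 / p ∧ -1 < a * p + β - N := by
    -- The midpoint of the admissible interval ((N - β - 1)/p, 1 - 1/p), which is nonempty precisely
    -- because β > N - p.
    refine ⟨1 - 1 / p - (β - (N - p)) / (2 * p), ?_, ?_⟩
    · have : 0 < (β - (N - p)) / (2 * p) := div_pos (by linarith) (by linarith)
      linarith
    · have : (1 - 1 / p - (β - (N - p)) / (2 * p)) * p = p - 1 - (β - (N - p)) / 2 := by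
        field_simp
      rw [this]; linarith
  obtain ⟨A, hA, hHolder⟩ := exists_weighted_holder hp ha1
  have hw := lintegral_rpow_lt_top ha2
  set J := ∫⁻ t in Set.Ioc (0 : ℝ) 1, ENNReal.ofReal (t ^ (a * p + β - N)) with hJ
  set vQ := volume c.Q with hvQ
  have hvQ0 : vQ ≠ 0 := (c.isOpen_Q.measure_pos volume c.nonempty_Q).ne'
  have hvQt : vQ ≠ ⊤ := c.bounded_Q.measure_lt_top.ne
  set M1 : ℝ≥0∞ := (c.K * ENNReal.ofReal D) ^ p with hM1
  have hM1t : M1 ≠ ⊤ := ENNReal.rpow_ne_top_of_nonneg hp0.le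
    (ENNReal.mul_ne_top ENNReal.coe_ne_top ENNReal.ofReal_ne_top)
  set M2 : ℝ≥0∞ := Cμ * ENNReal.ofReal (D ^ β) with hM2
  have hM2t : M2 ≠ ⊤ := ENNReal.mul_ne_top ENNReal.coe_ne_top ENNReal.ofReal_ne_top
  set T : ℝ≥0∞ := vQ⁻¹ * (2 ^ (p - 1) * (μ Set.univ * c.C + M1 * A * (J * M2 * c.C))) with hT
  have h2t : (2 : ℝ≥0∞) ^ (p - 1) ≠ ⊤ :=
    ENNReal.rpow_ne_top_of_nonneg (by linarith) ENNReal.ofNat_ne_top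
  have hTt : T ≠ ⊤ := by
    refine ENNReal.mul_ne_top (ENNReal.inv_ne_top.2 hvQ0) (ENNReal.mul_ne_top h2t ?_)
    refine ENNReal.add_ne_top.2 ⟨ENNReal.mul_ne_top (measure_ne_top _ _) ENNReal.coe_ne_top,
      ENNReal.mul_ne_top (ENNReal.mul_ne_top hM1t hA) ?_⟩
    exact ENNReal.mul_ne_top (ENNReal.mul_ne_top hw.ne hM2t) ENNReal.coe_ne_top
  refine ⟨T.toNNReal, fun u hu => ?_⟩
  rw [ENNReal.coe_toNNReal hTt]
  set U : EucSp N → ℝ≥0∞ := fun x => ‖u x‖ₑ ^ p with hU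
  set V : EucSp N → ℝ≥0∞ := fun x => ‖fderiv ℝ u x‖ₑ ^ p with hV
  have hVm : Measurable V := ((hu.continuous_fderiv one_ne_zero).enorm.measurable).pow_const p
  have hUm : Measurable U := (hu.continuous.enorm.measurable).pow_const p
  set G : EucSp N → ℝ≥0∞ := fun y => V (c.φ y) with hG
  have hφm := c.lip_φ.continuous.measurable
  have hPm := c.lip_P.continuous.measurable
  have hGm : Measurable G := hVm.comp hφm
  -- pointwise bound
  have hpt : ∀ x ∈ S, ∀ ζ ∈ c.Q, U x ≤ 2 ^ (p - 1) * (U (c.φ ζ) + M1 * (A *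
      ∫⁻ t in Set.Ioc (0 : ℝ) 1, ENNReal.ofReal (t ^ (a * p)) * G (c.P x + t • (ζ - c.P x)))) := by
    intro x hx ζ hζ
    set η := c.P x with hη
    have hxη : c.φ η = x := c.left_inv x hx
    have h1 := enorm_sub_le_lintegral_segment hu c.lip_φ η ζ
    rw [hxη] at h1
    have h2 : ‖u x‖ₑ ≤ ‖u (c.φ ζ)‖ₑ + c.K * ENNReal.ofReal D *
        ∫⁻ t in Set.Ioc (0 : ℝ) 1, ‖fderiv ℝ u (c.φ (η + t • (ζ - η)))‖ₑ := by
      have h3 : ‖u x‖ₑ ≤ ‖u (c.φ ζ)‖ₑ + ‖u (c.φ ζ) - u x‖ₑ := by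
        have := enorm_sub_le (a := u (c.φ ζ)) (b := u (c.φ ζ) - u x)
        rwa [sub_sub_cancel] at this
      refine h3.trans (add_le_add le_rfl (h1.trans ?_))
      refine mul_le_mul_left ?_ _
      refine mul_le_mul_right ?_ _
      rw [← ofReal_norm]
      exact ENNReal.ofReal_le_ofReal (hD η (c.mem_closure x hx) ζ hζ)
    refine (ENNReal.rpow_le_rpow h2 hp0.le).trans ((add_rpow_le_two_rpow_mul _ _ hp).trans ?_)
    refine mul_le_mul_right (add_le_add le_rfl ?_) _
    rw [ENNReal.mul_rpow_of_nonneg _ _ hp0.le]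
    refine mul_le_mul_right (hHolder _ ?_) _
    have : Continuous fun t : ℝ => c.φ (η + t • (ζ - η)) :=
      c.lip_φ.continuous.comp (by fun_prop)
    exact (((hu.continuous_fderiv one_ne_zero).comp this).enorm.measurable).aemeasurable
  -- joint measurability
  have hcont : Continuous fun z : (EucSp N × EucSp N) × ℝ => c.P z.1.1 + z.2 • (z.1.2 - c.P z.1.1) := by
    have := c.lip_P.continuous
    fun_prop
  have hFm : Measurable fun z : (EucSp N × EucSp N) × ℝ => ENNReal.ofReal (z.2 ^ (a * p)) *
      G (c.P z.1.1 + z.2 • (z.1.2 - c.P z.1.1)) :=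
    (ENNReal.measurable_ofReal.comp (measurable_snd.pow_const _)).mul (hGm.comp hcont.measurable)
  -- the key estimate for fixed `t`
  have hkey : ∀ t ∈ Set.Ioc (0 : ℝ) 1, ∫⁻ x in S, ∫⁻ ζ in c.Q, G (c.P x + t • (ζ - c.P x)) ∂volume ∂μ
      ≤ ENNReal.ofReal (t ^ (β - N)) * (M2 * ∫⁻ ξ in c.Q, G ξ) := by
    intro t ht
    calc ∫⁻ x in S, ∫⁻ ζ in c.Q, G (c.P x + t • (ζ - c.P x)) ∂volume ∂μ
        ≤ ∫⁻ x in S, ENNReal.ofReal (t ^ (-(N : ℝ))) *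
            ∫⁻ ξ in c.Q, {ξ | dist (c.P x) ξ ≤ t * D}.indicator G ξ ∂volume ∂μ := by
          refine setLIntegral_mono' hSm fun x hx => ?_
          exact lintegral_homothety_le c.isOpen_Q c.convex_Q (c.mem_closure x hx)
            (hD _ (c.mem_closure x hx)) ht.1 ht.2 hGm
      _ = ENNReal.ofReal (t ^ (-(N : ℝ))) * ∫⁻ x in S,
            ∫⁻ ξ in c.Q, {ξ | dist (c.P x) ξ ≤ t * D}.indicator G ξ ∂volume ∂μ :=
          lintegral_const_mul' _ _ ENNReal.ofReal_ne_top
      _ = ENNReal.ofReal (t ^ (-(N : ℝ))) * ∫⁻ ξ in c.Q, ∫⁻ x in S,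
            {x | dist (c.P x) ξ ≤ t * D}.indicator (fun _ => G ξ) x ∂μ := by
          congr 1
          rw [lintegral_lintegral_swap]
          · rfl
          · refine Measurable.aemeasurable ?_
            have : Measurable ({z : EucSp N × EucSp N | dist (c.P z.1) z.2 ≤ t * D}.indicator
                fun z => G z.2) :=
              (hGm.comp measurable_snd).indicator
                (measurableSet_le ((hPm.comp measurable_fst).dist measurable_snd) measurable_const)
            exact this
      -- With ξ fixed, the points x with |P x - ξ| ≤ tD have measure at most Cμ (tD)^β. Together
      -- with the Jacobian this leaves t^(β-N).
      _ ≤ ENNReal.ofReal (t ^ (-(N : ℝ))) * ∫⁻ ξ in c.Q,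
            (Cμ * ENNReal.ofReal ((t * D) ^ β)) * G ξ := by
          refine mul_le_mul_right (lintegral_mono fun ξ => ?_) _
          have hms : MeasurableSet {x | dist (c.P x) ξ ≤ t * D} :=
            measurableSet_le (hPm.dist measurable_const) measurable_const
          rw [lintegral_indicator hms, setLIntegral_const, Measure.restrict_apply hms, mul_comm,
            Set.inter_comm]
          exact mul_le_mul_left (hg ξ (t * D) (mul_pos ht.1 hD0)) _
      _ = _ := by
          rw [lintegral_const_mul' _ _ (ENNReal.mul_ne_top ENNReal.coe_ne_top ENNReal.ofReal_ne_top),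
            Real.mul_rpow ht.1.le hD0.le, ENNReal.ofReal_mul (Real.rpow_nonneg ht.1.le _),
            sub_eq_neg_add, Real.rpow_add ht.1, ENNReal.ofReal_mul (Real.rpow_nonneg ht.1.le _)]
          ring
  have hUφ : Measurable fun ζ => U (c.φ ζ) := hUm.comp hφm
  -- integrate
  have hint : vQ * ∫⁻ x in S, U x ∂μ ≤ 2 ^ (p - 1) * (μ Set.univ * (∫⁻ ζ in c.Q, U (c.φ ζ)) +
      M1 * A * (J * (M2 * ∫⁻ ξ in c.Q, G ξ))) := by
    calc vQ * ∫⁻ x in S, U x ∂μ = ∫⁻ x in S, ∫⁻ _ζ in c.Q, U x ∂volume ∂μ := by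
          simp_rw [setLIntegral_const]
          rw [lintegral_mul_const _ hUm, mul_comm]
      _ ≤ ∫⁻ x in S, ∫⁻ ζ in c.Q, 2 ^ (p - 1) * (U (c.φ ζ) + M1 * (A *
            ∫⁻ t in Set.Ioc (0 : ℝ) 1, ENNReal.ofReal (t ^ (a * p)) *
              G (c.P x + t • (ζ - c.P x)))) ∂volume ∂μ :=
          setLIntegral_mono' hSm fun x hx =>
            setLIntegral_mono' c.isOpen_Q.measurableSet fun ζ hζ => hpt x hx ζ hζ
      _ = 2 ^ (p - 1) * (μ S * (∫⁻ ζ in c.Q, U (c.φ ζ)) + M1 * A * ∫⁻ x in S, ∫⁻ ζ in c.Q,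
            ∫⁻ t in Set.Ioc (0 : ℝ) 1, ENNReal.ofReal (t ^ (a * p)) *
              G (c.P x + t • (ζ - c.P x)) ∂volume ∂volume ∂μ) := by
          simp_rw [lintegral_const_mul' _ _ h2t, lintegral_add_left hUφ,
            lintegral_const_mul' _ _ hM1t, lintegral_const_mul' _ _ hA]
          rw [lintegral_add_left measurable_const, setLIntegral_const,
            lintegral_const_mul' _ _ hM1t, lintegral_const_mul' _ _ hA]
          ring
      _ = 2 ^ (p - 1) * (μ S * (∫⁻ ζ in c.Q, U (c.φ ζ)) + M1 * A * ∫⁻ t in Set.Ioc (0 : ℝ) 1,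
            ENNReal.ofReal (t ^ (a * p)) * ∫⁻ x in S, ∫⁻ ζ in c.Q,
              G (c.P x + t • (ζ - c.P x)) ∂volume ∂μ) := by
          congr 3
          -- The integral over t is moved to the outside, since `hkey` is an estimate for fixed t.
          have e1 : ∀ x, ∫⁻ ζ in c.Q, ∫⁻ t in Set.Ioc (0 : ℝ) 1, ENNReal.ofReal (t ^ (a * p)) *
              G (c.P x + t • (ζ - c.P x)) = ∫⁻ t in Set.Ioc (0 : ℝ) 1, ∫⁻ ζ in c.Q,
                ENNReal.ofReal (t ^ (a * p)) * G (c.P x + t • (ζ - c.P x)) := by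
            intro x
            refine lintegral_lintegral_swap (Measurable.aemeasurable ?_)
            exact hFm.comp (f := fun z : EucSp N × ℝ => ((x, z.1), z.2))
              ((measurable_const.prodMk measurable_fst).prodMk measurable_snd)
          simp_rw [e1]
          rw [lintegral_lintegral_swap]
          · refine lintegral_congr fun t => ?_
            exact (lintegral_congr fun x => lintegral_const_mul' _ _ ENNReal.ofReal_ne_top).trans
              (lintegral_const_mul' _ _ ENNReal.ofReal_ne_top)
          · refine Measurable.aemeasurable ?_
            have := Measurable.lintegral_prod_right' (ν := (volume : Measure (EucSp N)).restrict c.Q)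
              (f := fun z : (EucSp N × ℝ) × EucSp N => ENNReal.ofReal (z.1.2 ^ (a * p)) *
                G (c.P z.1.1 + z.1.2 • (z.2 - c.P z.1.1)))
              (hFm.comp (f := fun z : (EucSp N × ℝ) × EucSp N => ((z.1.1, z.2), z.1.2))
                (((measurable_fst.comp measurable_fst).prodMk measurable_snd).prodMk
                  (measurable_snd.comp measurable_fst)))
            exact this
      _ ≤ _ := by
          refine mul_le_mul_right (add_le_add (mul_le_mul_left (measure_mono (Set.subset_univ _)) _)
            (mul_le_mul_right ?_ _)) _
          calc ∫⁻ t in Set.Ioc (0 : ℝ) 1, ENNReal.ofReal (t ^ (a * p)) * ∫⁻ x in S, ∫⁻ ζ in c.Q,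
              G (c.P x + t • (ζ - c.P x)) ∂volume ∂μ
              ≤ ∫⁻ t in Set.Ioc (0 : ℝ) 1, ENNReal.ofReal (t ^ (a * p + β - N)) *
                (M2 * ∫⁻ ξ in c.Q, G ξ) := by
                refine setLIntegral_mono' measurableSet_Ioc fun t ht => ?_
                refine (mul_le_mul_right (hkey t ht) _).trans (le_of_eq ?_)
                rw [← mul_assoc, ← ENNReal.ofReal_mul (Real.rpow_nonneg ht.1.le _),
                  ← Real.rpow_add ht.1, add_sub_assoc]
            _ = _ := by
                rw [lintegral_mul_const]
                exact ENNReal.measurable_ofReal.comp (measurable_id.pow_const _)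
  have h1 : ∫⁻ x in S, U x ∂μ ≤ vQ⁻¹ * (2 ^ (p - 1) * (μ Set.univ * (∫⁻ ζ in c.Q, U (c.φ ζ)) +
      M1 * A * (J * (M2 * ∫⁻ ξ in c.Q, G ξ)))) := by
    rw [mul_comm, ← div_eq_mul_inv, ENNReal.le_div_iff_mul_le (Or.inl hvQ0) (Or.inl hvQt), mul_comm]
    exact hint
  refine h1.trans ?_
  rw [hT, mul_assoc vQ⁻¹]
  refine mul_le_mul_right ?_ _
  rw [mul_assoc (2 ^ (p - 1))]
  refine mul_le_mul_right ?_ _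
  have hUl := c.lintegral_comp_φ_le hUm
  have hVl := c.lintegral_comp_φ_le hVm
  set a1 := ∫⁻ x, U x ∂(domMeasure Ω)
  set a2 := ∫⁻ x, V x ∂(domMeasure Ω)
  calc μ Set.univ * (∫⁻ ζ in c.Q, U (c.φ ζ)) + M1 * A * (J * (M2 * ∫⁻ ξ in c.Q, G ξ))
      ≤ μ Set.univ * (c.C * a1) + M1 * A * (J * (M2 * (c.C * a2))) := by gcongr
    _ = (μ Set.univ * c.C) * a1 + (M1 * A * (J * M2 * c.C)) * a2 := by ring
    _ ≤ (μ Set.univ * c.C) * (a1 + a2) + (M1 * A * (J * M2 * c.C)) * (a1 + a2) := by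
        gcongr
        · exact le_self_add
        · exact le_add_self
    _ = _ := by ring

end LipChart

end Chart

/-! ### Hausdorff measure under Lipschitz maps and on hyperplanes -/

section Hausdorff

theorem LipschitzWith.euclideanHausdorffMeasure_image_le {X Y : Type*} [EMetricSpace X]
    [MeasurableSpace X] [BorelSpace X] [EMetricSpace Y] [MeasurableSpace Y] [BorelSpace Y]
    {K : ℝ≥0} {f : X → Y} (hf : LipschitzWith K f) (d : ℕ) (s : Set X) :
    Measure.euclideanHausdorffMeasure d (f '' s)
      ≤ (K : ℝ≥0∞) ^ d * Measure.euclideanHausdorffMeasure d s := by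
  simp only [Measure.euclideanHausdorffMeasure_def, Measure.smul_apply, ENNReal.smul_def, smul_eq_mul]
  have h := hf.hausdorffMeasure_image_le (Nat.cast_nonneg d) s
  rw [ENNReal.rpow_natCast] at h
  rw [mul_left_comm]
  exact mul_le_mul_right h _

/-- Lebesgue measure is the normalized N-dimensional Hausdorff measure, which a K-Lipschitz map
increases by at most K^N. -/
theorem LipschitzWith.volume_image_le {N : ℕ} {K : ℝ≥0} {f : EucSp N → EucSp N}
    (hf : LipschitzWith K f) (s : Set (EucSp N)) :
    volume (f '' s) ≤ (K : ℝ≥0∞) ^ N * volume s := by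
  rw [← EuclideanSpace.euclideanHausdorffMeasure_eq_volume]
  exact hf.euclideanHausdorffMeasure_image_le N s

/-- A nonempty slice lies in the (N-1)-dimensional ball of radius 2r about one of its own points,
and on the hyperplane the Hausdorff measure is Lebesgue measure. -/
theorem euclideanHausdorffMeasure_hyperplane_le {N : ℕ} [NeZero N] :
    ∃ C : ℝ≥0, ∀ (z : EucSp N) (r : ℝ), 0 < r →
      Measure.euclideanHausdorffMeasure (N - 1) {y : EucSp N | y ⊤ = 0 ∧ dist y z ≤ r}
        ≤ C * ENNReal.ofReal (r ^ ((N : ℝ) - 1)) := by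
  set e : EucSp N := EuclideanSpace.single ⊤ 1 with he
  have he0 : e ≠ 0 := by simp [he]
  set V : Submodule ℝ (EucSp N) := (Submodule.span ℝ {e})ᗮ with hV
  have hN : N - 1 + 1 = N := Nat.sub_add_cancel (NeZero.one_le)
  have : Fact (Module.finrank ℝ (EucSp N) = N - 1 + 1) := ⟨by rw [finrank_euclideanSpace_fin, hN]⟩
  have hfr : Module.finrank ℝ V = N - 1 := Submodule.finrank_orthogonal_span_singleton he0
  have hmem : ∀ y : EucSp N, y ∈ V ↔ y ⊤ = 0 := by
    intro y
    rw [hV, Submodule.mem_orthogonal_singleton_iff_inner_right]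
    have := EuclideanSpace.inner_single_left (𝕜 := ℝ) (⊤ : Fin N) 1 y
    rw [he, this]
    simp
  have hball : volume (Metric.ball (0 : V) 1) ≠ ⊤ := measure_ball_lt_top.ne
  refine ⟨2 ^ (N - 1) * (volume (Metric.ball (0 : V) 1)).toNNReal, fun z r hr => ?_⟩
  rcases Set.eq_empty_or_nonempty {y : EucSp N | y ⊤ = 0 ∧ dist y z ≤ r} with h | ⟨y₀, hy₀, hy₀z⟩
  · rw [h, measure_empty]; exact zero_le
  have hsub : {y : EucSp N | y ⊤ = 0 ∧ dist y z ≤ r} ⊆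
      ((↑) : V → EucSp N) '' (Metric.closedBall (⟨y₀, (hmem y₀).2 hy₀⟩ : V) (2 * r)) := by
    rintro y ⟨hy, hyz⟩
    refine ⟨⟨y, (hmem y).2 hy⟩, ?_, rfl⟩
    rw [Metric.mem_closedBall]
    change dist y y₀ ≤ 2 * r
    have := dist_triangle_right y y₀ z
    linarith
  refine (measure_mono hsub).trans ?_
  rw [isometry_subtype_coe.euclideanHausdorffMeasure_image, ← hfr,
    InnerProductSpace.euclideanHausdorffMeasure_eq_volume,
    Measure.addHaar_closedBall _ _ (by positivity), hfr, mul_pow,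
    ENNReal.ofReal_mul (by positivity), ENNReal.coe_mul, ENNReal.coe_toNNReal hball]
  have h1 : r ^ ((N : ℝ) - 1) = r ^ (N - 1) := by
    rw [← Real.rpow_natCast, Nat.cast_sub NeZero.one_le, Nat.cast_one]
  have h2 : ENNReal.ofReal (2 ^ (N - 1)) = ((2 ^ (N - 1) : ℝ≥0) : ℝ≥0∞) := by
    rw [ENNReal.ofReal_pow (by norm_num)]; simp
  rw [h1, h2, mul_right_comm]

end Hausdorff

/-! ### Existence of charts at interior and boundary points -/

section ChartExistence

variable {N : ℕ} {Ω : Set (EucSp N)}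

/-- The trivial chart around an interior point. -/
theorem nonempty_lipChart_ball {x : EucSp N} {r : ℝ} (hr : 0 < r) (h : Metric.ball x r ⊆ Ω) :
    Nonempty (LipChart Ω (Metric.ball x r)) :=
  ⟨{ Q := Metric.ball x r
     φ := id
     P := id
     K := 1
     C := 1
     isOpen_W := Metric.isOpen_ball
     isOpen_Q := Metric.isOpen_ball
     convex_Q := convex_ball x r
     bounded_Q := Metric.isBounded_ball
     nonempty_Q := ⟨x, Metric.mem_ball_self hr⟩
     lip_φ := LipschitzWith.id
     lip_P := LipschitzWith.id
     mapsTo := h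
     mem_closure := fun y hy => subset_closure hy.1
     left_inv := fun _ _ => rfl
     volume_φ := fun s _ => by
       rw [ENNReal.coe_one, one_mul, Set.preimage_id, Set.inter_comm]
       exact measure_mono (Set.inter_subset_inter_right _ h)
     volume_P := fun s _ => by
       rw [ENNReal.coe_one, one_mul, Set.preimage_id, Set.inter_comm]
     -- The ball does not meet the boundary of Ω, so there is no surface measure to estimate.
     growth := fun z ρ _ => by
       have : bdryMeasure Ω (Metric.ball x r) = 0 := by
         rw [bdryMeasure, Measure.restrict_apply Metric.isOpen_ball.measurableSet]
         have : Metric.ball x r ∩ frontier Ω = ∅ := by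
           have h1 : Metric.ball x r ⊆ interior Ω := interior_maximal h Metric.isOpen_ball
           exact (Set.disjoint_of_subset_left h1 disjoint_interior_frontier).inter_eq
         rw [this, measure_empty]
       rw [measure_mono_null Set.inter_subset_left this]
       exact zero_le }⟩

variable [NeZero N]

theorem isOpen_upperHalfCube : IsOpen (upperHalfCube N) := by
  have h1 : IsOpen (openCube N) := by
    have : openCube N = ⋂ i, {y : EucSp N | y i ∈ Set.Ioo (-1 : ℝ) 1} := by
      ext y; simp [openCube]
    rw [this]
    exact isOpen_iInter_of_finite fun i =>
      isOpen_Ioo.preimage (EuclideanSpace.proj (𝕜 := ℝ) i).continuous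
  exact h1.inter (isOpen_Ioi.preimage (EuclideanSpace.proj (𝕜 := ℝ) (⊤ : Fin N)).continuous)

theorem convex_upperHalfCube : Convex ℝ (upperHalfCube N) := by
  rintro x ⟨hx, hx'⟩ y ⟨hy, hy'⟩ a b ha hb hab
  refine ⟨fun i => ?_, ?_⟩
  · exact convex_Ioo (-1 : ℝ) 1 (hx i) (hy i) ha hb hab
  · exact convex_Ioi (0 : ℝ) hx' hy' ha hb hab

theorem isBounded_upperHalfCube : Bornology.IsBounded (upperHalfCube N) := by
  refine (Metric.isBounded_closedBall (x := (0 : EucSp N)) (r := √N)).subset fun y hy => ?_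
  rw [mem_closedBall_zero_iff, EuclideanSpace.norm_eq]
  refine Real.sqrt_le_sqrt ?_
  calc ∑ i, ‖y i‖ ^ 2 ≤ ∑ _i : Fin N, (1 : ℝ) := by
        refine Finset.sum_le_sum fun i _ => ?_
        have := hy.1 i
        rw [Real.norm_eq_abs, sq_abs]
        nlinarith [this.1, this.2]
    _ = N := by simp

theorem nonempty_upperHalfCube : (upperHalfCube N).Nonempty :=
  ⟨WithLp.toLp 2 fun _ => 1 / 2, fun i => by constructor <;> norm_num, by norm_num⟩

/-- Folding at the hyperplane where the last coordinate vanishes. -/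
noncomputable def foldLast (y : EucSp N) : EucSp N := y + (|y ⊤| - y ⊤) • EuclideanSpace.single ⊤ 1

/-- Reflection at the hyperplane where the last coordinate vanishes. -/
noncomputable def reflLast (y : EucSp N) : EucSp N := y - (2 * y ⊤) • EuclideanSpace.single ⊤ 1

theorem abs_top_sub_le (y z : EucSp N) : |y ⊤ - z ⊤| ≤ ‖y - z‖ := by
  have := PiLp.norm_apply_le (y - z) (⊤ : Fin N)
  simpa using this

theorem lipschitzWith_foldLast : LipschitzWith 3 (foldLast (N := N)) := by
  refine LipschitzWith.of_dist_le_mul fun y z => ?_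
  rw [dist_eq_norm, dist_eq_norm]
  have h : foldLast y - foldLast z = (y - z) + ((|y ⊤| - |z ⊤|) - (y ⊤ - z ⊤)) •
      (EuclideanSpace.single ⊤ 1 : EucSp N) := by
    simp only [foldLast]; module
  have h1 := abs_top_sub_le y z
  have h2 := abs_abs_sub_abs_le_abs_sub (y ⊤) (z ⊤)
  rw [h]
  refine (norm_add_le _ _).trans ?_
  rw [norm_smul, PiLp.norm_single, norm_one, mul_one, Real.norm_eq_abs]
  have h3 := abs_sub (|y ⊤| - |z ⊤|) (y ⊤ - z ⊤)
  push_cast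
  linarith

theorem lipschitzWith_reflLast : LipschitzWith 3 (reflLast (N := N)) := by
  refine LipschitzWith.of_dist_le_mul fun y z => ?_
  rw [dist_eq_norm, dist_eq_norm]
  have h : reflLast y - reflLast z = (y - z) + (-2 * (y ⊤ - z ⊤)) •
      (EuclideanSpace.single ⊤ 1 : EucSp N) := by
    simp only [reflLast]; module
  have h1 := abs_top_sub_le y z
  rw [h]
  refine (norm_add_le _ _).trans ?_
  rw [norm_smul, PiLp.norm_single, norm_one, mul_one, Real.norm_eq_abs, abs_mul]
  norm_num
  linarith

theorem foldLast_of_nonneg {y : EucSp N} (h : 0 ≤ y ⊤) : foldLast y = y := by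
  simp [foldLast, abs_of_nonneg h]

theorem foldLast_of_neg {y : EucSp N} (h : y ⊤ < 0) : foldLast y = reflLast y := by
  rw [foldLast, reflLast, abs_of_neg h]
  module

theorem reflLast_reflLast (y : EucSp N) : reflLast (reflLast y) = y := by
  have : (reflLast y) ⊤ = - y ⊤ := by simp [reflLast]; ring
  rw [reflLast, this, reflLast]
  module

theorem reflLast_mem_upperHalfCube {y : EucSp N} (hy : y ∈ openCube N) (h : y ⊤ < 0) :
    reflLast y ∈ upperHalfCube N := by
  have h1 : ∀ i, i ≠ ⊤ → reflLast y i = y i := fun i hi => by simp [reflLast, hi]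
  have h2 : reflLast y ⊤ = - y ⊤ := by simp [reflLast]; ring
  refine ⟨fun i => ?_, by rw [h2]; linarith⟩
  by_cases hi : i = ⊤
  · rw [hi, h2]
    have := hy ⊤
    exact ⟨by linarith [this.2], by linarith [this.1]⟩
  · rw [h1 i hi]; exact hy i

theorem volume_last_eq_zero : volume {y : EucSp N | y ⊤ = 0} = 0 := by
  have h := Measure.addHaar_submodule (volume : Measure (EucSp N))
    (LinearMap.ker (EuclideanSpace.proj (𝕜 := ℝ) (⊤ : Fin N) : EucSp N →ₗ[ℝ] ℝ)) (by
      intro h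
      have : (EuclideanSpace.single ⊤ 1 : EucSp N) ∈
        LinearMap.ker (EuclideanSpace.proj (𝕜 := ℝ) (⊤ : Fin N) : EucSp N →ₗ[ℝ] ℝ) := by
          rw [h]; trivial
      simp at this)
  exact h

/-- Off the hyperplane, folding is two-to-one: a preimage lies in s or in its mirror image. The
factor 3^N comes from using for the reflection only the Lipschitz constant 3 proved above. -/
theorem volume_fold_preimage_le (s : Set (EucSp N)) :
    volume (openCube N ∩ foldLast ⁻¹' s) ≤ (1 + 3 ^ N) * volume (s ∩ upperHalfCube N) := by
  have hsub : openCube N ∩ foldLast ⁻¹' s ⊆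
      (s ∩ upperHalfCube N) ∪ reflLast '' (s ∩ upperHalfCube N) ∪ {y | y ⊤ = 0} := by
    rintro y ⟨hy, hys⟩
    rw [Set.mem_preimage] at hys
    rcases lt_trichotomy (y ⊤) 0 with h | h | h
    · refine Or.inl (Or.inr ⟨reflLast y, ⟨?_, reflLast_mem_upperHalfCube hy h⟩,
        reflLast_reflLast y⟩)
      rwa [← foldLast_of_neg h]
    · exact Or.inr h
    · refine Or.inl (Or.inl ⟨?_, hy, h⟩)
      rwa [foldLast_of_nonneg h.le] at hys
  refine (measure_mono hsub).trans ((measure_union_le _ _).trans ?_)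
  rw [volume_last_eq_zero, add_zero]
  refine (measure_union_le _ _).trans ?_
  rw [add_mul, one_mul]
  exact add_le_add le_rfl (lipschitzWith_reflLast.volume_image_le _)

/-- A boundary chart of a Lipschitz domain, in folded form. -/
theorem exists_lipChart_frontier (hΩ : IsBoundedLipschitzDomain Ω) {x : EucSp N}
    (hx : x ∈ frontier Ω) : ∃ W, x ∈ W ∧ Nonempty (LipChart Ω W) := by
  obtain ⟨W, ψ₀, K₁, K₂, hWo, hxW, hψL, hψA, hψW, hψΩ⟩ := hΩ.chart x hx
  have hinj : Set.InjOn ψ₀ W := by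
    intro y hy z hz h
    have := hψA.injective (a₁ := ⟨y, hy⟩) (a₂ := ⟨z, hz⟩) h
    exact congrArg Subtype.val this
  set φ₀ : EucSp N → EucSp N := Function.invFunOn ψ₀ W with hφ₀
  have hφW : ∀ y ∈ openCube N, φ₀ y ∈ W := fun y hy =>
    Function.invFunOn_mem (by rw [← hψW] at hy; exact hy)
  have hψφ : ∀ y ∈ openCube N, ψ₀ (φ₀ y) = y := fun y hy =>
    Function.invFunOn_eq (by rw [← hψW] at hy; exact hy)
  have hφψ : ∀ y ∈ W, φ₀ (ψ₀ y) = y := fun y hy =>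
    hinj (hφW _ (hψW ▸ ⟨y, hy, rfl⟩)) hy (hψφ _ (hψW ▸ ⟨y, hy, rfl⟩))
  have hφL : LipschitzOnWith K₂ φ₀ (openCube N) := by
    intro y hy z hz
    have := hψA ⟨φ₀ y, hφW y hy⟩ ⟨φ₀ z, hφW z hz⟩
    change edist (φ₀ y) (φ₀ z) ≤ K₂ * edist (ψ₀ (φ₀ y)) (ψ₀ (φ₀ z)) at this
    rwa [hψφ y hy, hψφ z hz] at this
  -- A `LipChart` asks for globally defined Lipschitz maps; both the chart and its inverse are
  -- extended, at the cost of a dimensional constant.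
  obtain ⟨ψ, hψ, hψeq⟩ := hψL.extend_finite_dimension
  obtain ⟨φ, hφ, hφeq⟩ := hφL.extend_finite_dimension
  set L := max (lipschitzExtensionConstant (EucSp N) * K₁) (lipschitzExtensionConstant (EucSp N) * K₂)
    with hL
  have hψ' : LipschitzWith L ψ := hψ.weaken (le_max_left _ _)
  have hφ' : LipschitzWith L φ := hφ.weaken (le_max_right _ _)
  have hψc : ∀ y ∈ W, ψ y ∈ openCube N := fun y hy => by
    rw [← hψeq hy, ← hψW]; exact ⟨y, hy, rfl⟩
  have hinv : ∀ y ∈ W, φ (ψ y) = y := fun y hy => by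
    rw [← hφeq (hψc y hy), ← hψeq hy]; exact hφψ y hy
  have hinv' : ∀ y ∈ openCube N, ψ (φ y) = y := fun y hy => by
    rw [← hφeq hy, ← hψeq (hφW y hy)]; exact hψφ y hy
  have hQΩ : ∀ y ∈ upperHalfCube N, φ y ∈ Ω := by
    intro y hy
    rw [← hψΩ] at hy
    obtain ⟨w, hw, rfl⟩ := hy
    rw [hψeq hw.1, hinv w hw.1]
    exact hw.2
  have hcl : ∀ y ∈ W ∩ closure Ω, ψ y ∈ closure (upperHalfCube N) := by
    rintro y ⟨hyW, hyΩ⟩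
    -- W is open, so a point of W in the closure of Ω is a limit of points of W ∩ Ω, whose images
    -- lie in the half cube.
    have h1 : y ∈ closure (W ∩ Ω) := hWo.inter_closure ⟨hyW, hyΩ⟩
    have h2 := image_closure_subset_closure_image hψ.continuous ⟨y, h1, rfl⟩
    rw [← hψΩ]
    rwa [Set.image_congr (fun z hz => hψeq hz.1)]
  have hnn : ∀ y ∈ closure (upperHalfCube N), 0 ≤ y ⊤ := by
    have : closure (upperHalfCube N) ⊆ {y : EucSp N | 0 ≤ y ⊤} :=
      closure_minimal (fun y hy => hy.2.le)
        (isClosed_Ici.preimage (EuclideanSpace.proj (𝕜 := ℝ) (⊤ : Fin N)).continuous)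
    exact this
  have hP : ∀ y ∈ W ∩ closure Ω, foldLast (ψ y) = ψ y := fun y hy =>
    foldLast_of_nonneg (hnn _ (hcl y hy))
  -- A positive last coordinate would put ψ y in the half cube and hence y in Ω, which is open and
  -- misses its frontier.
  have hfr : ∀ y ∈ W ∩ frontier Ω, (ψ y) ⊤ = 0 := by
    rintro y ⟨hyW, hyf⟩
    refine le_antisymm (not_lt.1 fun h => ?_) (hnn _ (hcl y ⟨hyW, frontier_subset_closure hyf⟩))
    have h1 : ψ y ∈ upperHalfCube N := ⟨hψc y hyW, h⟩
    have h2 := hQΩ _ h1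
    rw [hinv y hyW] at h2
    rw [hΩ.isOpen.frontier_eq] at hyf
    exact hyf.2 h2
  obtain ⟨C₀, hC₀⟩ := euclideanHausdorffMeasure_hyperplane_le (N := N)
  -- The first summand covers both volume distortions, including that of the fold; the second covers
  -- surface growth through the (N-1)-dimensional estimate on the hyperplane.
  set C : ℝ≥0 := L ^ N * (1 + 3 ^ N) + L ^ (N - 1) * C₀ with hC
  refine ⟨W, hxW, ⟨{
    Q := upperHalfCube N
    φ := φ
    P := foldLast ∘ ψ
    K := max L (3 * L)
    C := C
    isOpen_W := hWo
    isOpen_Q := isOpen_upperHalfCube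
    convex_Q := convex_upperHalfCube
    bounded_Q := isBounded_upperHalfCube
    nonempty_Q := nonempty_upperHalfCube
    lip_φ := hφ'.weaken (le_max_left _ _)
    lip_P := (lipschitzWith_foldLast.comp hψ').weaken (le_max_right _ _)
    mapsTo := hQΩ
    mem_closure := fun y hy => by rw [Function.comp_apply, hP y hy]; exact hcl y hy
    left_inv := fun y hy => by rw [Function.comp_apply, hP y hy]; exact hinv y hy.1
    volume_φ := fun s _ => ?_
    volume_P := fun s _ => ?_
    growth := fun z r hr => ?_ }⟩⟩
  · have hsub : upperHalfCube N ∩ φ ⁻¹' s ⊆ ψ '' (s ∩ Ω) := by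
      rintro y ⟨hy, hys⟩
      exact ⟨φ y, ⟨hys, hQΩ y hy⟩, hinv' y hy.1⟩
    refine (measure_mono hsub).trans ((hψ'.volume_image_le _).trans ?_)
    refine mul_le_mul_left ?_ _
    rw [← ENNReal.coe_pow, ENNReal.coe_le_coe, hC]
    refine le_trans ?_ le_self_add
    exact le_mul_of_one_le_right zero_le le_self_add
  · have hsub : W ∩ (foldLast ∘ ψ) ⁻¹' s ⊆ φ '' (openCube N ∩ foldLast ⁻¹' s) := by
      rintro y ⟨hy, hys⟩
      exact ⟨ψ y, ⟨hψc y hy, hys⟩, hinv y hy⟩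
    refine (measure_mono hsub).trans ((hφ'.volume_image_le _).trans ?_)
    refine (mul_le_mul_right (volume_fold_preimage_le s) _).trans ?_
    rw [← mul_assoc]
    refine mul_le_mul_left ?_ _
    rw [hC]
    push_cast
    exact le_self_add
  · have hms : MeasurableSet (W ∩ {y | dist ((foldLast ∘ ψ) y) z ≤ r}) :=
      hWo.measurableSet.inter (measurableSet_le (((lipschitzWith_foldLast.comp
        hψ').continuous.measurable).dist measurable_const) measurable_const)
    rw [bdryMeasure, Measure.restrict_apply hms]
    have hsub : W ∩ {y | dist ((foldLast ∘ ψ) y) z ≤ r} ∩ frontier Ω ⊆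
        φ '' {y : EucSp N | y ⊤ = 0 ∧ dist y z ≤ r} := by
      rintro y ⟨⟨hyW, hyr⟩, hyf⟩
      refine ⟨ψ y, ⟨hfr y ⟨hyW, hyf⟩, ?_⟩, hinv y hyW⟩
      have := hP y ⟨hyW, frontier_subset_closure hyf⟩
      rw [← this]
      exact hyr
    refine (measure_mono hsub).trans ((hφ'.euclideanHausdorffMeasure_image_le _ _).trans ?_)
    refine (mul_le_mul_right (hC₀ z r hr) _).trans ?_
    rw [← mul_assoc]
    refine mul_le_mul_left ?_ _
    rw [hC]
    push_cast
    exact le_add_self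

theorem exists_lipChart (hΩ : IsBoundedLipschitzDomain Ω) {x : EucSp N} (hx : x ∈ closure Ω) :
    ∃ W, x ∈ W ∧ Nonempty (LipChart Ω W) := by
  by_cases h : x ∈ Ω
  · obtain ⟨r, hr, hrΩ⟩ := Metric.isOpen_iff.1 hΩ.isOpen x h
    exact ⟨_, Metric.mem_ball_self hr, nonempty_lipChart_ball hr hrΩ⟩
  · exact exists_lipChart_frontier hΩ (by rw [hΩ.isOpen.frontier_eq]; exact ⟨hx, h⟩)

end ChartExistence

/-! ### Growth of weighted measures; global Sobolev and trace inequalities -/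

section Growth

variable {N : ℕ} {Ω W : Set (EucSp N)}

/-- Hölder's inequality for the measure of a set with respect to a density. -/
theorem withDensity_enorm_le {X : Type*} [MeasurableSpace X] {σ : Measure X} {ψ : X → ℝ} {s : ℝ}
    (hs : 1 ≤ s) (hψ : MemLp ψ (ENNReal.ofReal s) σ) {A : Set X} (hA : MeasurableSet A) :
    σ.withDensity (fun x => ‖ψ x‖ₑ) A
      ≤ eLpNorm ψ (ENNReal.ofReal s) σ * σ A ^ (1 - 1 / s) := by
  rw [withDensity_apply _ hA]
  have h1 := eLpNorm_le_eLpNorm_mul_rpow_measure_univ (μ := σ.restrict A) (f := ψ)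
    (p := 1) (q := ENNReal.ofReal s) (by simpa using hs) (hψ.1.restrict)
  rw [eLpNorm_one_eq_lintegral_enorm, Measure.restrict_apply_univ,
    ENNReal.toReal_ofReal (by linarith), ENNReal.toReal_one, div_one] at h1
  exact h1.trans (mul_le_mul_left (eLpNorm_mono_measure _ Measure.restrict_le_self) _)

/-- By Hölder an L^s density costs only the factor 1 - 1/s in the growth exponent. -/
theorem growth_withDensity {X : Type*} [MeasurableSpace X] {σ : Measure X} {ψ : X → ℝ} {s : ℝ}
    (hs : 1 ≤ s) (hψ : MemLp ψ (ENNReal.ofReal s) σ) {d : ℝ} {C : ℝ≥0} {A : ℝ → Set X}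
    (hA : ∀ r, MeasurableSet (A r))
    (hσ : ∀ r : ℝ, 0 < r → σ (A r) ≤ C * ENNReal.ofReal (r ^ d)) {r : ℝ} (hr : 0 < r) :
    σ.withDensity (fun x => ‖ψ x‖ₑ) (A r) ≤
      ((eLpNorm ψ (ENNReal.ofReal s) σ * (C : ℝ≥0∞) ^ (1 - 1 / s)).toNNReal : ℝ≥0) *
        ENNReal.ofReal (r ^ (d * (1 - 1 / s))) := by
  have hs0 : 0 ≤ 1 - 1 / s := by
    rw [sub_nonneg, div_le_one (by linarith)]; exact hs
  rw [ENNReal.coe_toNNReal (ENNReal.mul_ne_top hψ.2.ne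
    (ENNReal.rpow_ne_top_of_nonneg hs0 ENNReal.coe_ne_top))]
  refine (withDensity_enorm_le hs hψ (hA r)).trans ?_
  rw [mul_assoc]
  refine mul_le_mul_right ?_ _
  refine (ENNReal.rpow_le_rpow (hσ r hr) hs0).trans (le_of_eq ?_)
  rw [ENNReal.mul_rpow_of_nonneg _ _ hs0,
    ENNReal.ofReal_rpow_of_nonneg (Real.rpow_nonneg hr.le _) hs0, ← Real.rpow_mul hr.le]

namespace LipChart

theorem measurableSet_ball (c : LipChart Ω W) (z : EucSp N) (r : ℝ) :
    MeasurableSet ((W ∩ closure Ω) ∩ {x | dist (c.P x) z ≤ r}) :=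
  c.measurableSet_inter.inter
    (measurableSet_le (c.lip_P.continuous.measurable.dist measurable_const) measurable_const)

/-- φ is a Lipschitz left inverse of P, so points whose images under P lie in a common ball of
radius r are within 2Kr of each other. -/
theorem growth_domMeasure (c : LipChart Ω W) :
    ∃ C : ℝ≥0, ∀ z, ∀ r : ℝ, 0 < r →
      domMeasure Ω ((W ∩ closure Ω) ∩ {x | dist (c.P x) z ≤ r}) ≤ C * ENNReal.ofReal (r ^ (N : ℝ)) := by
  have hball : volume (Metric.ball (0 : EucSp N) 1) ≠ ⊤ := measure_ball_lt_top.ne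
  refine ⟨(2 * c.K) ^ N * (volume (Metric.ball (0 : EucSp N) 1)).toNNReal, fun z r hr => ?_⟩
  rcases Set.eq_empty_or_nonempty ((W ∩ closure Ω) ∩ {x | dist (c.P x) z ≤ r}) with h | ⟨x₀, hx₀, hx₀z⟩
  · rw [h, measure_empty]; exact zero_le
  have hsub : (W ∩ closure Ω) ∩ {x | dist (c.P x) z ≤ r} ⊆ Metric.closedBall x₀ (2 * c.K * r) := by
    rintro x ⟨hx, hxz⟩
    rw [Metric.mem_closedBall, ← c.left_inv x hx, ← c.left_inv x₀ hx₀]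
    refine (c.lip_φ.dist_le_mul _ _).trans ?_
    have h1 : dist (c.P x) z ≤ r := hxz
    have h2 : dist (c.P x₀) z ≤ r := hx₀z
    have h3 := dist_triangle_right (c.P x) (c.P x₀) z
    have : (c.K : ℝ) * dist (c.P x) (c.P x₀) ≤ c.K * (2 * r) :=
      mul_le_mul_of_nonneg_left (by linarith) c.K.2
    linarith
  refine (Measure.restrict_apply_le _ _).trans ((measure_mono hsub).trans (le_of_eq ?_))
  rw [Measure.addHaar_closedBall _ _ (by positivity), finrank_euclideanSpace_fin, mul_pow,
    ENNReal.ofReal_mul (by positivity), ENNReal.coe_mul, ENNReal.coe_toNNReal hball,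
    Real.rpow_natCast, mul_right_comm]
  congr 2
  rw [ENNReal.ofReal_pow (by positivity), ENNReal.ofReal_mul (by norm_num)]
  simp

theorem growth_bdryMeasure (c : LipChart Ω W) :
    ∃ C : ℝ≥0, ∀ z, ∀ r : ℝ, 0 < r →
      bdryMeasure Ω ((W ∩ closure Ω) ∩ {x | dist (c.P x) z ≤ r})
        ≤ C * ENNReal.ofReal (r ^ ((N : ℝ) - 1)) :=
  ⟨c.C, fun z r hr => (measure_mono (Set.inter_subset_inter_left _ Set.inter_subset_left)).trans
    (c.growth z r hr)⟩

/-- Measures with growth in a chart are finite there. -/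
theorem measure_lt_top_of_growth (c : LipChart Ω W) {σ : Measure (EucSp N)} {d : ℝ} {C : ℝ≥0}
    (h : ∀ z, ∀ r : ℝ, 0 < r →
      σ ((W ∩ closure Ω) ∩ {x | dist (c.P x) z ≤ r}) ≤ C * ENNReal.ofReal (r ^ d)) :
    σ (W ∩ closure Ω) < ⊤ := by
  obtain ⟨z, hz⟩ := c.nonempty_Q
  obtain ⟨r, hr⟩ := c.bounded_Q.closure.subset_closedBall z
  -- Q is bounded, so a single ball of large radius already catches all of P(W ∩ closure Ω).
  have hsub : W ∩ closure Ω ⊆ (W ∩ closure Ω) ∩ {x | dist (c.P x) z ≤ max r 1} := fun x hx =>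
    ⟨hx, le_trans (Metric.mem_closedBall.1 (hr (c.mem_closure x hx))) (le_max_left _ _)⟩
  exact (measure_mono hsub).trans_lt ((h z (max r 1) (lt_max_of_lt_right one_pos)).trans_lt
    (ENNReal.mul_lt_top ENNReal.coe_lt_top ENNReal.ofReal_lt_top))

end LipChart

theorem domMeasure_compl_closure : domMeasure Ω (closure Ω)ᶜ = 0 := by
  rw [domMeasure, Measure.restrict_apply isClosed_closure.measurableSet.compl]
  have : (closure Ω)ᶜ ∩ Ω = ∅ := by
    rw [Set.inter_comm, ← Set.disjoint_iff_inter_eq_empty, Set.disjoint_compl_right_iff_subset]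
    exact subset_closure
  rw [this, measure_empty]

theorem bdryMeasure_compl_closure : bdryMeasure Ω (closure Ω)ᶜ = 0 := by
  rw [bdryMeasure, Measure.restrict_apply isClosed_closure.measurableSet.compl]
  have : (closure Ω)ᶜ ∩ frontier Ω = ∅ := by
    rw [Set.inter_comm, ← Set.disjoint_iff_inter_eq_empty, Set.disjoint_compl_right_iff_subset]
    exact frontier_subset_closure
  rw [this, measure_empty]

variable [NeZero N]

theorem IsBoundedLipschitzDomain.exists_finite_cover (hΩ : IsBoundedLipschitzDomain Ω) :
    ∃ s : Finset (Set (EucSp N)), (∀ W ∈ s, Nonempty (LipChart Ω W)) ∧ closure Ω ⊆ ⋃ W ∈ s, W := by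
  choose! W hW hc using fun x hx => exists_lipChart hΩ (x := x) hx
  obtain ⟨t, ht, htc⟩ := hΩ.isBounded.isCompact_closure.elim_nhds_subcover W
    (fun x hx => ((hc x hx).some.isOpen_W).mem_nhds (hW x hx))
  classical
  refine ⟨t.image W, ?_, ?_⟩
  · intro V hV
    obtain ⟨x, hx, rfl⟩ := Finset.mem_image.1 hV
    exact hc x (ht x hx)
  · rw [Finset.set_biUnion_finset_image]
    exact htc

theorem lintegral_biUnion_finset_le {X ι : Type*} [MeasurableSpace X] (μ : Measure X)
    (t : Finset ι) (s : ι → Set X) (f : X → ℝ≥0∞) :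
    ∫⁻ x in ⋃ i ∈ t, s i, f x ∂μ ≤ ∑ i ∈ t, ∫⁻ x in s i, f x ∂μ := by
  classical
  induction t using Finset.induction_on with
  | empty => simp
  | insert a t ha ih =>
    rw [Finset.set_biUnion_insert, Finset.sum_insert ha]
    exact (lintegral_union_le _ _ _).trans (add_le_add le_rfl ih)

theorem isFiniteMeasure_bdryMeasure (hΩ : IsBoundedLipschitzDomain Ω) :
    IsFiniteMeasure (bdryMeasure Ω) := by
  obtain ⟨s, hs, hcov⟩ := hΩ.exists_finite_cover
  constructor
  have h1 : bdryMeasure Ω Set.univ ≤ bdryMeasure Ω (⋃ W ∈ s, W ∩ closure Ω) := by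
    rw [← measure_add_measure_compl isClosed_closure.measurableSet, bdryMeasure_compl_closure,
      add_zero]
    refine measure_mono fun x hx => ?_
    obtain ⟨W, hW, hxW⟩ := Set.mem_iUnion₂.1 (hcov hx)
    exact Set.mem_iUnion₂.2 ⟨W, hW, hxW, hx⟩
  refine h1.trans_lt (measure_biUnion_lt_top s.finite_toSet fun W hW => ?_)
  obtain ⟨c⟩ := hs W hW
  obtain ⟨C, hC⟩ := c.growth_bdryMeasure
  exact c.measure_lt_top_of_growth hC

/-- The weighted Sobolev inequality on a Lipschitz domain. -/
theorem exists_lintegral_withDensity_le (hΩ : IsBoundedLipschitzDomain Ω) {p : ℝ} (hp : 1 < p)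
    {σ : Measure (EucSp N)} [IsFiniteMeasure σ] (hσΩ : σ (closure Ω)ᶜ = 0) {d : ℝ}
    (hσ : ∀ W, ∀ c : LipChart Ω W, ∃ C : ℝ≥0, ∀ z, ∀ r : ℝ, 0 < r →
      σ ((W ∩ closure Ω) ∩ {x | dist (c.P x) z ≤ r}) ≤ C * ENNReal.ofReal (r ^ d))
    {s : ℝ} (hs : 1 ≤ s) (hds : (N : ℝ) - p < d * (1 - 1 / s)) {ψ : EucSp N → ℝ}
    (hψ : MemLp ψ (ENNReal.ofReal s) σ) :
    ∃ C : ℝ≥0, ∀ u : EucSp N → ℝ, ContDiff ℝ 1 u →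
      ∫⁻ x, ‖u x‖ₑ ^ p ∂(σ.withDensity fun x => ‖ψ x‖ₑ) ≤
        C * (∫⁻ x, ‖u x‖ₑ ^ p ∂(domMeasure Ω) + ∫⁻ x, ‖fderiv ℝ u x‖ₑ ^ p ∂(domMeasure Ω)) := by
  set m := σ.withDensity fun x => ‖ψ x‖ₑ with hm
  have hfin : IsFiniteMeasure m := isFiniteMeasure_withDensity
    ((hψ.integrable (by simpa using hs)).2.ne)
  obtain ⟨t, ht, hcov⟩ := hΩ.exists_finite_cover
  have hloc : ∀ W ∈ t, ∃ C : ℝ≥0, ∀ u : EucSp N → ℝ, ContDiff ℝ 1 u →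
      ∫⁻ x in W ∩ closure Ω, ‖u x‖ₑ ^ p ∂m ≤
        C * (∫⁻ x, ‖u x‖ₑ ^ p ∂(domMeasure Ω) + ∫⁻ x, ‖fderiv ℝ u x‖ₑ ^ p ∂(domMeasure Ω)) := by
    intro W hW
    obtain ⟨c⟩ := ht W hW
    obtain ⟨C, hC⟩ := hσ W c
    exact c.exists_lintegral_le hp hds m fun z r hr =>
      growth_withDensity hs hψ (fun r => c.measurableSet_ball z r) (fun r hr => hC z r hr) hr
  choose! C hC using hloc
  refine ⟨∑ W ∈ t, C W, fun u hu => ?_⟩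
  have h0 : m (closure Ω)ᶜ = 0 := withDensity_absolutelyContinuous _ _ hσΩ
  have h1 : m.restrict (⋃ W ∈ t, W ∩ closure Ω) = m := by
    refine Measure.restrict_eq_self_of_ae_mem ?_
    filter_upwards [compl_mem_ae_iff.2 h0] with x hx
    rw [Set.mem_compl_iff, Set.notMem_compl_iff] at hx
    obtain ⟨W, hW, hxW⟩ := Set.mem_iUnion₂.1 (hcov hx)
    exact Set.mem_iUnion₂.2 ⟨W, hW, hxW, hx⟩
  rw [← h1]
  calc ∫⁻ x in ⋃ W ∈ t, W ∩ closure Ω, ‖u x‖ₑ ^ p ∂m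
      ≤ ∑ W ∈ t, ∫⁻ x in W ∩ closure Ω, ‖u x‖ₑ ^ p ∂m := lintegral_biUnion_finset_le _ _ _ _
    _ ≤ ∑ W ∈ t, C W * (∫⁻ x, ‖u x‖ₑ ^ p ∂(domMeasure Ω)
          + ∫⁻ x, ‖fderiv ℝ u x‖ₑ ^ p ∂(domMeasure Ω)) :=
        Finset.sum_le_sum fun W hW => hC W hW u hu
    _ = _ := by rw [← Finset.sum_mul]; push_cast; rfl

/-- The trace inequality on a Lipschitz domain. -/
theorem exists_lintegral_bdryMeasure_le (hΩ : IsBoundedLipschitzDomain Ω) {p : ℝ} (hp : 1 < p) :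
    ∃ C : ℝ≥0, ∀ u : EucSp N → ℝ, ContDiff ℝ 1 u →
      ∫⁻ x, ‖u x‖ₑ ^ p ∂(bdryMeasure Ω) ≤
        C * (∫⁻ x, ‖u x‖ₑ ^ p ∂(domMeasure Ω) + ∫⁻ x, ‖fderiv ℝ u x‖ₑ ^ p ∂(domMeasure Ω)) := by
  have := isFiniteMeasure_bdryMeasure hΩ
  have hN : (1 : ℝ) ≤ N := by exact_mod_cast NeZero.one_le (n := N)
  have hp1 : 0 < p - 1 := by linarith
  -- The density 1 lies in every L^s. This s exceeds (N-1)/(p-1), which is what (N-1)(1-1/s) > N-p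
  -- requires, and the form of the choice includes N = 1.
  have hs : 1 ≤ (N : ℝ) / (p - 1) + 1 := by
    have : 0 < (N : ℝ) / (p - 1) := by positivity
    linarith
  have hds : (N : ℝ) - p < ((N : ℝ) - 1) * (1 - 1 / ((N : ℝ) / (p - 1) + 1)) := by
    have h1 : ((N : ℝ) - 1) * (1 / ((N : ℝ) / (p - 1) + 1)) < p - 1 := by
      rw [mul_one_div, div_lt_iff₀ (by linarith), mul_add, mul_div_cancel₀ _ hp1.ne']
      linarith
    rw [mul_sub, mul_one]
    linarith
  have h := exists_lintegral_withDensity_le hΩ hp (σ := bdryMeasure Ω) bdryMeasure_compl_closure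
    (fun W c => c.growth_bdryMeasure) hs hds (ψ := fun _ => 1) (memLp_const 1)
  simpa using h

end Growth

/-! ### Jensen's inequality for lower integrals -/

section Jensen

theorem lintegral_rpow_le {X : Type*} [MeasurableSpace X] (ν : Measure X) {p : ℝ} (hp : 1 < p)
    {f : X → ℝ≥0∞} (hf : AEMeasurable f ν) :
    (∫⁻ x, f x ∂ν) ^ p ≤ ν Set.univ ^ (p - 1) * ∫⁻ x, f x ^ p ∂ν := by
  have hpq := Real.HolderConjugate.conjExponent hp
  have hp0 : 0 < p := by linarith
  have h1 := ENNReal.lintegral_mul_le_Lp_mul_Lq ν hpq hf (g := fun _ => 1) aemeasurable_const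
  simp only [Pi.mul_apply, mul_one, ENNReal.one_rpow, lintegral_one] at h1
  have h2 := ENNReal.rpow_le_rpow h1 hp0.le
  rw [ENNReal.mul_rpow_of_nonneg _ _ hp0.le, ← ENNReal.rpow_mul, ← ENNReal.rpow_mul,
    one_div_mul_cancel hp0.ne', ENNReal.rpow_one, mul_comm] at h2
  have h3 : 1 / p.conjExponent * p = p - 1 := by
    have h4 := hpq.inv_add_inv_eq_one
    have h5 : 1 / p.conjExponent = 1 - p⁻¹ := by rw [one_div]; linarith
    rw [h5, sub_mul, one_mul, inv_mul_cancel₀ hp0.ne']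
  rwa [h3] at h2

/-- The previous inequality for the measure k dμ; for a kernel of total mass 1 the first factor
disappears. -/
theorem lintegral_mul_rpow_le {X : Type*} [MeasurableSpace X] (μ : Measure X) {p : ℝ} (hp : 1 < p)
    {k f : X → ℝ≥0∞} (hk : Measurable k) (hf : Measurable f) :
    (∫⁻ x, k x * f x ∂μ) ^ p ≤ (∫⁻ x, k x ∂μ) ^ (p - 1) * ∫⁻ x, k x * f x ^ p ∂μ := by
  have h := lintegral_rpow_le (μ.withDensity k) hp hf.aemeasurable
  rw [lintegral_withDensity_eq_lintegral_mul _ hk hf,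
    lintegral_withDensity_eq_lintegral_mul _ hk (hf.pow_const p), withDensity_apply _ .univ,
    Measure.restrict_univ] at h
  exact h

end Jensen

/-! ### Convolution with a smooth kernel -/

section Mollify

variable {N : ℕ}

/-- Convolution of `F` with the kernel `k`. -/
noncomputable def mollify (k F : EucSp N → ℝ) (x : EucSp N) : ℝ := ∫ y, k (x - y) * F y

theorem mollify_eq_convolution (k F : EucSp N → ℝ) :
    mollify k F = convolution k F (ContinuousLinearMap.lsmul ℝ ℝ) volume := by
  ext x
  rw [convolution_eq_swap]
  rfl

theorem contDiff_mollify {k F : EucSp N → ℝ} (hk : ContDiff ℝ ∞ k) (hc : HasCompactSupport k)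
    (hF : LocallyIntegrable F) : ContDiff ℝ ∞ (mollify k F) := by
  rw [mollify_eq_convolution]
  exact hc.contDiff_convolution_left _ hk hF

theorem integrable_mul_comp_sub {k F : EucSp N → ℝ} (hk : Continuous k) (hc : HasCompactSupport k)
    (hF : LocallyIntegrable F) (x : EucSp N) : Integrable fun y => k (x - y) * F y :=
  (hc.convolutionExists_left (ContinuousLinearMap.lsmul ℝ ℝ) hk hF x).integrable_swap

theorem fderiv_mollify {k F : EucSp N → ℝ} (hk : ContDiff ℝ ∞ k) (hc : HasCompactSupport k)
    (hF : LocallyIntegrable F) (x v : EucSp N) :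
    fderiv ℝ (mollify k F) x v = ∫ y, fderiv ℝ k (x - y) v * F y := by
  have hk1 : ContDiff ℝ 1 k := hk.of_le (by simp)
  rw [mollify_eq_convolution,
    (hc.hasFDerivAt_convolution_left (ContinuousLinearMap.lsmul ℝ ℝ) hk1 hF x).fderiv,
    convolution_eq_swap, ContinuousLinearMap.integral_apply]
  · refine integral_congr_ae (Eventually.of_forall fun y => ?_)
    simp only [ContinuousLinearMap.precompL_apply]
    rfl
  · exact ((hc.fderiv ℝ).convolutionExists_left _ (hk1.continuous_fderiv one_ne_zero) hF
      x).integrable_swap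

theorem enorm_integral_mul_le (f g : EucSp N → ℝ) :
    ‖∫ y, f y * g y‖ₑ ≤ ∫⁻ y, ‖f y‖ₑ * ‖g y‖ₑ := by
  refine (enorm_integral_le_lintegral_enorm _).trans (le_of_eq ?_)
  simp_rw [enorm_mul]

end Mollify

/-! ### Mollification of Sobolev functions away from the boundary -/

section InteriorMollification

variable {N : ℕ} {Ω : Set (EucSp N)} {p : ℝ} [hp : Fact (1 < p)]

theorem SobolevW1p.locallyIntegrable_indicator (ho : IsOpen Ω) (u : SobolevW1p Ω p) :
    LocallyIntegrable (Ω.indicator u.fn) := by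
  have h1 : MemLp (Ω.indicator u.fn) (ENNReal.ofReal p) volume :=
    (memLp_indicator_iff_restrict ho.measurableSet).2 u.memLp_fn
  exact h1.locallyIntegrable one_le_ofReal_of_fact

/-- The gradient of a mollified Sobolev function is the mollified weak gradient. -/
theorem SobolevW1p.fderiv_mollify_eq (ho : IsOpen Ω) (u : SobolevW1p Ω p) {k : EucSp N → ℝ}
    (hk : ContDiff ℝ ∞ k) (hc : HasCompactSupport k) {x : EucSp N}
    (hx : ∀ y, x - y ∈ tsupport k → y ∈ Ω) (v : EucSp N) :
    fderiv ℝ (mollify k (Ω.indicator u.fn)) x v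
      = ∫ y, k (x - y) * inner ℝ (u.grad y) v ∂(domMeasure Ω) := by
  rw [fderiv_mollify hk hc (u.locallyIntegrable_indicator ho)]
  have hk1 : ContDiff ℝ 1 k := hk.of_le (by simp)
  -- The reflected, translated kernel serves as the test function in the weak gradient identity; the
  -- support hypothesis places it inside Ω, and its derivative has the opposite sign.
  set χ : EucSp N → ℝ := fun y => k (x - y) with hχ
  have hχd : ContDiff ℝ ∞ χ := hk.comp (contDiff_const.sub contDiff_id)
  have hχs : tsupport χ ⊆ (fun y => x - y) ⁻¹' tsupport k :=
    closure_minimal (fun y hy => subset_tsupport k hy)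
      ((isClosed_tsupport k).preimage (continuous_const.sub continuous_id))
  have hχc : HasCompactSupport χ := hc.comp_homeomorph (Homeomorph.subLeft x)
  have hχΩ : tsupport χ ⊆ Ω := fun y hy => hx y (hχs hy)
  have hfd : ∀ y, fderiv ℝ χ y v = - fderiv ℝ k (x - y) v := by
    intro y
    have h1 : HasFDerivAt (fun y : EucSp N => x - y) (-ContinuousLinearMap.id ℝ (EucSp N)) y :=
      (hasFDerivAt_id y).const_sub x
    have h2 := ((hk1.differentiable one_ne_zero (x - y)).hasFDerivAt).comp y h1
    have h3 : fderiv ℝ χ y = (fderiv ℝ k (x - y)).comp (-ContinuousLinearMap.id ℝ (EucSp N)) :=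
      h2.fderiv
    rw [h3]
    simp
  have h1 := u.hasWeakGradient χ hχd hχc hχΩ v
  have h2 : ∫ y, fderiv ℝ k (x - y) v * Ω.indicator u.fn y
      = - ∫ y, u.fn y * fderiv ℝ χ y v ∂(domMeasure Ω) := by
    rw [domMeasure, ← integral_indicator ho.measurableSet, ← integral_neg]
    refine integral_congr_ae (Eventually.of_forall fun y => ?_)
    by_cases hy : y ∈ Ω
    · simp only [Set.indicator_of_mem hy, hfd]; ring
    · simp only [Set.indicator_of_notMem hy]; ring
  rw [h2, h1, neg_neg]

/-- Interior smooth approximation of a Sobolev function. -/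
theorem SobolevW1p.exists_interior_approx (ho : IsOpen Ω) (u : SobolevW1p Ω p) (ρ : ℕ → ℝ)
    (hρ : ∀ n, 0 < ρ n) :
    ∃ f : ℕ → EucSp N → ℝ, (∀ n, ContDiff ℝ ∞ (f n)) ∧
      (∀ᵐ x ∂(domMeasure Ω), Tendsto (fun n => f n x) atTop (𝓝 (u.fn x))) ∧
      ∀ n (A : Set (EucSp N)), MeasurableSet A → (∀ x ∈ A, Metric.closedBall x (ρ n) ⊆ Ω) →
        ∫⁻ x in A, ‖fderiv ℝ (f n) x‖ₑ ^ p ≤ ∫⁻ x, ‖u.grad x‖ₑ ^ p ∂(domMeasure Ω) := by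
  have hp1 := hp.out
  have hp0 : 0 < p := by linarith
  -- The first bound keeps the kernel at points of A inside Ω, the second makes the scale tend to 0.
  set ε : ℕ → ℝ := fun n => min (ρ n) (1 / (n + 1)) with hε
  have hε0 : ∀ n, 0 < ε n := fun n => lt_min (hρ n) (by positivity)
  let η : ℕ → ContDiffBump (0 : EucSp N) := fun n =>
    ⟨ε n / 2, ε n, half_pos (hε0 n), half_lt_self (hε0 n)⟩
  let k : ℕ → EucSp N → ℝ := fun n => (η n).normed volume
  have hk : ∀ n, ContDiff ℝ ∞ (k n) := fun n => (η n).contDiff_normed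
  have hkc : ∀ n, HasCompactSupport (k n) := fun n => (η n).hasCompactSupport_normed
  have hli := u.locallyIntegrable_indicator ho
  refine ⟨fun n => mollify (k n) (Ω.indicator u.fn), fun n => contDiff_mollify (hk n) (hkc n) hli,
    ?_, ?_⟩
  · have h1 : Tendsto (fun n => (η n).rOut) atTop (𝓝 0) :=
      squeeze_zero (fun n => (hε0 n).le) (fun n => min_le_right _ _)
        tendsto_one_div_add_atTop_nhds_zero_nat
    -- Convergence at almost every point needs a bounded ratio of outer to inner radius; here it is
    -- 2 for every n.
    have h2 := ContDiffBump.ae_convolution_tendsto_right_of_locallyIntegrable (μ := volume)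
      (φ := η) (K := 2) h1 (Eventually.of_forall fun n => by
        change ε n ≤ 2 * (ε n / 2); linarith) hli
    rw [domMeasure, ae_restrict_iff' ho.measurableSet]
    filter_upwards [h2] with x hx hxΩ
    rw [Set.indicator_of_mem hxΩ] at hx
    simp_rw [mollify_eq_convolution]
    exact hx
  · intro n A hA hAΩ
    have hkm : Measurable fun z => ‖k n z‖ₑ := ((hk n).continuous.enorm).measurable
    have hgm : Measurable fun y => Ω.indicator (fun y => ‖u.grad y‖ₑ) y :=
      ((Lp.stronglyMeasurable u.1.snd).measurable.enorm).indicator ho.measurableSet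
    set G : EucSp N → ℝ≥0∞ := Ω.indicator (fun y => ‖u.grad y‖ₑ) with hG
    have hk1 : ∫⁻ y, ‖k n y‖ₑ = 1 := by
      have h1 := ofReal_integral_eq_lintegral_ofReal ((η n).integrable_normed (μ := volume))
        (Eventually.of_forall fun y => (η n).nonneg_normed y)
      rw [(η n).integral_normed, ENNReal.ofReal_one] at h1
      rw [h1]
      refine lintegral_congr fun y => ?_
      rw [Real.enorm_eq_ofReal ((η n).nonneg_normed y)]
    have hk1x : ∀ x, ∫⁻ y, ‖k n (x - y)‖ₑ = 1 := fun x => by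
      rw [lintegral_sub_left_eq_self (fun y => ‖k n y‖ₑ) x, hk1]
    have hpt : ∀ x ∈ A, ‖fderiv ℝ (mollify (k n) (Ω.indicator u.fn)) x‖ₑ ≤
        ∫⁻ y, ‖k n (x - y)‖ₑ * G y := by
      intro x hx
      have hxs : ∀ y, x - y ∈ tsupport (k n) → y ∈ Ω := by
        intro y hy
        change x - y ∈ tsupport ((η n).normed volume) at hy
        rw [(η n).tsupport_normed_eq, mem_closedBall_zero_iff] at hy
        refine hAΩ x hx ?_
        rw [Metric.mem_closedBall, dist_comm, dist_eq_norm]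
        exact hy.trans (min_le_left _ _)
      have hfin : ∫⁻ y, ‖k n (x - y)‖ₑ * G y ≠ ⊤ := by
        have : Integrable (fun y => k n (x - y) * ‖Ω.indicator u.grad y‖) := by
          have h1 : MemLp (Ω.indicator u.grad) (ENNReal.ofReal p) volume :=
            (memLp_indicator_iff_restrict ho.measurableSet).2 u.memLp_grad
          exact integrable_mul_comp_sub (hk n).continuous (hkc n)
            (h1.norm.locallyIntegrable one_le_ofReal_of_fact) x
        have h2 := this.2.ne
        convert! h2 using 2
        ext y
        rw [enorm_mul, enorm_norm, hG]
        by_cases hy : y ∈ Ω <;> simp [hy]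
      rw [← ofReal_norm, ENNReal.ofReal_le_iff_le_toReal hfin]
      refine ContinuousLinearMap.opNorm_le_bound _ ENNReal.toReal_nonneg fun v => ?_
      rw [u.fderiv_mollify_eq ho (hk n) (hkc n) hxs]
      have h3 : ‖∫ y, k n (x - y) * inner ℝ (u.grad y) v ∂(domMeasure Ω)‖ₑ ≤
          (∫⁻ y, ‖k n (x - y)‖ₑ * G y) * ‖v‖ₑ := by
        refine (enorm_integral_le_lintegral_enorm _).trans ?_
        rw [domMeasure, ← lintegral_indicator ho.measurableSet, ← lintegral_mul_const' _ _ enorm_ne_top]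
        refine lintegral_mono fun y => ?_
        by_cases hy : y ∈ Ω
        · simp only [Set.indicator_of_mem hy, hG]
          rw [enorm_mul, mul_assoc]
          refine mul_le_mul_right ?_ _
          simp only [← ofReal_norm]
          rw [← ENNReal.ofReal_mul (norm_nonneg _)]
          exact ENNReal.ofReal_le_ofReal (norm_inner_le_norm _ _)
        · simp [hy]
      have h4 := ENNReal.toReal_mono (ENNReal.mul_ne_top hfin enorm_ne_top) h3
      rwa [ENNReal.toReal_mul, toReal_enorm, toReal_enorm] at h4
    have hjm : Measurable fun z : EucSp N × EucSp N => ‖k n (z.1 - z.2)‖ₑ * G z.2 ^ p :=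
      (hkm.comp (measurable_fst.sub measurable_snd)).mul ((hgm.comp measurable_snd).pow_const p)
    calc ∫⁻ x in A, ‖fderiv ℝ (mollify (k n) (Ω.indicator u.fn)) x‖ₑ ^ p
        -- Jensen for the probability density k(x - ·); Fubini then makes the kernel integrate out
        -- once more, so no constant appears.
        ≤ ∫⁻ x in A, ∫⁻ y, ‖k n (x - y)‖ₑ * G y ^ p := by
          refine setLIntegral_mono' hA fun x hx => ?_
          refine (ENNReal.rpow_le_rpow (hpt x hx) hp0.le).trans ?_
          refine (lintegral_mul_rpow_le volume hp1 (hkm.comp (measurable_const.sub measurable_id))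
            hgm).trans (le_of_eq ?_)
          have := hk1x x
          simp only [Function.comp_def, Pi.sub_apply, id] at this ⊢
          rw [this, ENNReal.one_rpow, one_mul]
      _ ≤ ∫⁻ x, ∫⁻ y, ‖k n (x - y)‖ₑ * G y ^ p := setLIntegral_le_lintegral _ _
      _ = ∫⁻ y, ∫⁻ x, ‖k n (x - y)‖ₑ * G y ^ p := lintegral_lintegral_swap hjm.aemeasurable
      _ = ∫⁻ y, G y ^ p := by
          refine lintegral_congr fun y => ?_
          have hkx : Measurable fun x => ‖k n (x - y)‖ₑ :=
            hkm.comp (measurable_id.sub measurable_const)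
          rw [lintegral_mul_const _ hkx, lintegral_sub_right_eq_self (fun x => ‖k n x‖ₑ) y, hk1, one_mul]
      _ = ∫⁻ x, ‖u.grad x‖ₑ ^ p ∂(domMeasure Ω) := by
          rw [domMeasure, ← lintegral_indicator ho.measurableSet]
          refine lintegral_congr fun y => ?_
          by_cases hy : y ∈ Ω
          · simp [hG, hy]
          · simp [hG, hy, hp0]

end InteriorMollification

/-! ### The energy at scale δ and its lower semicontinuity -/

section Energy

variable {N : ℕ}

/-- The energy of order `p` at scale `δ` of a function `w` on a set `A`. -/
noncomputable def energy (p δ : ℝ) (A : Set (EucSp N)) (w : EucSp N → ℝ) : ℝ≥0∞ :=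
  ∫⁻ x in A, ∫⁻ y in A, {y | dist x y ≤ δ}.indicator (fun y => ‖w y - w x‖ₑ ^ p) y

theorem measurable_energy_integrand (p δ : ℝ) {w : EucSp N → ℝ} (hw : Measurable w) :
    Measurable fun z : EucSp N × EucSp N =>
      {y | dist z.1 y ≤ δ}.indicator (fun y => ‖w y - w z.1‖ₑ ^ p) z.2 := by
  have h1 : Measurable fun z : EucSp N × EucSp N => ‖w z.2 - w z.1‖ₑ ^ p :=
    (((hw.comp measurable_snd).sub (hw.comp measurable_fst)).enorm).pow_const p
  have h2 : MeasurableSet {z : EucSp N × EucSp N | dist z.1 z.2 ≤ δ} :=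
    measurableSet_le (measurable_fst.dist measurable_snd) measurable_const
  exact h1.indicator h2

theorem volume_closedBall_zero (δ : ℝ) (hδ : 0 < δ) (x : EucSp N) :
    volume (Metric.closedBall x δ) = ENNReal.ofReal (δ ^ N) * volume (Metric.ball (0 : EucSp N) 1) := by
  rw [Measure.addHaar_closedBall _ _ hδ.le, finrank_euclideanSpace_fin]

/-- The energy of a `C¹` function in a convex chart. -/
theorem energy_comp_le {p : ℝ} (hp : 1 < p) {δ : ℝ} {A : Set (EucSp N)}
    (hA : Convex ℝ A) (hAm : MeasurableSet A) {v : EucSp N → ℝ} (hv : ContDiff ℝ 1 v)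
    {φ : EucSp N → EucSp N} {K : ℝ≥0} (hφ : LipschitzWith K φ) :
    energy p δ A (v ∘ φ) ≤ (K * ENNReal.ofReal δ) ^ p * volume (Metric.closedBall (0 : EucSp N) δ) *
      ∫⁻ y in A, ‖fderiv ℝ v (φ y)‖ₑ ^ p := by
  have hp0 : 0 < p := by linarith
  set w := v ∘ φ with hw
  have hwm : Measurable w := (hv.continuous.comp hφ.continuous).measurable
  set G : EucSp N → ℝ≥0∞ := fun y => ‖fderiv ℝ v (φ y)‖ₑ ^ p with hG
  have hGm : Measurable G :=
    (((hv.continuous_fderiv one_ne_zero).comp hφ.continuous).enorm.measurable).pow_const p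
  set M : ℝ≥0∞ := (K * ENNReal.ofReal δ) ^ p with hM
  have hMt : M ≠ ⊤ := ENNReal.rpow_ne_top_of_nonneg hp0.le
    (ENNReal.mul_ne_top ENNReal.coe_ne_top ENNReal.ofReal_ne_top)
  set B := Metric.closedBall (0 : EucSp N) δ with hB
  have hBm : MeasurableSet B := Metric.isClosed_closedBall.measurableSet
  -- pointwise bound
  have hpt : ∀ x ∈ A, ∀ h ∈ B, x + h ∈ A → ‖w (x + h) - w x‖ₑ ^ p ≤
      M * ∫⁻ t in Set.Ioc (0 : ℝ) 1, A.indicator G (x + t • h) := by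
    intro x hx h hh hxh
    have h1 := enorm_sub_le_lintegral_segment hv hφ x (x + h)
    rw [add_sub_cancel_left] at h1
    have h2 : ‖w (x + h) - w x‖ₑ ≤ K * ENNReal.ofReal δ *
        ∫⁻ t in Set.Ioc (0 : ℝ) 1, ‖fderiv ℝ v (φ (x + t • h))‖ₑ := by
      refine h1.trans (mul_le_mul_left (mul_le_mul_right ?_ _) _)
      rw [← ofReal_norm]
      exact ENNReal.ofReal_le_ofReal (mem_closedBall_zero_iff.1 hh)
    refine (ENNReal.rpow_le_rpow h2 hp0.le).trans ?_
    rw [ENNReal.mul_rpow_of_nonneg _ _ hp0.le]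
    refine mul_le_mul_right ?_ _
    have hc : Continuous fun t : ℝ => φ (x + t • h) := hφ.continuous.comp (by fun_prop)
    refine (lintegral_rpow_le _ hp (((hv.continuous_fderiv
      one_ne_zero).comp hc).enorm.measurable.aemeasurable)).trans ?_
    rw [Measure.restrict_apply_univ, Real.volume_Ioc, sub_zero, ENNReal.ofReal_one,
      ENNReal.one_rpow, one_mul]
    refine setLIntegral_mono' measurableSet_Ioc fun t ht => ?_
    have : x + t • h ∈ A := by
      have := hA.add_smul_mem hx hxh ⟨ht.1.le, ht.2⟩
      exact this
    rw [Set.indicator_of_mem this]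
    rfl
  have hGA : Measurable (A.indicator G) := hGm.indicator hAm
  have hc3 : Continuous fun z : (EucSp N × EucSp N) × ℝ => z.1.1 + z.2 • z.1.2 := by fun_prop
  have hm3 : Measurable fun z : (EucSp N × EucSp N) × ℝ => A.indicator G (z.1.1 + z.2 • z.1.2) :=
    hGA.comp hc3.measurable
  calc energy p δ A w
      ≤ ∫⁻ x in A, ∫⁻ h in B, M * ∫⁻ t in Set.Ioc (0 : ℝ) 1, A.indicator G (x + t • h) := by
        refine setLIntegral_mono' hAm fun x hx => ?_
        rw [← lintegral_indicator hAm, ← lintegral_indicator hBm,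
          ← lintegral_add_left_eq_self _ x]
        refine lintegral_mono fun h => ?_
        by_cases h1 : x + h ∈ A
        · rw [Set.indicator_of_mem h1]
          by_cases h2 : h ∈ B
          · rw [Set.indicator_of_mem h2]
            have h3 : x + h ∈ {y | dist x y ≤ δ} := by
              change dist x (x + h) ≤ δ
              rw [dist_self_add_right]
              exact mem_closedBall_zero_iff.1 h2
            rw [Set.indicator_of_mem h3]
            exact hpt x hx h h2 h1
          · have h3 : x + h ∉ {y | dist x y ≤ δ} := by
              change ¬ dist x (x + h) ≤ δ
              rw [dist_self_add_right]
              exact fun h4 => h2 (mem_closedBall_zero_iff.2 h4)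
            rw [Set.indicator_of_notMem h3]
            exact zero_le
        · rw [Set.indicator_of_notMem h1]
          exact zero_le
    _ ≤ ∫⁻ x, ∫⁻ h in B, M * ∫⁻ t in Set.Ioc (0 : ℝ) 1, A.indicator G (x + t • h) :=
        setLIntegral_le_lintegral _ _
    _ = ∫⁻ h in B, ∫⁻ x, M * ∫⁻ t in Set.Ioc (0 : ℝ) 1, A.indicator G (x + t • h) := by
        refine lintegral_lintegral_swap (Measurable.aemeasurable ?_)
        exact (Measurable.lintegral_prod_right' hm3).const_mul M
    _ = ∫⁻ h in B, M * ∫⁻ y in A, G y := by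
        refine lintegral_congr fun h => ?_
        rw [lintegral_const_mul' _ _ hMt, lintegral_lintegral_swap]
        · congr 1
          -- By translation invariance the integral over x no longer depends on t or h; the
          -- remaining integrals give 1 and the volume of the ball.
          have : ∀ t : ℝ, ∫⁻ x, A.indicator G (x + t • h) = ∫⁻ y in A, G y := fun t => by
            rw [lintegral_add_right_eq_self (fun x => A.indicator G x), lintegral_indicator hAm]
          simp_rw [this]
          rw [setLIntegral_const, Real.volume_Ioc, sub_zero, ENNReal.ofReal_one, mul_one]
        · refine Measurable.aemeasurable ?_
          exact hm3.comp (f := fun z : EucSp N × ℝ => ((z.1, h), z.2))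
            ((measurable_fst.prodMk measurable_const).prodMk measurable_snd)
    _ = _ := by rw [setLIntegral_const]; ring

/-- A bounded open convex set is exhausted by compact convex sets. -/
theorem exists_compact_convex_exhaustion {Q : Set (EucSp N)} (hQ : IsOpen Q) (hQc : Convex ℝ Q)
    (hQb : Bornology.IsBounded Q) : ∃ A : ℕ → Set (EucSp N), (∀ n, IsCompact (A n)) ∧
      (∀ n, Convex ℝ (A n)) ∧ (∀ n, A n ⊆ Q) ∧ ∀ y ∈ Q, ∀ᶠ n in atTop, y ∈ A n := by
  set r : ℕ → ℝ := fun n => 1 / (n + 1) with hr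
  have hr0 : ∀ n, 0 < r n := fun n => by positivity
  set A : ℕ → Set (EucSp N) := fun n => {y | Metric.ball y (r n) ⊆ Q} with hA
  have hAQ : ∀ n, A n ⊆ Q := fun n y hy => hy (Metric.mem_ball_self (hr0 n))
  have hAconv : ∀ n, Convex ℝ (A n) := by
    intro n y hy z hz a b ha hb hab w hw
    -- Moving y and z by the same displacement d stays in Q, and the convex combination of the moved
    -- points is w.
    set d := w - (a • y + b • z) with hd
    have hdn : ‖d‖ < r n := by rw [hd, ← dist_eq_norm]; exact hw
    have h1 : y + d ∈ Q := hy (by simpa using hdn)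
    have h2 : z + d ∈ Q := hz (by simpa using hdn)
    have h3 := hQc h1 h2 ha hb hab
    have h4 : a • (y + d) + b • (z + d) = w := by
      have : a • (y + d) + b • (z + d) = (a • y + b • z) + (a + b) • d := by module
      rw [this, hab, one_smul, hd, add_sub_cancel]
    rwa [h4] at h3
  have hAcl : ∀ n, IsClosed (A n) := by
    intro n
    have : A n = ⋂ z ∈ Qᶜ, {y | r n ≤ dist z y} := by
      ext y
      simp only [hA, Set.mem_iInter]
      constructor
      · intro h z hz
        by_contra hlt
        exact hz (h (Metric.mem_ball.2 (not_le.1 hlt)))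
      · intro h z hz
        by_contra hzQ
        exact absurd (h z hzQ) (not_le.2 (Metric.mem_ball.1 hz))
    rw [this]
    exact isClosed_biInter fun z _ => isClosed_le continuous_const (continuous_const.dist continuous_id)
  have hAcomp : ∀ n, IsCompact (A n) := fun n =>
    Metric.isCompact_of_isClosed_isBounded (hAcl n) (hQb.subset (hAQ n))
  have hAev : ∀ y ∈ Q, ∀ᶠ n in atTop, y ∈ A n := by
    intro y hy
    obtain ⟨ε, hε, hεQ⟩ := Metric.isOpen_iff.1 hQ y hy
    have h1 : Tendsto r atTop (𝓝 0) := tendsto_one_div_add_atTop_nhds_zero_nat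
    filter_upwards [h1.eventually_lt_const hε] with n hn
    exact (Metric.ball_subset_ball hn.le).trans hεQ
  exact ⟨A, hAcomp, hAconv, hAQ, hAev⟩

/-- Lower semicontinuity of the energy. -/
theorem energy_le_of_tendsto_ae {p δ : ℝ} {Q : Set (EucSp N)} (hQ : MeasurableSet Q)
    {A : ℕ → Set (EucSp N)} (hAm : ∀ n, MeasurableSet (A n))
    (hAev : ∀ y ∈ Q, ∀ᶠ n in atTop, y ∈ A n) {w : ℕ → EucSp N → ℝ} (hw : ∀ n, Measurable (w n))
    {v : EucSp N → ℝ}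
    (hQae : ∀ᵐ y ∂(volume.restrict Q), Tendsto (fun n => w n y) atTop (𝓝 (v y)))
    {M : ℝ≥0∞} (hM : ∀ n, energy p δ (A n) (w n) ≤ M) : energy p δ Q v ≤ M := by
  -- The integrand extended by 0 off A n × A n. It converges almost everywhere on Q × Q because
  -- every point eventually lies in A n, and Fatou is applied once in each variable.
  set D : ℕ → EucSp N → EucSp N → ℝ≥0∞ := fun n x y => (A n).indicator (fun x =>
    (A n).indicator (fun y => {y | dist x y ≤ δ}.indicator
      (fun y => ‖(w n) y - (w n) x‖ₑ ^ p) y) y) x with hD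
  have hDm : ∀ n, Measurable fun z : EucSp N × EucSp N => D n z.1 z.2 := by
    intro n
    have h1 := measurable_energy_integrand (N := N) p δ (w := w n) (hw n)
    have h2 := (h1.indicator (measurable_snd (hAm n))).indicator (measurable_fst (hAm n))
    exact h2
  have hDint : ∀ n, ∫⁻ x in Q, ∫⁻ y in Q, D n x y ≤ energy p δ (A n) (w n) := by
    intro n
    rw [energy, ← lintegral_indicator (hAm n)]
    refine (setLIntegral_le_lintegral _ _).trans (lintegral_mono fun x => ?_)
    by_cases hx : x ∈ A n
    · simp only [hD, Set.indicator_of_mem hx]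
      rw [← lintegral_indicator (hAm n)]
      exact setLIntegral_le_lintegral _ _
    · simp [hD, hx]
  have hlim : ∀ᵐ x ∂(volume.restrict Q), ∀ᵐ y ∂(volume.restrict Q),
      liminf (fun n => D n x y) atTop =
        {y | dist x y ≤ δ}.indicator (fun y => ‖(v) y - (v) x‖ₑ ^ p) y := by
    filter_upwards [hQae, ae_restrict_mem hQ] with x hx hxQ
    filter_upwards [hQae, ae_restrict_mem hQ] with y hy hyQ
    refine Tendsto.liminf_eq ?_
    have h1 : Tendsto (fun n => {y | dist x y ≤ δ}.indicator
        (fun y => ‖(w n) y - (w n) x‖ₑ ^ p) y) atTop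
        (𝓝 ({y | dist x y ≤ δ}.indicator (fun y => ‖(v) y - (v) x‖ₑ ^ p) y)) := by
      by_cases hxy : y ∈ {y | dist x y ≤ δ}
      · simp only [Set.indicator_of_mem hxy]
        exact ((ENNReal.continuous_rpow_const.tendsto _).comp
          ((continuous_enorm.tendsto _).comp (hy.sub hx)))
      · simp only [Set.indicator_of_notMem hxy]
        exact tendsto_const_nhds
    refine h1.congr' ?_
    filter_upwards [hAev x hxQ, hAev y hyQ] with n hxn hyn
    simp only [hD, Set.indicator_of_mem hxn, Set.indicator_of_mem hyn]
  calc energy p δ Q (v)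
      = ∫⁻ x in Q, ∫⁻ y in Q, liminf (fun n => D n x y) atTop := by
        refine lintegral_congr_ae ?_
        filter_upwards [hlim] with x hx
        refine lintegral_congr_ae ?_
        filter_upwards [hx] with y hy using hy.symm
    _ ≤ ∫⁻ x in Q, liminf (fun n => ∫⁻ y in Q, D n x y) atTop := by
        refine lintegral_mono fun x => ?_
        exact lintegral_liminf_le fun n => (hDm n).comp measurable_prodMk_left
    _ ≤ liminf (fun n => ∫⁻ x in Q, ∫⁻ y in Q, D n x y) atTop :=
        lintegral_liminf_le fun n => (hDm n).lintegral_prod_right'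
    _ ≤ _ := by
        refine (liminf_le_liminf (Eventually.of_forall fun n => (hDint n).trans (hM n))).trans ?_
        simp

end Energy

/-! ### The energy of a Sobolev function in a chart -/

section ChartEnergy

variable {N : ℕ} {Ω W : Set (EucSp N)} {p : ℝ} [hp : Fact (1 < p)]

/-- The energy of a Sobolev function in a chart. -/
theorem LipChart.energy_le (c : LipChart Ω W) (ho : IsOpen Ω) (u : SobolevW1p Ω p) (δ : ℝ) :
    energy p δ c.Q (u.fn ∘ c.φ) ≤ (c.K * ENNReal.ofReal δ) ^ p *
      volume (Metric.closedBall (0 : EucSp N) δ) *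
        (c.C * ∫⁻ x, ‖u.grad x‖ₑ ^ p ∂(domMeasure Ω)) := by
  have hp1 := hp.out
  have hp0 : 0 < p := by linarith
  obtain ⟨A, hAcomp, hAconv, hAQ, hAev⟩ :=
    exists_compact_convex_exhaustion c.isOpen_Q c.convex_Q c.bounded_Q
  have hAm : ∀ n, MeasurableSet (A n) := fun n => (hAcomp n).measurableSet
  -- The image of the compact set A n has positive distance to the complement of Ω; this fixes a
  -- mollification radius valid on it.
  have himg : ∀ n, ∃ ρ, 0 < ρ ∧ Metric.cthickening ρ (c.φ '' A n) ⊆ Ω := fun n =>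
    ((hAcomp n).image c.lip_φ.continuous).exists_cthickening_subset_open ho
      (Set.image_subset_iff.2 fun y hy => c.mapsTo (hAQ n hy))
  choose ρ hρ0 hρ using himg
  obtain ⟨f, hf, hfae, hfA⟩ := u.exists_interior_approx ho ρ hρ0
  have hf1 : ∀ n, ContDiff ℝ 1 (f n) := fun n => (hf n).of_le (by simp)
  set a := ∫⁻ x, ‖u.grad x‖ₑ ^ p ∂(domMeasure Ω) with ha
  have hφm := c.lip_φ.continuous.measurable
  -- bound for the approximations
  have hbd : ∀ n, energy p δ (A n) (f n ∘ c.φ) ≤ (c.K * ENNReal.ofReal δ) ^ p *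
      volume (Metric.closedBall (0 : EucSp N) δ) * (c.C * a) := by
    intro n
    refine (energy_comp_le hp1 (hAconv n) (hAm n) (hf1 n) c.lip_φ).trans (mul_le_mul_right ?_ _)
    set H : EucSp N → ℝ≥0∞ := fun x => ‖fderiv ℝ (f n) x‖ₑ ^ p with hH
    have hHm : Measurable H := (((hf1 n).continuous_fderiv one_ne_zero).enorm.measurable).pow_const p
    have hIm : MeasurableSet (c.φ '' A n) := ((hAcomp n).image c.lip_φ.continuous).measurableSet
    calc ∫⁻ y in A n, H (c.φ y) ≤ ∫⁻ y in c.Q, (c.φ '' A n).indicator H (c.φ y) := by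
          rw [← lintegral_indicator (hAm n), ← lintegral_indicator c.isOpen_Q.measurableSet]
          refine lintegral_mono fun y => ?_
          by_cases hy : y ∈ A n
          · rw [Set.indicator_of_mem hy, Set.indicator_of_mem (hAQ n hy),
              Set.indicator_of_mem (Set.mem_image_of_mem _ hy)]
          · rw [Set.indicator_of_notMem hy]; exact zero_le
      _ ≤ c.C * ∫⁻ x, (c.φ '' A n).indicator H x ∂(domMeasure Ω) :=
          c.lintegral_comp_φ_le (hHm.indicator hIm)
      _ ≤ c.C * a := by
          refine mul_le_mul_right ?_ _
          rw [lintegral_indicator hIm]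
          refine (lintegral_mono' (Measure.restrict_mono le_rfl Measure.restrict_le_self)
            le_rfl).trans (hfA n _ hIm fun x hx => ?_)
          exact (Metric.closedBall_subset_cthickening hx _).trans (hρ n)
  -- convergence almost everywhere
  have hQae : ∀ᵐ y ∂(volume.restrict c.Q), Tendsto (fun n => f n (c.φ y)) atTop (𝓝 (u.fn (c.φ y))) := by
    -- The exceptional null set in Ω pulls back to a null set in Q by the volume bound for φ; a
    -- measurable superset is taken because that bound is stated for measurable sets.
    obtain ⟨s, hs1, hs2, hs3⟩ := exists_measurable_superset_of_null (ae_iff.1 hfae)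
    rw [ae_iff]
    refine measure_mono_null (t := c.φ ⁻¹' s) (fun y hy => hs1 hy) ?_
    rw [Measure.restrict_apply (hφm hs2), Set.inter_comm]
    refine le_antisymm ((c.volume_φ s hs2).trans ?_) zero_le
    have : volume (s ∩ Ω) = 0 := by rwa [domMeasure, Measure.restrict_apply hs2] at hs3
    rw [this, mul_zero]
  exact energy_le_of_tendsto_ae c.isOpen_Q.measurableSet hAm hAev
    (fun n => (hf n).continuous.measurable.comp hφm) hQae hbd

end ChartEnergy

/-! ### The energy under cut-offs and under folding -/

section ProductEnergy

variable {N : ℕ} {p : ℝ}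

/-- The energy of the product of a cut-off function and a function. -/
theorem energy_mul_le (hp : 1 < p) {W : Set (EucSp N)} (hW : IsOpen W) {χ w : EucSp N → ℝ}
    (hw : Measurable w) {L M : ℝ≥0} (hL : LipschitzWith L χ) (hM : ∀ x, ‖χ x‖ ≤ M) {δ : ℝ}
    (hδ : Metric.cthickening δ (tsupport χ) ⊆ W) :
    energy p δ Set.univ (fun x => χ x * w x) ≤ 2 ^ (p - 1) * ((M : ℝ≥0∞) ^ p * energy p δ W w +
      (L * ENNReal.ofReal δ) ^ p * volume (Metric.closedBall (0 : EucSp N) δ) *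
        ∫⁻ x in W, ‖w x‖ₑ ^ p) := by
  have hp0 : 0 < p := by linarith
  have hWm := hW.measurableSet
  have hMt : (M : ℝ≥0∞) ^ p ≠ ⊤ := ENNReal.rpow_ne_top_of_nonneg hp0.le ENNReal.coe_ne_top
  have h2t : (2 : ℝ≥0∞) ^ (p - 1) ≠ ⊤ :=
    ENNReal.rpow_ne_top_of_nonneg (by linarith) (by simp)
  have hLt : ((L : ℝ≥0∞) * ENNReal.ofReal δ) ^ p ≠ ⊤ := ENNReal.rpow_ne_top_of_nonneg hp0.le
    (ENNReal.mul_ne_top ENNReal.coe_ne_top ENNReal.ofReal_ne_top)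
  -- For such δ, a pair at distance at most δ either lies in W × W or has χ = 0 at both points, so
  -- only the energy of w on W enters.
  have hnear : ∀ x y, dist x y ≤ δ → χ x ≠ 0 → x ∈ W ∧ y ∈ W := by
    intro x y hxy hx
    have hxs : x ∈ tsupport χ := subset_tsupport χ hx
    exact ⟨hδ (Metric.self_subset_cthickening _ hxs),
      hδ (Metric.mem_cthickening_of_dist_le y x δ _ hxs (by rwa [dist_comm]))⟩
  have hpt : ∀ x y, dist x y ≤ δ → ‖χ y * w y - χ x * w x‖ₑ ^ p ≤
      2 ^ (p - 1) * ((M : ℝ≥0∞) ^ p * ‖w y - w x‖ₑ ^ p +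
        ((L : ℝ≥0∞) * ENNReal.ofReal δ) ^ p * ‖w x‖ₑ ^ p) := by
    intro x y hxy
    -- A discrete product rule: the first term is an increment of w, the second is at most Lδ|w x|,
    -- which has the same order in δ after integration.
    have e : χ y * w y - χ x * w x = χ y * (w y - w x) + (χ y - χ x) * w x := by ring
    have h1 : ‖χ y‖ₑ ≤ M := by
      rw [← ofReal_norm, ← ENNReal.ofReal_coe_nnreal]
      exact ENNReal.ofReal_le_ofReal (hM y)
    have h2 : ‖χ y - χ x‖ₑ ≤ L * ENNReal.ofReal δ := by
      rw [← edist_eq_enorm_sub]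
      refine (hL y x).trans (mul_le_mul_right ?_ _)
      rw [edist_dist, dist_comm]
      exact ENNReal.ofReal_le_ofReal hxy
    calc ‖χ y * w y - χ x * w x‖ₑ ^ p
        ≤ (M * ‖w y - w x‖ₑ + L * ENNReal.ofReal δ * ‖w x‖ₑ) ^ p := by
          refine ENNReal.rpow_le_rpow ?_ hp0.le
          rw [e]
          refine (enorm_add_le _ _).trans ?_
          rw [enorm_mul, enorm_mul]
          gcongr
      _ ≤ _ := by
          refine (add_rpow_le_two_rpow_mul _ _ hp).trans ?_
          rw [ENNReal.mul_rpow_of_nonneg _ _ hp0.le,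
            ENNReal.mul_rpow_of_nonneg (↑L * ENNReal.ofReal δ) _ hp0.le]
  obtain ⟨H, hH⟩ : ∃ H : EucSp N → EucSp N → ℝ≥0∞, H = fun x y => W.indicator (fun x => W.indicator
      (fun y => {y | dist x y ≤ δ}.indicator (fun y => ‖w y - w x‖ₑ ^ p) y) y) x := ⟨_, rfl⟩
  have hHm : Measurable fun z : EucSp N × EucSp N => H z.1 z.2 := by
    have := ((measurable_energy_integrand p δ hw).indicator (measurable_snd hWm)).indicator
      (measurable_fst hWm)
    rw [hH]
    exact this
  have hHi : ∫⁻ x, ∫⁻ y, H x y = energy p δ W w := by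
    rw [energy, ← lintegral_indicator hWm]
    refine lintegral_congr fun x => ?_
    rw [hH]
    by_cases hx : x ∈ W
    · simp only [Set.indicator_of_mem hx]
      rw [lintegral_indicator hWm]
    · simp only [Set.indicator_of_notMem hx, lintegral_zero]
  have hwp : Measurable fun x => ‖w x‖ₑ ^ p := hw.enorm.pow_const p
  obtain ⟨J, hJ⟩ : ∃ J : EucSp N → EucSp N → ℝ≥0∞, J = fun x y =>
    W.indicator (fun x => ‖w x‖ₑ ^ p) x * (Metric.closedBall x δ).indicator 1 y := ⟨_, rfl⟩
  have hJi : ∫⁻ x, ∫⁻ y, J x y =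
      (∫⁻ x in W, ‖w x‖ₑ ^ p) * volume (Metric.closedBall (0 : EucSp N) δ) := by
    rw [← lintegral_indicator hWm, ← lintegral_mul_const _ (hwp.indicator hWm)]
    refine lintegral_congr fun x => ?_
    rw [hJ]
    simp only
    rw [lintegral_const_mul _ (measurable_one.indicator Metric.isClosed_closedBall.measurableSet),
      lintegral_indicator_one Metric.isClosed_closedBall.measurableSet,
      Measure.addHaar_closedBall_center]
  calc energy p δ Set.univ (fun x => χ x * w x)
      ≤ ∫⁻ x, ∫⁻ y, 2 ^ (p - 1) * ((M : ℝ≥0∞) ^ p * H x y +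
          ((L : ℝ≥0∞) * ENNReal.ofReal δ) ^ p * J x y) := by
        rw [energy, Measure.restrict_univ]
        refine lintegral_mono fun x => lintegral_mono fun y => ?_
        by_cases hxy : dist x y ≤ δ
        · have hy1 : y ∈ {y | dist x y ≤ δ} := hxy
          have hy2 : y ∈ Metric.closedBall x δ := by rwa [Metric.mem_closedBall, dist_comm]
          rw [Set.indicator_of_mem hy1]
          by_cases hW' : x ∈ W ∧ y ∈ W
          · rw [hH, hJ]
            simp only [Set.indicator_of_mem hW'.1, Set.indicator_of_mem hW'.2,
              Set.indicator_of_mem hy1, Set.indicator_of_mem hy2, Pi.one_apply, mul_one]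
            exact hpt x y hxy
          · have hx0 : χ x = 0 := by
              by_contra h
              exact hW' (hnear x y hxy h)
            have hy0 : χ y = 0 := by
              by_contra h
              exact hW' (hnear y x (by rwa [dist_comm]) h).symm
            simp [hx0, hy0, hp0]
        · rw [Set.indicator_of_notMem (by exact hxy)]
          exact zero_le
    _ = 2 ^ (p - 1) * ((M : ℝ≥0∞) ^ p * energy p δ W w +
          ((L : ℝ≥0∞) * ENNReal.ofReal δ) ^ p * ((∫⁻ x in W, ‖w x‖ₑ ^ p) *
            volume (Metric.closedBall (0 : EucSp N) δ))) := by
        have hi : ∀ x, ∫⁻ y, 2 ^ (p - 1) * ((M : ℝ≥0∞) ^ p * H x y +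
            ((L : ℝ≥0∞) * ENNReal.ofReal δ) ^ p * J x y) =
            2 ^ (p - 1) * ((M : ℝ≥0∞) ^ p * (∫⁻ y, H x y) +
            ((L : ℝ≥0∞) * ENNReal.ofReal δ) ^ p * ∫⁻ y, J x y) := by
          intro x
          have hma : Measurable (H x) := hHm.comp measurable_prodMk_left
          rw [lintegral_const_mul' _ _ h2t, lintegral_add_left (hma.const_mul _),
            lintegral_const_mul' _ _ hMt, lintegral_const_mul' _ _ hLt]
        simp_rw [hi]
        have hma : Measurable fun x => ∫⁻ y, H x y := hHm.lintegral_prod_right'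
        rw [lintegral_const_mul' _ _ h2t, lintegral_add_left (hma.const_mul _),
          lintegral_const_mul' _ _ hMt, lintegral_const_mul' _ _ hLt, hHi, hJi]
    _ = _ := by ring

/-- P sends pairs at distance δ to pairs at distance at most Kδ and distorts volume by at most C in
each variable. The factor K + 1 keeps the new scale positive even if K = 0. -/
theorem LipChart.energy_comp_P_le {Ω W : Set (EucSp N)} (c : LipChart Ω W) {v : EucSp N → ℝ}
    (hv : Measurable v) {δ : ℝ} (hδ : 0 ≤ δ) :
    energy p δ W (v ∘ c.P) ≤ c.C * (c.C * energy p ((c.K + 1) * δ) c.Q v) := by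
  set δ' : ℝ := (c.K + 1) * δ with hδ'
  obtain ⟨H, hH⟩ : ∃ H : EucSp N → EucSp N → ℝ≥0∞, H = fun x y =>
    {y | dist x y ≤ δ'}.indicator (fun y => ‖v y - v x‖ₑ ^ p) y := ⟨_, rfl⟩
  have hHm : Measurable fun z : EucSp N × EucSp N => H z.1 z.2 := by
    rw [hH]
    exact measurable_energy_integrand p δ' hv
  have hHi : energy p δ' c.Q v = ∫⁻ x in c.Q, ∫⁻ y in c.Q, H x y := by rw [hH]; rfl
  have hma : Measurable fun x => ∫⁻ y in c.Q, H x y := hHm.lintegral_prod_right'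
  rw [hHi]
  calc energy p δ W (v ∘ c.P)
      ≤ ∫⁻ x in W, ∫⁻ y in W, H (c.P x) (c.P y) := by
        refine lintegral_mono fun x => lintegral_mono fun y => ?_
        by_cases hxy : dist x y ≤ δ
        · have h1 : c.P y ∈ {y | dist (c.P x) y ≤ δ'} := by
            change dist (c.P x) (c.P y) ≤ δ'
            refine (c.lip_P.dist_le_mul x y).trans ?_
            rw [hδ']
            have := mul_le_mul_of_nonneg_left hxy c.K.coe_nonneg
            linarith
          rw [Set.indicator_of_mem (show y ∈ {y | dist x y ≤ δ} from hxy), hH]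
          simp only [Set.indicator_of_mem h1]
          exact le_rfl
        · rw [Set.indicator_of_notMem (by exact hxy)]
          exact zero_le
    _ ≤ ∫⁻ x in W, c.C * ∫⁻ y in c.Q, H (c.P x) y := by
        refine lintegral_mono fun x => ?_
        have : Measurable (H (c.P x)) := hHm.comp measurable_prodMk_left
        exact c.lintegral_comp_P_le this
    _ = c.C * ∫⁻ x in W, ∫⁻ y in c.Q, H (c.P x) y :=
        lintegral_const_mul' _ _ ENNReal.coe_ne_top
    _ ≤ _ := mul_le_mul_right (c.lintegral_comp_P_le hma) _

end ProductEnergy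

/-! ### Extension by folding and its energy -/

section Extension

variable {N : ℕ} {Ω W : Set (EucSp N)} {p : ℝ} [hp : Fact (1 < p)]

/-- The localized extension by folding of a function to the whole space. -/
noncomputable def LipChart.extend (c : LipChart Ω W) (χ u : EucSp N → ℝ) (x : EucSp N) : ℝ :=
  χ x * u (c.φ (c.P x))

/-- On W ∩ Ω the map φ ∘ P is the identity, and off W the cut-off vanishes, so the extension agrees
with χu on Ω. -/
theorem LipChart.extend_of_mem (c : LipChart Ω W) {χ : EucSp N → ℝ} (hχ : tsupport χ ⊆ W)
    (u : EucSp N → ℝ) {x : EucSp N} (hx : x ∈ Ω) : c.extend χ u x = χ x * u x := by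
  by_cases hxW : x ∈ W
  · rw [LipChart.extend, c.left_inv x ⟨hxW, subset_closure hx⟩]
  · have : χ x = 0 := by
      by_contra h
      exact hxW (hχ (subset_tsupport χ h))
    rw [LipChart.extend, this, zero_mul, zero_mul]

theorem SobolevW1p.lintegral_rpow_lt_top (u : SobolevW1p Ω p) :
    ∫⁻ x, ‖u.fn x‖ₑ ^ p ∂(domMeasure Ω) < ⊤ := by
  have hp0 : 0 < p := by linarith [hp.out]
  have := lintegral_rpow_enorm_lt_top_of_eLpNorm_lt_top (by simpa using hp0) ENNReal.ofReal_ne_top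
    u.memLp_fn.2
  rwa [ENNReal.toReal_ofReal hp0.le] at this

theorem SobolevW1p.lintegral_grad_rpow_lt_top (u : SobolevW1p Ω p) :
    ∫⁻ x, ‖u.grad x‖ₑ ^ p ∂(domMeasure Ω) < ⊤ := by
  have hp0 : 0 < p := by linarith [hp.out]
  have := lintegral_rpow_enorm_lt_top_of_eLpNorm_lt_top (by simpa using hp0) ENNReal.ofReal_ne_top
    u.memLp_grad.2
  rwa [ENNReal.toReal_ofReal hp0.le] at this

theorem SobolevW1p.measurable_fn (u : SobolevW1p Ω p) : Measurable u.fn :=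
  (Lp.stronglyMeasurable u.1.fst).measurable

theorem LipChart.lintegral_comp_fn_lt_top (c : LipChart Ω W) (u : SobolevW1p Ω p) :
    ∫⁻ x in W, ‖u.fn (c.φ (c.P x))‖ₑ ^ p < ⊤ := by
  have hm : Measurable fun x => ‖u.fn x‖ₑ ^ p := u.measurable_fn.enorm.pow_const p
  have h1 := c.lintegral_comp_P_le (hm.comp c.lip_φ.continuous.measurable)
  have h2 := c.lintegral_comp_φ_le hm
  refine (h1.trans (mul_le_mul_right h2 _)).trans_lt ?_
  exact ENNReal.mul_lt_top ENNReal.coe_lt_top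
    (ENNReal.mul_lt_top ENNReal.coe_lt_top u.lintegral_rpow_lt_top)

theorem LipChart.measurable_extend (c : LipChart Ω W) {χ : EucSp N → ℝ} (hχ : Continuous χ)
    (u : SobolevW1p Ω p) : Measurable (c.extend χ u.fn) :=
  hχ.measurable.mul (u.measurable_fn.comp
    (c.lip_φ.continuous.measurable.comp c.lip_P.continuous.measurable))

theorem LipChart.lintegral_extend_lt_top (c : LipChart Ω W) {χ : EucSp N → ℝ}
    (hχs : tsupport χ ⊆ W) {M : ℝ≥0} (hM : ∀ x, ‖χ x‖ ≤ M) (u : SobolevW1p Ω p) :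
    ∫⁻ x, ‖c.extend χ u.fn x‖ₑ ^ p < ⊤ := by
  have hp0 : 0 < p := by linarith [hp.out]
  have hMt : (M : ℝ≥0∞) ^ p ≠ ⊤ := ENNReal.rpow_ne_top_of_nonneg hp0.le ENNReal.coe_ne_top
  calc ∫⁻ x, ‖c.extend χ u.fn x‖ₑ ^ p
      ≤ ∫⁻ x in W, (M : ℝ≥0∞) ^ p * ‖u.fn (c.φ (c.P x))‖ₑ ^ p := by
        rw [← lintegral_indicator c.isOpen_W.measurableSet]
        refine lintegral_mono fun x => ?_
        by_cases hx : x ∈ W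
        · rw [Set.indicator_of_mem hx, ← ENNReal.mul_rpow_of_nonneg _ _ hp0.le, LipChart.extend,
            enorm_mul]
          refine ENNReal.rpow_le_rpow (mul_le_mul_left ?_ _) hp0.le
          rw [← ofReal_norm, ← ENNReal.ofReal_coe_nnreal]
          exact ENNReal.ofReal_le_ofReal (hM x)
        · have : χ x = 0 := by
            by_contra h
            exact hx (hχs (subset_tsupport χ h))
          rw [LipChart.extend, this]
          simp [hp0]
    _ = (M : ℝ≥0∞) ^ p * ∫⁻ x in W, ‖u.fn (c.φ (c.P x))‖ₑ ^ p := lintegral_const_mul' _ _ hMt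
    _ < ⊤ := ENNReal.mul_lt_top hMt.lt_top (c.lintegral_comp_fn_lt_top u)

/-- The three energy estimates (chart, fold, cut-off) chained: each loses a constant and rescales δ
by a constant, so the order δ^(p+N) is kept. The threshold δ₀ comes from the distance of the support
of χ to the complement of W. -/
theorem LipChart.exists_energy_extend_le (c : LipChart Ω W) (ho : IsOpen Ω) {χ : EucSp N → ℝ}
    (hχ : ContDiff ℝ ∞ χ) (hχc : HasCompactSupport χ) (hχs : tsupport χ ⊆ W)
    (u : SobolevW1p Ω p) :
    ∃ δ₀ : ℝ, 0 < δ₀ ∧ ∃ C : ℝ≥0, ∀ δ, 0 < δ → δ ≤ δ₀ →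
      energy p δ Set.univ (c.extend χ u.fn) ≤
        C * (ENNReal.ofReal δ ^ p * ENNReal.ofReal (δ ^ N)) := by
  have hp0 : 0 < p := by linarith [hp.out]
  obtain ⟨L, hL⟩ := (hχ.of_le (m := 1) (by simp)).lipschitzWith_of_hasCompactSupport hχc one_ne_zero
  obtain ⟨M, hM⟩ : ∃ M : ℝ≥0, ∀ x, ‖χ x‖ ≤ M := by
    obtain ⟨M, hM⟩ := hχ.continuous.bounded_above_of_compact_support hχc
    exact ⟨⟨max M 0, le_max_right _ _⟩, fun x => (hM x).trans (le_max_left _ _)⟩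
  obtain ⟨δ₀, hδ₀, hδ₀W⟩ := hχc.isCompact.exists_cthickening_subset_open c.isOpen_W hχs
  have hWi := c.lintegral_comp_fn_lt_top u
  have hgi := u.lintegral_grad_rpow_lt_top
  set I := ∫⁻ x in W, ‖u.fn (c.φ (c.P x))‖ₑ ^ p with hI
  set G := ∫⁻ x, ‖u.grad x‖ₑ ^ p ∂(domMeasure Ω) with hG
  set V := volume (Metric.ball (0 : EucSp N) 1) with hV
  have hVt : V < ⊤ := measure_ball_lt_top
  set κ : ℝ := c.K + 1 with hκ
  have hκ0 : 0 < κ := by positivity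
  set T : ℝ≥0∞ := 2 ^ (p - 1) * ((M : ℝ≥0∞) ^ p * (c.C * (c.C *
    ((c.K * ENNReal.ofReal κ) ^ p * (ENNReal.ofReal (κ ^ N) * V) * (c.C * G)))) +
    (L : ℝ≥0∞) ^ p * V * I) with hT
  have hr : ∀ a : ℝ≥0∞, a ≠ ⊤ → a ^ p < ⊤ := fun a ha =>
    (ENNReal.rpow_ne_top_of_nonneg hp0.le ha).lt_top
  have hTt : T < ⊤ := by
    refine ENNReal.mul_lt_top (ENNReal.rpow_ne_top_of_nonneg (by linarith [hp.out])
      (by simp)).lt_top (ENNReal.add_lt_top.2 ⟨?_, ?_⟩)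
    · refine ENNReal.mul_lt_top (hr _ ENNReal.coe_ne_top) (ENNReal.mul_lt_top ENNReal.coe_lt_top
        (ENNReal.mul_lt_top ENNReal.coe_lt_top (ENNReal.mul_lt_top (ENNReal.mul_lt_top
        (hr _ (ENNReal.mul_ne_top ENNReal.coe_ne_top ENNReal.ofReal_ne_top))
        (ENNReal.mul_lt_top ENNReal.ofReal_lt_top hVt)) (ENNReal.mul_lt_top ENNReal.coe_lt_top hgi))))
    · exact ENNReal.mul_lt_top (ENNReal.mul_lt_top (hr _ ENNReal.coe_ne_top) hVt) hWi
  refine ⟨δ₀, hδ₀, T.toNNReal, fun δ hδ hδδ₀ => ?_⟩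
  rw [ENNReal.coe_toNNReal hTt.ne]
  have hwm : Measurable (u.fn ∘ c.φ) := u.measurable_fn.comp c.lip_φ.continuous.measurable
  have h1 := energy_mul_le hp.out c.isOpen_W
    (hwm.comp c.lip_P.continuous.measurable) hL hM
    ((Metric.cthickening_mono hδδ₀ _).trans hδ₀W)
  have h2 := c.energy_comp_P_le (p := p) hwm hδ.le
  have h3 := c.energy_le ho u (κ * δ)
  rw [volume_closedBall_zero _ (mul_pos hκ0 hδ)] at h3
  rw [volume_closedBall_zero _ hδ] at h1
  refine h1.trans ?_
  calc _ ≤ 2 ^ (p - 1) * ((M : ℝ≥0∞) ^ p * (c.C * (c.C * ((c.K * ENNReal.ofReal (κ * δ)) ^ p *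
        (ENNReal.ofReal ((κ * δ) ^ N) * V) * (c.C * G)))) +
        (L * ENNReal.ofReal δ) ^ p * (ENNReal.ofReal (δ ^ N) * V) * I) := by
        refine mul_le_mul_right (add_le_add (mul_le_mul_right (h2.trans ?_) _) le_rfl) _
        exact mul_le_mul_right (mul_le_mul_right h3 _) _
    _ = _ := by
        rw [hT, ENNReal.ofReal_mul hκ0.le, mul_pow, ENNReal.ofReal_mul (by positivity),
          ← mul_assoc (c.K : ℝ≥0∞), ENNReal.mul_rpow_of_nonneg _ (ENNReal.ofReal δ) hp0.le,
          ENNReal.mul_rpow_of_nonneg _ (ENNReal.ofReal δ) hp0.le]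
        ring

end Extension

/-! ### From energy decay to smooth approximation -/

section Smoothing

variable {N : ℕ} {p : ℝ}

theorem enorm_clm_le_of_forall {T : EucSp N →L[ℝ] ℝ} {a : ℝ≥0∞}
    (h : ∀ v, ‖T v‖ₑ ≤ a * ‖v‖ₑ) : ‖T‖ₑ ≤ a := by
  by_cases ha : a = ⊤
  · rw [ha]; exact le_top
  rw [← ofReal_norm, ENNReal.ofReal_le_iff_le_toReal ha]
  refine ContinuousLinearMap.opNorm_le_bound _ ENNReal.toReal_nonneg fun v => ?_
  have h4 := ENNReal.toReal_mono (ENNReal.mul_ne_top ha enorm_ne_top) (h v)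
  rwa [ENNReal.toReal_mul, toReal_enorm, toReal_enorm] at h4

/-- An oscillation average of radius `δ` is bounded by the energy. -/
theorem lintegral_oscillation_le (hp : 1 < p) {F : EucSp N → ℝ} (hF : Measurable F) {δ : ℝ}
    (B : ℝ≥0) {T : EucSp N → ℝ≥0∞}
    (hT : ∀ x, T x ≤ B * ∫⁻ y in Metric.closedBall x δ, ‖F y - F x‖ₑ) :
    ∫⁻ x, T x ^ p ≤ (B : ℝ≥0∞) ^ p * (volume (Metric.closedBall (0 : EucSp N) δ) ^ (p - 1) *
      energy p δ Set.univ F) := by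
  have hp0 : 0 < p := by linarith
  have hBt : (B : ℝ≥0∞) ^ p ≠ ⊤ := ENNReal.rpow_ne_top_of_nonneg hp0.le ENNReal.coe_ne_top
  have hVt : volume (Metric.closedBall (0 : EucSp N) δ) ^ (p - 1) ≠ ⊤ :=
    ENNReal.rpow_ne_top_of_nonneg (by linarith) measure_closedBall_lt_top.ne
  rw [energy, Measure.restrict_univ, ← lintegral_const_mul' _ _ hVt, ← lintegral_const_mul' _ _ hBt]
  refine lintegral_mono fun x => ?_
  refine (ENNReal.rpow_le_rpow (hT x) hp0.le).trans ?_
  rw [ENNReal.mul_rpow_of_nonneg _ _ hp0.le]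
  refine mul_le_mul_right ?_ _
  refine (lintegral_rpow_le _ hp (hF.sub measurable_const).enorm.aemeasurable).trans ?_
  rw [Measure.restrict_apply_univ, Measure.addHaar_closedBall_center]
  refine mul_le_mul_right ?_ _
  rw [← lintegral_indicator Metric.isClosed_closedBall.measurableSet]
  refine lintegral_mono fun y => ?_
  by_cases hy : dist x y ≤ δ
  · rw [Set.indicator_of_mem (show y ∈ {y | dist x y ≤ δ} from hy),
      Set.indicator_of_mem (Metric.mem_closedBall.2 (by rwa [dist_comm]))]
    exact le_rfl
  · rw [Set.indicator_of_notMem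
      (fun h => hy (by rw [dist_comm]; exact Metric.mem_closedBall.1 h))]
    exact zero_le

/-- Used for the kernel and for its directional derivatives: both are supported in the δ-ball, so
only their sup bound and the oscillation of F there matter. -/
theorem enorm_integral_kernel_le {F k : EucSp N → ℝ} {δ : ℝ} {B : ℝ≥0}
    (hk0 : ∀ x, x ∉ Metric.closedBall (0 : EucSp N) δ → k x = 0) (x : EucSp N) {b : ℝ≥0∞}
    (hkB : ∀ x, ‖k x‖ₑ ≤ B * b) (hb : b ≠ ⊤) :
    ‖∫ y, k (x - y) * (F y - F x)‖ₑ ≤ (B * ∫⁻ y in Metric.closedBall x δ, ‖F y - F x‖ₑ) * b := by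
  refine (enorm_integral_mul_le _ _).trans ?_
  rw [← lintegral_indicator Metric.isClosed_closedBall.measurableSet, mul_right_comm,
    ← lintegral_const_mul' _ _ (ENNReal.mul_ne_top ENNReal.coe_ne_top hb)]
  refine lintegral_mono fun y => ?_
  by_cases hy : y ∈ Metric.closedBall x δ
  · rw [Set.indicator_of_mem hy]
    exact mul_le_mul_left (hkB _) _
  · rw [hk0 (x - y), enorm_zero, zero_mul]
    · exact zero_le
    · rwa [mem_closedBall_zero_iff, ← dist_eq_norm, dist_comm]

/-- A smooth kernel at scale `δ`. -/
theorem exists_kernel (N : ℕ) : ∃ B : ℝ≥0, ∀ δ : ℝ, 0 < δ → ∃ k : EucSp N → ℝ,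
    ContDiff ℝ ∞ k ∧ HasCompactSupport k ∧ ∫ x, k x = 1 ∧
    (∀ x, x ∉ Metric.closedBall (0 : EucSp N) δ → k x = 0 ∧ fderiv ℝ k x = 0) ∧
    (∀ x, ‖k x‖ₑ ≤ B * (ENNReal.ofReal (δ ^ N))⁻¹) ∧
    ∀ x, ‖fderiv ℝ k x‖ₑ ≤ B * ((ENNReal.ofReal (δ ^ N))⁻¹ * (ENNReal.ofReal δ)⁻¹) := by
  let η : ContDiffBump (0 : EucSp N) := ⟨1 / 2, 1, by norm_num, by norm_num⟩
  set κ : EucSp N → ℝ := η.normed volume with hκ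
  have hκd : ContDiff ℝ ∞ κ := η.contDiff_normed
  have hκc : HasCompactSupport κ := η.hasCompactSupport_normed
  have hκ1 : ContDiff ℝ 1 κ := hκd.of_le (by simp)
  obtain ⟨B1, hB1⟩ := hκd.continuous.bounded_above_of_compact_support hκc
  obtain ⟨B2, hB2⟩ := (hκ1.continuous_fderiv one_ne_zero).bounded_above_of_compact_support
    (hκc.fderiv ℝ)
  set B : ℝ≥0 := Real.toNNReal (max B1 B2) with hB
  have hB' : max B1 B2 ≤ B := Real.le_coe_toNNReal _
  refine ⟨B, fun δ hδ => ?_⟩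
  set k : EucSp N → ℝ := fun x => (δ ^ N)⁻¹ * κ (δ⁻¹ • x) with hk
  have hδN : 0 < δ ^ N := pow_pos hδ N
  have hkd : ContDiff ℝ ∞ k := contDiff_const.mul (hκd.comp (contDiff_const_smul _))
  have hfd : ∀ x, fderiv ℝ k x = ((δ ^ N)⁻¹ * δ⁻¹) • fderiv ℝ κ (δ⁻¹ • x) := by
    intro x
    have h1 : HasFDerivAt (fun y : EucSp N => δ⁻¹ • y)
        (δ⁻¹ • ContinuousLinearMap.id ℝ (EucSp N)) x := (hasFDerivAt_id x).const_smul δ⁻¹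
    have h2 := ((hκ1.differentiable one_ne_zero (δ⁻¹ • x)).hasFDerivAt).comp x h1
    have h3 := (h2.const_mul ((δ ^ N)⁻¹)).fderiv
    rw [hk]
    refine h3.trans ?_
    ext v
    simp [mul_assoc]
  have hsupp : tsupport κ = Metric.closedBall 0 1 := η.tsupport_normed_eq
  have hout : ∀ x, x ∉ Metric.closedBall (0 : EucSp N) δ → δ⁻¹ • x ∉ tsupport κ := by
    intro x hx h
    rw [hsupp, mem_closedBall_zero_iff, norm_smul, norm_inv, Real.norm_eq_abs, abs_of_pos hδ,
      inv_mul_le_iff₀ hδ, mul_one] at h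
    exact hx (mem_closedBall_zero_iff.2 h)
  have hz : ∀ x, x ∉ Metric.closedBall (0 : EucSp N) δ → k x = 0 ∧ fderiv ℝ k x = 0 := by
    intro x hx
    constructor
    · rw [hk]
      simp only [image_eq_zero_of_notMem_tsupport (hout x hx), mul_zero]
    · rw [hfd, image_eq_zero_of_notMem_tsupport
        (fun h => hout x hx (tsupport_fderiv_subset ℝ h)), smul_zero]
  have he : ∀ {a : ℝ}, 0 < a → ‖a⁻¹‖ₑ = (ENNReal.ofReal a)⁻¹ := fun {a} ha => by
    rw [Real.enorm_eq_ofReal (inv_pos.2 ha).le, ENNReal.ofReal_inv_of_pos ha]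
  refine ⟨k, hkd, HasCompactSupport.intro (isCompact_closedBall (0 : EucSp N) δ)
    fun x hx => (hz x hx).1, ?_, hz, fun x => ?_, fun x => ?_⟩
  · rw [hk]
    simp only
    rw [integral_const_mul, Measure.integral_comp_smul, finrank_euclideanSpace_fin, hκ,
      η.integral_normed, inv_pow, inv_inv, abs_of_pos hδN, smul_eq_mul, mul_one,
      inv_mul_cancel₀ hδN.ne']
  · rw [hk]
    simp only
    rw [enorm_mul, he hδN, mul_comm]
    refine mul_le_mul_left ?_ _
    rw [← ofReal_norm, ← ENNReal.ofReal_coe_nnreal]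
    exact ENNReal.ofReal_le_ofReal ((hB1 _).trans ((le_max_left _ _).trans hB'))
  · rw [hfd, enorm_smul, enorm_mul, he hδN, he hδ, mul_comm]
    refine mul_le_mul_left ?_ _
    rw [← ofReal_norm, ← ENNReal.ofReal_coe_nnreal]
    exact ENNReal.ofReal_le_ofReal ((hB2 _).trans ((le_max_right _ _).trans hB'))

/-- Mollifying the constant 1 gives a constant, whose derivative is 0. -/
theorem integral_fderiv_eq_zero {k : EucSp N → ℝ} (hk : ContDiff ℝ ∞ k) (hc : HasCompactSupport k)
    (x v : EucSp N) : ∫ y, fderiv ℝ k (x - y) v = 0 := by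
  have h1 := fderiv_mollify hk hc (F := fun _ => (1 : ℝ)) (locallyIntegrable_const 1) x v
  have h2 : mollify k (fun _ => (1 : ℝ)) = fun _ => ∫ y, k y := by
    ext x
    simp only [mollify, mul_one]
    rw [integral_sub_left_eq_self]
  rw [h2] at h1
  simpa using h1.symm

/-- Functions whose energy decays like that of Sobolev functions are limits in `L^p` of smooth
functions with bounded gradients. -/
theorem exists_smooth_approx_of_energy_le (hp : 1 < p) {F : EucSp N → ℝ} (hFm : Measurable F)
    (hF : LocallyIntegrable F) {δ₀ : ℝ} (hδ₀ : 0 < δ₀) {C : ℝ≥0}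
    (hE : ∀ δ, 0 < δ → δ ≤ δ₀ → energy p δ Set.univ F ≤
      C * (ENNReal.ofReal δ ^ p * ENNReal.ofReal (δ ^ N))) :
    ∃ f : ℕ → EucSp N → ℝ, (∀ n, ContDiff ℝ ∞ (f n)) ∧
      Tendsto (fun n => ∫⁻ x, ‖f n x - F x‖ₑ ^ p) atTop (𝓝 0) ∧
      ∃ C' : ℝ≥0, ∀ n, ∫⁻ x, ‖fderiv ℝ (f n) x‖ₑ ^ p ≤ C' := by
  have hp0 : 0 < p := by linarith
  obtain ⟨B, hB⟩ := exists_kernel N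
  set V := volume (Metric.ball (0 : EucSp N) 1) with hV
  have hVt : V < ⊤ := measure_ball_lt_top
  set T : ℝ≥0∞ := (B : ℝ≥0∞) ^ p * (V ^ (p - 1) * C) with hT
  have hTt : T ≠ ⊤ := ENNReal.mul_ne_top (ENNReal.rpow_ne_top_of_nonneg hp0.le ENNReal.coe_ne_top)
    (ENNReal.mul_ne_top (ENNReal.rpow_ne_top_of_nonneg (by linarith) hVt.ne) ENNReal.coe_ne_top)
  have main : ∀ δ, 0 < δ → δ ≤ δ₀ → ∃ f : EucSp N → ℝ, ContDiff ℝ ∞ f ∧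
      ∫⁻ x, ‖f x - F x‖ₑ ^ p ≤ T * ENNReal.ofReal δ ^ p ∧ ∫⁻ x, ‖fderiv ℝ f x‖ₑ ^ p ≤ T := by
    intro δ hδ hδδ₀
    obtain ⟨k, hkd, hkc, hk1, hkz, hkB, hkB'⟩ := hB δ hδ
    have hk1' : ContDiff ℝ 1 k := hkd.of_le (by simp)
    have hδN : 0 < δ ^ N := pow_pos hδ N
    set d := ENNReal.ofReal δ with hd
    set D := ENNReal.ofReal (δ ^ N) with hD
    have hd0 : d ≠ 0 := by simpa [hd] using hδ
    have hdt : d ≠ ⊤ := ENNReal.ofReal_ne_top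
    have hD0 : D ≠ 0 := by simpa [hD] using hδN
    have hDt : D ≠ ⊤ := ENNReal.ofReal_ne_top
    have hDit : D⁻¹ ≠ ⊤ := ENNReal.inv_ne_top.2 hD0
    have hdit : d⁻¹ ≠ ⊤ := ENNReal.inv_ne_top.2 hd0
    have hvol : volume (Metric.closedBall (0 : EucSp N) δ) = D * V := volume_closedBall_zero δ hδ 0
    -- Jensen on the ball contributes D^(p-1) and the energy d^p D, with d = δ and D = δ^N. The
    -- total d^p D^p is matched by the kernel bound D⁻¹, leaving d^p, and by the gradient bound
    -- D⁻¹d⁻¹, leaving a constant.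
    have hosc : ∫⁻ x, (B * ∫⁻ y in Metric.closedBall x δ, ‖F y - F x‖ₑ) ^ p ≤
        (T * d ^ p) * D ^ p := by
      refine (lintegral_oscillation_le hp hFm B fun x => le_rfl).trans ?_
      refine (mul_le_mul_right (mul_le_mul_right (hE δ hδ hδδ₀) _) _).trans (le_of_eq ?_)
      have e1 : D ^ p = D ^ (p - 1) * D := by
        conv_rhs => rw [← ENNReal.rpow_one D, ← ENNReal.rpow_mul, mul_comm, ENNReal.rpow_mul]
        rw [← ENNReal.rpow_one D, ← ENNReal.rpow_mul, ← ENNReal.rpow_mul,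
          ← ENNReal.rpow_mul, ← ENNReal.rpow_add _ _ hD0 hDt]
        congr 1
        ring
      rw [hvol, ENNReal.mul_rpow_of_nonneg _ _ (by linarith : 0 ≤ p - 1), e1, hT]
      ring
    refine ⟨mollify k F, contDiff_mollify hkd hkc hF, ?_, ?_⟩
    · have hpt : ∀ x, ‖mollify k F x - F x‖ₑ ≤
          (B * ∫⁻ y in Metric.closedBall x δ, ‖F y - F x‖ₑ) * D⁻¹ := by
        intro x
        have e : mollify k F x - F x = ∫ y, k (x - y) * (F y - F x) := by
          have h1 := integrable_mul_comp_sub hkd.continuous hkc hF x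
          have h2 := integrable_mul_comp_sub hkd.continuous hkc
            (locallyIntegrable_const (F x)) x
          simp_rw [mul_sub]
          rw [integral_sub h1 h2, integral_mul_const, integral_sub_left_eq_self, hk1, one_mul]
          rfl
        rw [e]
        exact enorm_integral_kernel_le (fun x hx => (hkz x hx).1) x hkB hDit
      calc ∫⁻ x, ‖mollify k F x - F x‖ₑ ^ p
          ≤ ∫⁻ x, (B * ∫⁻ y in Metric.closedBall x δ, ‖F y - F x‖ₑ) ^ p * (D⁻¹) ^ p := by
            refine lintegral_mono fun x => ?_
            rw [← ENNReal.mul_rpow_of_nonneg _ _ hp0.le]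
            exact ENNReal.rpow_le_rpow (hpt x) hp0.le
        _ = (∫⁻ x, (B * ∫⁻ y in Metric.closedBall x δ, ‖F y - F x‖ₑ) ^ p) * (D⁻¹) ^ p :=
            lintegral_mul_const' _ _ (ENNReal.rpow_ne_top_of_nonneg hp0.le hDit)
        _ ≤ (T * d ^ p) * D ^ p * (D⁻¹) ^ p := mul_le_mul_left hosc _
        _ = T * d ^ p := by
            rw [mul_assoc, ← ENNReal.mul_rpow_of_nonneg _ _ hp0.le, ENNReal.mul_inv_cancel hD0 hDt,
              ENNReal.one_rpow, mul_one]
    · have hpt : ∀ x, ‖fderiv ℝ (mollify k F) x‖ₑ ≤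
          (B * ∫⁻ y in Metric.closedBall x δ, ‖F y - F x‖ₑ) * (D⁻¹ * d⁻¹) := by
        intro x
        refine enorm_clm_le_of_forall fun v => ?_
        have hkv : Continuous fun z => fderiv ℝ k z v :=
          (hk1'.continuous_fderiv one_ne_zero).clm_apply continuous_const
        have hkvc : HasCompactSupport fun z => fderiv ℝ k z v := hkc.fderiv_apply ℝ v
        -- Since the derivative of the kernel has integral zero, F x can be subtracted and the
        -- gradient too is controlled by oscillation.
        have e : fderiv ℝ (mollify k F) x v = ∫ y, fderiv ℝ k (x - y) v * (F y - F x) := by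
          have h1 := integrable_mul_comp_sub hkv hkvc hF x
          have h2 := integrable_mul_comp_sub hkv hkvc (locallyIntegrable_const (F x)) x
          simp_rw [mul_sub]
          rw [integral_sub h1 h2, integral_mul_const, integral_fderiv_eq_zero hkd hkc, zero_mul,
            sub_zero, fderiv_mollify hkd hkc hF]
        rw [e, mul_assoc _ _ ‖v‖ₑ]
        refine enorm_integral_kernel_le (k := fun z => fderiv ℝ k z v) (fun x hx => ?_) x
          (fun x => ?_) (ENNReal.mul_ne_top (ENNReal.mul_ne_top hDit hdit) enorm_ne_top)
        · simp only [(hkz x hx).2, zero_apply]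
        · refine (ContinuousLinearMap.le_opENorm _ _).trans ?_
          rw [← mul_assoc]
          exact mul_le_mul_left (hkB' x) _
      calc ∫⁻ x, ‖fderiv ℝ (mollify k F) x‖ₑ ^ p
          ≤ ∫⁻ x, (B * ∫⁻ y in Metric.closedBall x δ, ‖F y - F x‖ₑ) ^ p * (D⁻¹ * d⁻¹) ^ p := by
            refine lintegral_mono fun x => ?_
            rw [← ENNReal.mul_rpow_of_nonneg _ _ hp0.le]
            exact ENNReal.rpow_le_rpow (hpt x) hp0.le
        _ = (∫⁻ x, (B * ∫⁻ y in Metric.closedBall x δ, ‖F y - F x‖ₑ) ^ p) * (D⁻¹ * d⁻¹) ^ p :=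
            lintegral_mul_const' _ _ (ENNReal.rpow_ne_top_of_nonneg hp0.le
              (ENNReal.mul_ne_top hDit hdit))
        _ ≤ (T * d ^ p) * D ^ p * (D⁻¹ * d⁻¹) ^ p := mul_le_mul_left hosc _
        _ = T := by
            rw [mul_assoc, mul_assoc, ← ENNReal.mul_rpow_of_nonneg _ _ hp0.le,
              ← ENNReal.mul_rpow_of_nonneg _ _ hp0.le]
            have : d * (D * (D⁻¹ * d⁻¹)) = 1 := by
              rw [← mul_assoc D, ENNReal.mul_inv_cancel hD0 hDt, one_mul,
                ENNReal.mul_inv_cancel hd0 hdt]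
            rw [this, ENNReal.one_rpow, mul_one]
  have hδn0 : ∀ n : ℕ, 0 < δ₀ * (1 / ((n : ℝ) + 1)) := fun n => by positivity
  have hδn : ∀ n : ℕ, δ₀ * (1 / ((n : ℝ) + 1)) ≤ δ₀ := fun n => by
    refine mul_le_of_le_one_right hδ₀.le ?_
    rw [div_le_one (by positivity)]
    linarith [n.cast_nonneg (α := ℝ)]
  choose f hf1 hf2 hf3 using fun n : ℕ => main _ (hδn0 n) (hδn n)
  refine ⟨f, hf1, ?_, T.toNNReal, fun n => by rw [ENNReal.coe_toNNReal hTt]; exact hf3 n⟩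
  have h1 : Tendsto (fun n : ℕ => δ₀ * (1 / ((n : ℝ) + 1))) atTop (𝓝 0) := by
    simpa using tendsto_one_div_add_atTop_nhds_zero_nat.const_mul δ₀
  have h2 := ENNReal.Tendsto.const_mul (a := T) ((ENNReal.continuous_rpow_const (y := p)).tendsto _
    |>.comp (ENNReal.tendsto_ofReal h1)) (Or.inr hTt)
  rw [ENNReal.ofReal_zero, ENNReal.zero_rpow_of_pos hp0, mul_zero] at h2
  exact tendsto_of_tendsto_of_tendsto_of_le_of_le tendsto_const_nhds h2 (fun _ => zero_le) hf2

end Smoothing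

/-! ### Density of smooth functions in W^{1,p}(Ω) -/

section Density

theorem eLpNorm_ofReal_eq {X F : Type*} [MeasurableSpace X] [NormedAddCommGroup F] {p : ℝ}
    (hp : 0 < p) (f : X → F) (m : Measure X) :
    eLpNorm f (ENNReal.ofReal p) m = (∫⁻ x, ‖f x‖ₑ ^ p ∂m) ^ (1 / p) := by
  rw [eLpNorm_eq_lintegral_rpow_enorm_toReal (by simpa using hp) ENNReal.ofReal_ne_top,
    ENNReal.toReal_ofReal hp.le]

variable {N : ℕ} {Ω : Set (EucSp N)} {p : ℝ} [hp : Fact (1 < p)]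

/-- A smooth partition of unity on the compact closure of Ω, subordinate to finitely many chart
domains. Intersecting these with a large ball makes the supports compact. -/
theorem IsBoundedLipschitzDomain.exists_cutoffs [NeZero N] (hΩ : IsBoundedLipschitzDomain Ω) :
    ∃ (ι : Type) (_ : Fintype ι) (W : ι → Set (EucSp N)) (χ : ι → EucSp N → ℝ),
      (∀ i, Nonempty (LipChart Ω (W i))) ∧ (∀ i, ContDiff ℝ ∞ (χ i)) ∧
      (∀ i, HasCompactSupport (χ i)) ∧ (∀ i, tsupport (χ i) ⊆ W i) ∧
      ∀ x ∈ Ω, ∑ i, χ i x = 1 := by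
  obtain ⟨s, hs, hcov⟩ := hΩ.exists_finite_cover
  obtain ⟨R, hR⟩ := hΩ.isBounded.closure.subset_ball (0 : EucSp N)
  obtain ⟨f, hf⟩ := SmoothPartitionOfUnity.exists_isSubordinate (modelWithCornersSelf ℝ (EucSp N))
    (isClosed_closure (s := Ω)) (fun i : s => (i : Set (EucSp N)) ∩ Metric.ball 0 R)
    (fun i => (hs i i.2).some.isOpen_W.inter Metric.isOpen_ball) (fun x hx => by
      obtain ⟨W, hW, hxW⟩ := Set.mem_iUnion₂.1 (hcov hx)
      exact Set.mem_iUnion.2 ⟨⟨W, hW⟩, hxW, hR hx⟩)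
  have hc : ∀ i, IsCompact (tsupport (f i)) := fun i =>
    Metric.isCompact_of_isClosed_isBounded (isClosed_tsupport _)
      (Metric.isBounded_ball.subset ((hf i).trans Set.inter_subset_right))
  let e := s.equivFin
  refine ⟨Fin s.card, inferInstance, fun i => (e.symm i : Set (EucSp N)), fun i => f (e.symm i),
    fun i => hs _ (e.symm i).2, fun i => (f (e.symm i)).contMDiff.contDiff, fun i => hc _,
    fun i => (hf _).trans Set.inter_subset_left, fun x hx => ?_⟩
  have h1 := f.sum_eq_one (subset_closure hx)
  rw [finsum_eq_sum_of_fintype] at h1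
  rw [← h1]
  exact e.symm.sum_comp (fun i => f i x)

/-- Each χᵢu is extended by folding and mollified on the whole space; on Ω the extensions add up to
u. The energy yields only boundedness of the gradients, not their convergence. -/
theorem SobolevW1p.exists_smooth_bounded [NeZero N] (hΩ : IsBoundedLipschitzDomain Ω)
    (u : SobolevW1p Ω p) :
    ∃ f : ℕ → EucSp N → ℝ, (∀ n, ContDiff ℝ ∞ (f n)) ∧
      Tendsto (fun n => eLpNorm (fun x => f n x - u.fn x) (ENNReal.ofReal p) (domMeasure Ω))
        atTop (𝓝 0) ∧
      ∃ C : ℝ≥0, ∀ n, eLpNorm (gradient (f n)) (ENNReal.ofReal p) (domMeasure Ω) ≤ C := by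
  have hp1 := hp.out
  have hp0 : 0 < p := by linarith
  have hpi : 0 < 1 / p := by positivity
  have h1p : 1 ≤ ENNReal.ofReal p := one_le_ofReal_of_fact
  obtain ⟨ι, _, W, χ, hW, hχ, hχc, hχs, hsum⟩ := hΩ.exists_cutoffs
  have c : ∀ i, LipChart Ω (W i) := fun i => (hW i).some
  have key : ∀ i, ∃ f : ℕ → EucSp N → ℝ, (∀ n, ContDiff ℝ ∞ (f n)) ∧
      Tendsto (fun n => ∫⁻ x, ‖f n x - (c i).extend (χ i) u.fn x‖ₑ ^ p) atTop (𝓝 0) ∧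
      ∃ C' : ℝ≥0, ∀ n, ∫⁻ x, ‖fderiv ℝ (f n) x‖ₑ ^ p ≤ C' := by
    intro i
    have hm := (c i).measurable_extend (hχ i).continuous u
    have hlt : ∫⁻ x, ‖(c i).extend (χ i) u.fn x‖ₑ ^ p < ⊤ := by
      obtain ⟨M, hM⟩ := (hχ i).continuous.bounded_above_of_compact_support (hχc i)
      exact (c i).lintegral_extend_lt_top (hχs i) (M := ⟨max M 0, le_max_right _ _⟩)
        (fun x => (hM x).trans (le_max_left _ _)) u
    have hLp : MemLp ((c i).extend (χ i) u.fn) (ENNReal.ofReal p) volume := by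
      refine ⟨hm.aestronglyMeasurable, ?_⟩
      rw [eLpNorm_ofReal_eq hp0]
      exact ENNReal.rpow_lt_top_of_nonneg hpi.le hlt.ne
    obtain ⟨δ₀, hδ₀, C, hC⟩ := (c i).exists_energy_extend_le hΩ.isOpen (hχ i) (hχc i) (hχs i) u
    exact exists_smooth_approx_of_energy_le hp1 hm (hLp.locallyIntegrable h1p) hδ₀ hC
  choose f hf hf0 C hC using key
  have hf1 : ∀ i n, ContDiff ℝ 1 (f i n) := fun i n => (hf i n).of_le (by simp)
  refine ⟨fun n x => ∑ i, f i n x, fun n => ContDiff.sum fun i _ => hf i n, ?_,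
    ∑ i, (C i) ^ (1 / p), fun n => ?_⟩
  · have hle : ∀ n, eLpNorm (fun x => ∑ i, f i n x - u.fn x) (ENNReal.ofReal p) (domMeasure Ω) ≤
        ∑ i, (∫⁻ x, ‖f i n x - (c i).extend (χ i) u.fn x‖ₑ ^ p) ^ (1 / p) := by
      intro n
      have hae : (fun x => ∑ i, f i n x - u.fn x) =ᵐ[domMeasure Ω]
          ∑ i, fun x => f i n x - (c i).extend (χ i) u.fn x := by
        filter_upwards [ae_restrict_mem hΩ.isOpen.measurableSet] with x hx
        rw [Finset.sum_apply, Finset.sum_sub_distrib]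
        simp_rw [fun i => (c i).extend_of_mem (hχs i) u.fn hx]
        rw [← Finset.sum_mul, hsum x hx, one_mul]
      rw [eLpNorm_congr_ae hae]
      refine (eLpNorm_sum_le (fun i _ => ((hf i n).continuous.measurable.sub
        ((c i).measurable_extend (hχ i).continuous u)).aestronglyMeasurable) h1p).trans
        (Finset.sum_le_sum fun i _ => ?_)
      rw [← eLpNorm_ofReal_eq hp0]
      exact eLpNorm_mono_measure _ Measure.restrict_le_self
    have h0 : Tendsto (fun n => ∑ i, (∫⁻ x, ‖f i n x - (c i).extend (χ i) u.fn x‖ₑ ^ p) ^ (1 / p))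
        atTop (𝓝 0) := by
      rw [← Finset.sum_const_zero (s := (Finset.univ : Finset ι))]
      refine tendsto_finsetSum _ fun i _ => ?_
      have := (ENNReal.continuous_rpow_const (y := 1 / p)).tendsto 0 |>.comp (hf0 i)
      rwa [ENNReal.zero_rpow_of_pos hpi] at this
    exact tendsto_of_tendsto_of_tendsto_of_le_of_le tendsto_const_nhds h0 (fun _ => zero_le) hle
  · have e1 : eLpNorm (gradient fun x => ∑ i, f i n x) (ENNReal.ofReal p) (domMeasure Ω) =
        eLpNorm (∑ i, fun x => fderiv ℝ (f i n) x) (ENNReal.ofReal p) (domMeasure Ω) := by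
      refine eLpNorm_congr_norm_ae (Eventually.of_forall fun x => ?_)
      rw [norm_gradient_eq, Finset.sum_apply,
        fderiv_fun_sum fun i _ => ((hf1 i n).differentiable one_ne_zero).differentiableAt]
    rw [e1]
    refine (eLpNorm_sum_le (fun i _ =>
      ((hf1 i n).continuous_fderiv one_ne_zero).aestronglyMeasurable) h1p).trans ?_
    push_cast
    refine Finset.sum_le_sum fun i _ => ?_
    rw [eLpNorm_ofReal_eq hp0, ENNReal.coe_rpow_of_nonneg _ hpi.le]
    refine ENNReal.rpow_le_rpow ?_ hpi.le
    exact (lintegral_mono' Measure.restrict_le_self le_rfl).trans (hC i n)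

namespace SobolevW1p

/-- The element of `W^{1,p}(Ω)` given by a smooth function on the whole space. -/
noncomputable def ofSmooth (hb : Bornology.IsBounded Ω) {φ : EucSp N → ℝ} (hφ : ContDiff ℝ 1 φ) :
    SobolevW1p Ω p :=
  mk (memLp_domMeasure_of_continuous hb hφ.continuous _)
    (memLp_domMeasure_of_continuous hb (continuous_gradient hφ) _) (hasWeakGradient_of_contDiff hφ)

/-- The subspace of `W^{1,p}(Ω)` of functions that are smooth up to the boundary. -/
noncomputable def smoothSubmodule (Ω : Set (EucSp N)) (p : ℝ) [Fact (1 < p)] :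
    Submodule ℝ (SobolevW1p Ω p) where
  carrier := {w | ∃ φ, ContDiff ℝ ∞ φ ∧ w.fn =ᵐ[domMeasure Ω] φ}
  zero_mem' := ⟨0, contDiff_const, Lp.coeFn_zero ℝ (ENNReal.ofReal p) (domMeasure Ω)⟩
  add_mem' := by
    rintro v w ⟨φ, hφ, h1⟩ ⟨χ, hχ, h2⟩
    exact ⟨φ + χ, hφ.add hχ, (fn_add v w).trans (h1.add h2)⟩
  smul_mem' := by
    rintro c w ⟨φ, hφ, h1⟩
    exact ⟨c • φ, hφ.const_smul c, (fn_smul c w).trans (h1.const_smul c)⟩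

/-- Boundedness in W^{1,p}(Ω) with convergence in L^p is enough: by reflexivity the sequence
clusters weakly, and a closed subspace contains the weak limits of its sequences. -/
theorem mem_closure_smoothSubmodule [NeZero N] (hΩ : IsBoundedLipschitzDomain Ω)
    (u : SobolevW1p Ω p) : u ∈ (smoothSubmodule Ω p).topologicalClosure := by
  have hb := hΩ.isBounded
  obtain ⟨f, hf, hf0, C, hC⟩ := u.exists_smooth_bounded hΩ
  have hf1 : ∀ n, ContDiff ℝ 1 (f n) := fun n => (hf n).of_le (by simp)
  set x : ℕ → SobolevW1p Ω p := fun n => ofSmooth hb (hf1 n) with hx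
  have hxfn : ∀ n, (x n).fn =ᵐ[domMeasure Ω] f n := fun n => fn_mk _ _ _
  have hxgr : ∀ n, (x n).grad =ᵐ[domMeasure Ω] gradient (f n) := fun n => grad_mk _ _ _
  have hlim : Tendsto (fun n => (split Ω p (x n)).1) atTop (𝓝 (split Ω p u).1) := by
    refine (Lp.tendsto_Lp_iff_tendsto_eLpNorm' _ _).2 (hf0.congr fun n => ?_)
    refine eLpNorm_congr_ae ?_
    filter_upwards [hxfn n] with y hy
    change f n y - u.fn y = (x n).fn y - u.fn y
    rw [hy]
  obtain ⟨D, hD⟩ : ∃ D, ∀ n, ‖(split Ω p (x n)).1‖ ≤ D := by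
    obtain ⟨D, hD⟩ := (Metric.isBounded_range_of_tendsto _ hlim).exists_norm_le
    exact ⟨D, fun n => hD _ ⟨n, rfl⟩⟩
  have hgr : ∀ n, ‖(split Ω p (x n)).2‖ ≤ C := fun n => by
    have h1 : ‖(split Ω p (x n)).2‖ = (eLpNorm (x n).grad (ENNReal.ofReal p) (domMeasure Ω)).toReal :=
      Lp.norm_def _
    rw [h1, eLpNorm_congr_ae (hxgr n)]
    exact ENNReal.toReal_le_coe_of_le_coe (hC n)
  obtain ⟨K, hK⟩ := exists_antilipschitz_split Ω p
  have hbd : ∀ n, ‖x n‖ ≤ K * max D C := fun n => by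
    have h1 := hK.le_mul_dist (x n) 0
    rw [dist_zero_right, map_zero, dist_zero_right] at h1
    exact h1.trans (mul_le_mul_of_nonneg_left (max_le_max (hD n) (hgr n)) K.coe_nonneg)
  obtain ⟨y, hy⟩ := (isReflexiveSpace_sobolevW1p (p := p) hb).exists_tendsto_ultrafilter hbd
    (hyperfilter ℕ)
  have hU : ((hyperfilter ℕ : Ultrafilter ℕ) : Filter ℕ) ≤ atTop := Nat.hyperfilter_le_atTop
  -- A functional separating y from the closed subspace would vanish along the sequence but not at
  -- its weak limit.
  have hyM : y ∈ (smoothSubmodule Ω p).topologicalClosure := by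
    by_contra hyM
    obtain ⟨g, hg0, hgy⟩ := exists_dual_separating _
      (smoothSubmodule Ω p).isClosed_topologicalClosure hyM
    have h1 : ∀ n, g (x n) = 0 := fun n =>
      hg0 _ ((smoothSubmodule Ω p).le_topologicalClosure ⟨f n, hf n, hxfn n⟩)
    have h2 := hy g
    simp_rw [h1] at h2
    exact hgy (tendsto_nhds_unique h2 tendsto_const_nhds)
  -- The function components converge in norm to u, so every functional has the same limit at both;
  -- the gradients then agree by uniqueness.
  have hyu : (split Ω p y).1 = (split Ω p u).1 := by
    refine (SeparatingDual.eq_iff_forall_dual_eq (R := ℝ)).2 fun g => ?_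
    have h1 := hy (g.comp ((ContinuousLinearMap.fst ℝ _ _).comp (split Ω p)))
    have h2 := (g.continuous.tendsto _).comp (hlim.mono_left hU)
    exact tendsto_nhds_unique h1 h2
  have : y = u := SobolevW1p.ext hΩ.isOpen (Filter.EventuallyEq.of_eq (congrArg (fun g : Lp ℝ _ _ => (g : EucSp N → ℝ)) hyu))
  rwa [← this]

/-- Functions that are smooth up to the boundary are dense in `W^{1,p}(Ω)`. -/
theorem exists_smooth_tendsto [NeZero N] (hΩ : IsBoundedLipschitzDomain Ω) (u : SobolevW1p Ω p) :
    ∃ φ : ℕ → EucSp N → ℝ, (∀ n, ContDiff ℝ ∞ (φ n)) ∧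
      Tendsto (fun n => eLpNorm (fun x => φ n x - u.fn x) (ENNReal.ofReal p) (domMeasure Ω))
        atTop (𝓝 0) ∧
      Tendsto (fun n => eLpNorm (fun x => gradient (φ n) x - u.grad x) (ENNReal.ofReal p)
        (domMeasure Ω)) atTop (𝓝 0) := by
  have hb := hΩ.isBounded
  obtain ⟨w, hw, hwu⟩ := mem_closure_iff_seq_limit.1 (mem_closure_smoothSubmodule hΩ u)
  choose φ hφ hwφ using hw
  have hφ1 : ∀ n, ContDiff ℝ 1 (φ n) := fun n => (hφ n).of_le (by simp)
  have hs := ((split Ω p).continuous.tendsto u).comp hwu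
  refine ⟨φ, hφ, ?_, ?_⟩
  · have h1 : Tendsto (fun n => (split Ω p (w n)).1) atTop (𝓝 (split Ω p u).1) :=
      (continuous_fst.tendsto _).comp hs
    refine ((Lp.tendsto_Lp_iff_tendsto_eLpNorm' _ _).1 h1).congr fun n => eLpNorm_congr_ae ?_
    filter_upwards [hwφ n] with y hy
    change (w n).fn y - u.fn y = φ n y - u.fn y
    rw [hy]
  · have h1 : Tendsto (fun n => (split Ω p (w n)).2) atTop (𝓝 (split Ω p u).2) :=
      (continuous_snd.tendsto _).comp hs
    refine ((Lp.tendsto_Lp_iff_tendsto_eLpNorm' _ _).1 h1).congr fun n => eLpNorm_congr_ae ?_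
    have h2 : (w n).grad =ᵐ[domMeasure Ω] gradient (φ n) :=
      (grad_unique hΩ.isOpen ((hwφ n).trans (fn_mk _ _ _).symm)).trans
        (grad_mk (p := p) (memLp_domMeasure_of_continuous hb (hφ1 n).continuous _)
          (memLp_domMeasure_of_continuous hb (continuous_gradient (hφ1 n)) _)
          (hasWeakGradient_of_contDiff (hφ1 n)))
    filter_upwards [h2] with y hy
    change (w n).grad y - u.grad y = gradient (φ n) y - u.grad y
    rw [hy]

end SobolevW1p

end Density

/-! ### Limits of smooth functions in L^p(m); existence and uniqueness of traces -/

section Trace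

variable {N : ℕ} {Ω : Set (EucSp N)} {p : ℝ} [hp : Fact (1 < p)]

namespace SobolevW1p

/-- The sequence `φ` of smooth functions converges to `u` in `W^{1,p}(Ω)`. -/
structure ApproximatedBy (u : SobolevW1p Ω p) (φ : ℕ → EucSp N → ℝ) : Prop where
  contDiff : ∀ n, ContDiff ℝ ∞ (φ n)
  tendsto_fn : Tendsto (fun n => eLpNorm (fun x => φ n x - u.fn x) (ENNReal.ofReal p)
    (domMeasure Ω)) atTop (𝓝 0)
  tendsto_grad : Tendsto (fun n => eLpNorm (fun x => gradient (φ n) x - u.grad x)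
    (ENNReal.ofReal p) (domMeasure Ω)) atTop (𝓝 0)

theorem exists_approximatedBy [NeZero N] (hΩ : IsBoundedLipschitzDomain Ω) (u : SobolevW1p Ω p) :
    ∃ φ, u.ApproximatedBy φ := by
  obtain ⟨φ, h1, h2, h3⟩ := u.exists_smooth_tendsto hΩ
  exact ⟨φ, h1, h2, h3⟩

theorem isTrace_iff {u : SobolevW1p Ω p} {g : EucSp N → ℝ} :
    u.IsTrace g ↔ MemLp g (ENNReal.ofReal p) (bdryMeasure Ω) ∧ ∃ φ, u.ApproximatedBy φ ∧
      Tendsto (fun n => eLpNorm (fun x => φ n x - g x) (ENNReal.ofReal p) (bdryMeasure Ω))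
        atTop (𝓝 0) :=
  ⟨fun ⟨h, φ, h1, h2, h3, h4⟩ => ⟨h, φ, ⟨h1, h2, h3⟩, h4⟩,
    fun ⟨h, φ, ⟨h1, h2, h3⟩, h4⟩ => ⟨h, φ, h1, h2, h3, h4⟩⟩

/-- `C¹` functions are bounded in `L^p(m)` by their Sobolev norm. -/
def BoundedIn (Ω : Set (EucSp N)) (p : ℝ) (m : Measure (EucSp N)) (C : ℝ≥0) : Prop :=
  ∀ φ : EucSp N → ℝ, ContDiff ℝ 1 φ → eLpNorm φ (ENNReal.ofReal p) m ≤
    C * (eLpNorm φ (ENNReal.ofReal p) (domMeasure Ω) +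
      eLpNorm (gradient φ) (ENNReal.ofReal p) (domMeasure Ω))

/-- Taking p-th roots is harmless because (a + b)^(1/p) ≤ a^(1/p) + b^(1/p). -/
theorem boundedIn_of_lintegral_le {m : Measure (EucSp N)} {C : ℝ≥0}
    (hC : ∀ u : EucSp N → ℝ, ContDiff ℝ 1 u → ∫⁻ x, ‖u x‖ₑ ^ p ∂m ≤
      C * (∫⁻ x, ‖u x‖ₑ ^ p ∂(domMeasure Ω) + ∫⁻ x, ‖fderiv ℝ u x‖ₑ ^ p ∂(domMeasure Ω))) :
    BoundedIn Ω p m (C ^ (1 / p)) := by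
  intro φ hφ
  have hp1 := hp.out
  have hp0 : 0 < p := by linarith
  have hpi : 0 ≤ 1 / p := by positivity
  have e : eLpNorm (gradient φ) (ENNReal.ofReal p) (domMeasure Ω) =
      eLpNorm (fun x => fderiv ℝ φ x) (ENNReal.ofReal p) (domMeasure Ω) :=
    eLpNorm_congr_norm_ae (Eventually.of_forall fun x => norm_gradient_eq φ x)
  rw [e, eLpNorm_ofReal_eq hp0, eLpNorm_ofReal_eq hp0, eLpNorm_ofReal_eq hp0,
    ENNReal.coe_rpow_of_nonneg _ hpi]
  refine (ENNReal.rpow_le_rpow (hC φ hφ) hpi).trans ?_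
  rw [ENNReal.mul_rpow_of_nonneg _ _ hpi]
  refine mul_le_mul_right (ENNReal.rpow_add_le_add_rpow _ _ hpi ?_) _
  rw [div_le_one hp0]
  exact hp1.le

/-- The Sobolev bound is applied to φ_j - χ_k. The indices are independent so that φ = χ gives the
Cauchy property and the diagonal gives uniqueness of limits. -/
theorem ApproximatedBy.tendsto_sub {u : SobolevW1p Ω p} {φ χ : ℕ → EucSp N → ℝ}
    (hφ : u.ApproximatedBy φ) (hχ : u.ApproximatedBy χ) {m : Measure (EucSp N)} {C : ℝ≥0}
    (hC : BoundedIn Ω p m C) :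
    Tendsto (fun q : ℕ × ℕ => eLpNorm (φ q.1 - χ q.2) (ENNReal.ofReal p) m) atTop (𝓝 0) := by
  have h1p : 1 ≤ ENNReal.ofReal p := one_le_ofReal_of_fact
  have hφ1 : ∀ n, ContDiff ℝ 1 (φ n) := fun n => (hφ.contDiff n).of_le (by simp)
  have hχ1 : ∀ n, ContDiff ℝ 1 (χ n) := fun n => (hχ.contDiff n).of_le (by simp)
  set a : ℕ → ℝ≥0∞ := fun n => eLpNorm (fun x => φ n x - u.fn x) (ENNReal.ofReal p) (domMeasure Ω)
  set a' : ℕ → ℝ≥0∞ := fun n => eLpNorm (fun x => χ n x - u.fn x) (ENNReal.ofReal p) (domMeasure Ω)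
  set b : ℕ → ℝ≥0∞ := fun n => eLpNorm (fun x => gradient (φ n) x - u.grad x) (ENNReal.ofReal p)
    (domMeasure Ω)
  set b' : ℕ → ℝ≥0∞ := fun n => eLpNorm (fun x => gradient (χ n) x - u.grad x) (ENNReal.ofReal p)
    (domMeasure Ω)
  have hle : ∀ q : ℕ × ℕ, eLpNorm (φ q.1 - χ q.2) (ENNReal.ofReal p) m ≤
      C * ((a q.1 + a' q.2) + (b q.1 + b' q.2)) := by
    intro q
    refine (hC (φ q.1 - χ q.2) ((hφ1 q.1).sub (hχ1 q.2))).trans (mul_le_mul_right (add_le_add ?_ ?_) _)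
    · have e : φ q.1 - χ q.2 = (fun x => φ q.1 x - u.fn x) - fun x => χ q.2 x - u.fn x := by
        ext x; simp
      rw [e]
      exact eLpNorm_sub_le
        ((hφ1 q.1).continuous.aestronglyMeasurable.sub u.memLp_fn.1)
        ((hχ1 q.2).continuous.aestronglyMeasurable.sub u.memLp_fn.1) h1p
    · have e : gradient (φ q.1 - χ q.2) =
          (fun x => gradient (φ q.1) x - u.grad x) - fun x => gradient (χ q.2) x - u.grad x := by
        ext1 x
        have : gradient (φ q.1 - χ q.2) x = gradient (φ q.1) x - gradient (χ q.2) x := by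
          simp only [gradient]
          rw [fderiv_sub ((hφ1 q.1).differentiable one_ne_zero x)
            ((hχ1 q.2).differentiable one_ne_zero x), map_sub]
        rw [this]
        simp
      rw [e]
      exact eLpNorm_sub_le
        ((continuous_gradient (hφ1 q.1)).aestronglyMeasurable.sub u.memLp_grad.1)
        ((continuous_gradient (hχ1 q.2)).aestronglyMeasurable.sub u.memLp_grad.1) h1p
  have hf : Tendsto (Prod.fst : ℕ × ℕ → ℕ) atTop atTop := by
    rw [← prod_atTop_atTop_eq]; exact tendsto_fst
  have hs : Tendsto (Prod.snd : ℕ × ℕ → ℕ) atTop atTop := by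
    rw [← prod_atTop_atTop_eq]; exact tendsto_snd
  have h0 := ENNReal.Tendsto.const_mul (a := (C : ℝ≥0∞))
    (((hφ.tendsto_fn.comp hf).add (hχ.tendsto_fn.comp hs)).add
      ((hφ.tendsto_grad.comp hf).add (hχ.tendsto_grad.comp hs))) (Or.inr ENNReal.coe_ne_top)
  simp only [add_zero, mul_zero] at h0
  exact tendsto_of_tendsto_of_tendsto_of_le_of_le tendsto_const_nhds h0 (fun _ => zero_le) hle

theorem ApproximatedBy.exists_tendsto {u : SobolevW1p Ω p} (hb : Bornology.IsBounded Ω)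
    {φ : ℕ → EucSp N → ℝ} (hφ : u.ApproximatedBy φ) {m : Measure (EucSp N)} {C : ℝ≥0}
    (hC : BoundedIn Ω p m C) :
    ∃ g, MemLp g (ENNReal.ofReal p) m ∧
      Tendsto (fun n => eLpNorm (fun x => φ n x - g x) (ENNReal.ofReal p) m) atTop (𝓝 0) := by
  have hφ1 : ∀ n, ContDiff ℝ 1 (φ n) := fun n => (hφ.contDiff n).of_le (by simp)
  have hm : ∀ n, MemLp (φ n) (ENNReal.ofReal p) m := fun n => by
    refine ⟨(hφ1 n).continuous.aestronglyMeasurable, (hC _ (hφ1 n)).trans_lt ?_⟩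
    exact ENNReal.mul_lt_top ENNReal.coe_lt_top (ENNReal.add_lt_top.2
      ⟨(memLp_domMeasure_of_continuous hb (hφ1 n).continuous _).2,
        (memLp_domMeasure_of_continuous hb (continuous_gradient (hφ1 n)) _).2⟩)
  have hcau : CauchySeq fun n => (hm n).toLp (φ n) := by
    refine (Lp.cauchySeq_Lp_iff_cauchySeq_eLpNorm _).2 ((hφ.tendsto_sub hφ hC).congr fun q => ?_)
    refine eLpNorm_congr_ae ?_
    filter_upwards [(hm q.1).coeFn_toLp, (hm q.2).coeFn_toLp] with x h1 h2
    rw [Pi.sub_apply, Pi.sub_apply, h1, h2]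
  obtain ⟨g, hg⟩ := cauchySeq_tendsto_of_complete hcau
  refine ⟨g, Lp.memLp g, ((Lp.tendsto_Lp_iff_tendsto_eLpNorm' _ _).1 hg).congr fun n => ?_⟩
  refine eLpNorm_congr_ae ?_
  filter_upwards [(hm n).coeFn_toLp] with x h1
  rw [Pi.sub_apply, h1]

/-- The limit of the approximating functions is bounded by the Sobolev norm. -/
theorem ApproximatedBy.eLpNorm_le {u : SobolevW1p Ω p} {φ : ℕ → EucSp N → ℝ}
    (hφ : u.ApproximatedBy φ) {m m' : Measure (EucSp N)} (hm : m' ≪ m) {C : ℝ≥0}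
    (hC : BoundedIn Ω p m' C) {g : EucSp N → ℝ} (hg : AEStronglyMeasurable g m)
    (hφg : Tendsto (fun n => eLpNorm (fun x => φ n x - g x) (ENNReal.ofReal p) m) atTop (𝓝 0)) :
    eLpNorm g (ENNReal.ofReal p) m' ≤ C * (eLpNorm u.fn (ENNReal.ofReal p) (domMeasure Ω) +
      eLpNorm u.grad (ENNReal.ofReal p) (domMeasure Ω)) := by
  have h1p : 1 ≤ ENNReal.ofReal p := one_le_ofReal_of_fact
  have hφ1 : ∀ n, ContDiff ℝ 1 (φ n) := fun n => (hφ.contDiff n).of_le (by simp)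
  have hφm : ∀ (n) (ν : Measure (EucSp N)), AEStronglyMeasurable (φ n) ν := fun n ν =>
    (hφ1 n).continuous.aestronglyMeasurable
  -- A subsequence converges m-almost everywhere, hence m'-almost everywhere, and Fatou applies for
  -- m'. Convergence in L^p(m') is never needed.
  obtain ⟨ns, hns, hae⟩ := (tendstoInMeasure_of_tendsto_eLpNorm (one_pos.trans_le h1p).ne'
    (fun n => hφm n m) hg hφg).exists_seq_tendsto_ae
  refine (Lp.eLpNorm_lim_le_liminf_eLpNorm (fun n => hφm (ns n) m') g (hm.ae_le hae)).trans ?_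
  have hle : ∀ n, eLpNorm (φ (ns n)) (ENNReal.ofReal p) m' ≤
      C * ((eLpNorm (fun x => φ (ns n) x - u.fn x) (ENNReal.ofReal p) (domMeasure Ω) +
        eLpNorm u.fn (ENNReal.ofReal p) (domMeasure Ω)) +
        (eLpNorm (fun x => gradient (φ (ns n)) x - u.grad x) (ENNReal.ofReal p) (domMeasure Ω) +
        eLpNorm u.grad (ENNReal.ofReal p) (domMeasure Ω))) := by
    intro n
    refine (hC _ (hφ1 (ns n))).trans (mul_le_mul_right (add_le_add ?_ ?_) _)
    · have e : φ (ns n) = (fun x => φ (ns n) x - u.fn x) + u.fn := by ext x; simp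
      conv_lhs => rw [e]
      exact eLpNorm_add_le ((hφm _ _).sub u.memLp_fn.1) u.memLp_fn.1 h1p
    · have e : gradient (φ (ns n)) = (fun x => gradient (φ (ns n)) x - u.grad x) + u.grad := by
        ext1 x; simp
      conv_lhs => rw [e]
      exact eLpNorm_add_le ((continuous_gradient (hφ1 _)).aestronglyMeasurable.sub u.memLp_grad.1)
        u.memLp_grad.1 h1p
  have hlim := ENNReal.Tendsto.const_mul (a := (C : ℝ≥0∞))
    (((hφ.tendsto_fn.comp hns.tendsto_atTop).add_const
      (eLpNorm u.fn (ENNReal.ofReal p) (domMeasure Ω))).add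
      ((hφ.tendsto_grad.comp hns.tendsto_atTop).add_const
      (eLpNorm u.grad (ENNReal.ofReal p) (domMeasure Ω)))) (Or.inr ENNReal.coe_ne_top)
  simp only [zero_add] at hlim
  exact (liminf_le_liminf (Eventually.of_forall hle)).trans (le_of_eq hlim.liminf_eq)

theorem isTrace_unique {u : SobolevW1p Ω p} {C : ℝ≥0} (hC : BoundedIn Ω p (bdryMeasure Ω) C)
    {g g' : EucSp N → ℝ} (h : u.IsTrace g) (h' : u.IsTrace g') : g =ᵐ[bdryMeasure Ω] g' := by
  have h1p : 1 ≤ ENNReal.ofReal p := one_le_ofReal_of_fact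
  obtain ⟨hg, φ, hφ, hφg⟩ := isTrace_iff.1 h
  obtain ⟨hg', χ, hχ, hχg⟩ := isTrace_iff.1 h'
  have hm : ∀ {φ : ℕ → EucSp N → ℝ}, u.ApproximatedBy φ → ∀ n,
      AEStronglyMeasurable (φ n) (bdryMeasure Ω) := fun hφ n =>
    (hφ.contDiff n).continuous.aestronglyMeasurable
  have hd : Tendsto (fun n : ℕ => (n, n)) atTop atTop :=
    tendsto_atTop_diagonal
  have h0 := ((hφ.tendsto_sub hχ hC).comp hd).add (hφg.add hχg)
  simp only [add_zero] at h0
  have hle : ∀ n, eLpNorm (g - g') (ENNReal.ofReal p) (bdryMeasure Ω) ≤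
      eLpNorm (φ n - χ n) (ENNReal.ofReal p) (bdryMeasure Ω) +
      (eLpNorm (fun x => φ n x - g x) (ENNReal.ofReal p) (bdryMeasure Ω) +
      eLpNorm (fun x => χ n x - g' x) (ENNReal.ofReal p) (bdryMeasure Ω)) := by
    intro n
    have e : g - g' = (φ n - χ n) - ((fun x => φ n x - g x) - fun x => χ n x - g' x) := by
      ext x; simp only [Pi.sub_apply]; ring
    rw [e]
    refine (eLpNorm_sub_le ((hm hφ n).sub (hm hχ n))
      (((hm hφ n).sub hg.1).sub ((hm hχ n).sub hg'.1)) h1p).trans ?_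
    gcongr
    exact eLpNorm_sub_le ((hm hφ n).sub hg.1) ((hm hχ n).sub hg'.1) h1p
  have h2 : eLpNorm (g - g') (ENNReal.ofReal p) (bdryMeasure Ω) = 0 :=
    le_antisymm (ge_of_tendsto' h0 hle) zero_le
  have h3 := (eLpNorm_eq_zero_iff (hg.1.sub hg'.1) (one_pos.trans_le h1p).ne').1 h2
  filter_upwards [h3] with x hx
  exact sub_eq_zero.1 hx

theorem ApproximatedBy.add {u v : SobolevW1p Ω p} {φ χ : ℕ → EucSp N → ℝ}
    (hφ : u.ApproximatedBy φ) (hχ : v.ApproximatedBy χ) :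
    (u + v).ApproximatedBy fun n => φ n + χ n := by
  have h1p : 1 ≤ ENNReal.ofReal p := one_le_ofReal_of_fact
  have hφ1 : ∀ n, ContDiff ℝ 1 (φ n) := fun n => (hφ.contDiff n).of_le (by simp)
  have hχ1 : ∀ n, ContDiff ℝ 1 (χ n) := fun n => (hχ.contDiff n).of_le (by simp)
  refine ⟨fun n => (hφ.contDiff n).add (hχ.contDiff n), ?_, ?_⟩
  · have h0 := hφ.tendsto_fn.add hχ.tendsto_fn
    rw [add_zero] at h0
    refine tendsto_of_tendsto_of_tendsto_of_le_of_le tendsto_const_nhds h0 (fun _ => zero_le)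
      fun n => ?_
    have e : (fun x => (φ n + χ n) x - (u + v).fn x) =ᵐ[domMeasure Ω]
        (fun x => φ n x - u.fn x) + fun x => χ n x - v.fn x := by
      filter_upwards [fn_add u v] with x hx
      rw [hx]
      simp only [Pi.add_apply]
      ring
    dsimp only
    rw [eLpNorm_congr_ae e]
    exact eLpNorm_add_le ((hφ1 n).continuous.aestronglyMeasurable.sub u.memLp_fn.1)
      ((hχ1 n).continuous.aestronglyMeasurable.sub v.memLp_fn.1) h1p
  · have h0 := hφ.tendsto_grad.add hχ.tendsto_grad
    rw [add_zero] at h0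
    refine tendsto_of_tendsto_of_tendsto_of_le_of_le tendsto_const_nhds h0 (fun _ => zero_le)
      fun n => ?_
    have e : (fun x => gradient (φ n + χ n) x - (u + v).grad x) =ᵐ[domMeasure Ω]
        (fun x => gradient (φ n) x - u.grad x) + fun x => gradient (χ n) x - v.grad x := by
      filter_upwards [grad_add u v] with x hx
      have : gradient (φ n + χ n) x = gradient (φ n) x + gradient (χ n) x := by
        simp only [gradient]
        rw [fderiv_add ((hφ1 n).differentiable one_ne_zero x)
          ((hχ1 n).differentiable one_ne_zero x), map_add]
      rw [hx, this]
      simp only [Pi.add_apply]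
      abel
    dsimp only
    rw [eLpNorm_congr_ae e]
    exact eLpNorm_add_le ((continuous_gradient (hφ1 n)).aestronglyMeasurable.sub u.memLp_grad.1)
      ((continuous_gradient (hχ1 n)).aestronglyMeasurable.sub v.memLp_grad.1) h1p

theorem ApproximatedBy.const_smul {u : SobolevW1p Ω p} {φ : ℕ → EucSp N → ℝ}
    (hφ : u.ApproximatedBy φ) (c : ℝ) : (c • u).ApproximatedBy fun n => c • φ n := by
  have hφ1 : ∀ n, ContDiff ℝ 1 (φ n) := fun n => (hφ.contDiff n).of_le (by simp)
  refine ⟨fun n => (hφ.contDiff n).const_smul c, ?_, ?_⟩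
  · have h0 := ENNReal.Tendsto.const_mul (a := ‖c‖ₑ) hφ.tendsto_fn (Or.inr enorm_ne_top)
    rw [mul_zero] at h0
    refine h0.congr fun n => ?_
    rw [← eLpNorm_const_smul]
    refine eLpNorm_congr_ae ?_
    filter_upwards [fn_smul c u] with x hx
    rw [hx]
    simp only [Pi.smul_apply, smul_sub]
  · have h0 := ENNReal.Tendsto.const_mul (a := ‖c‖ₑ) hφ.tendsto_grad (Or.inr enorm_ne_top)
    rw [mul_zero] at h0
    refine h0.congr fun n => ?_
    rw [← eLpNorm_const_smul]
    refine eLpNorm_congr_ae ?_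
    filter_upwards [grad_smul c u] with x hx
    have : gradient (c • φ n) x = c • gradient (φ n) x := by
      simp only [gradient]
      rw [fderiv_const_smul ((hφ1 n).differentiable one_ne_zero x)]
      exact (InnerProductSpace.toDual ℝ (EucSp N)).symm.map_smul c _
    rw [hx, this]
    simp only [Pi.smul_apply, smul_sub]

theorem IsTrace.add {u v : SobolevW1p Ω p} {g h : EucSp N → ℝ} (hg : u.IsTrace g)
    (hh : v.IsTrace h) : (u + v).IsTrace (g + h) := by
  have h1p : 1 ≤ ENNReal.ofReal p := one_le_ofReal_of_fact
  obtain ⟨hgm, φ, hφ, hφg⟩ := isTrace_iff.1 hg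
  obtain ⟨hhm, χ, hχ, hχh⟩ := isTrace_iff.1 hh
  refine isTrace_iff.2 ⟨hgm.add hhm, _, hφ.add hχ, ?_⟩
  have h0 := hφg.add hχh
  rw [add_zero] at h0
  refine tendsto_of_tendsto_of_tendsto_of_le_of_le tendsto_const_nhds h0 (fun _ => zero_le)
    fun n => ?_
  have e : (fun x => (φ n + χ n) x - (g + h) x) =
      (fun x => φ n x - g x) + fun x => χ n x - h x := by
    ext x; simp only [Pi.add_apply]; ring
  dsimp only
  rw [e]
  exact eLpNorm_add_le ((hφ.contDiff n).continuous.aestronglyMeasurable.sub hgm.1)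
      ((hχ.contDiff n).continuous.aestronglyMeasurable.sub hhm.1) h1p

theorem IsTrace.const_smul {u : SobolevW1p Ω p} {g : EucSp N → ℝ} (hg : u.IsTrace g) (c : ℝ) :
    (c • u).IsTrace (c • g) := by
  obtain ⟨hgm, φ, hφ, hφg⟩ := isTrace_iff.1 hg
  refine isTrace_iff.2 ⟨hgm.const_smul c, _, hφ.const_smul c, ?_⟩
  have h0 := ENNReal.Tendsto.const_mul (a := ‖c‖ₑ) hφg (Or.inr enorm_ne_top)
  rw [mul_zero] at h0
  refine h0.congr fun n => ?_
  rw [← eLpNorm_const_smul]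
  congr 1
  ext x
  simp only [Pi.smul_apply, smul_sub]

theorem exists_boundedIn_bdryMeasure [NeZero N] (hΩ : IsBoundedLipschitzDomain Ω) :
    ∃ C, BoundedIn Ω p (bdryMeasure Ω) C := by
  obtain ⟨C, hC⟩ := exists_lintegral_bdryMeasure_le hΩ hp.out
  exact ⟨_, boundedIn_of_lintegral_le hC⟩

/-- Smooth approximants of u are Cauchy in L^p(∂Ω) by the trace inequality, so a trace exists and
the chosen representative is not the default 0. -/
theorem isTrace_trace [NeZero N] (hΩ : IsBoundedLipschitzDomain Ω) (u : SobolevW1p Ω p) :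
    u.IsTrace u.trace := by
  have h : ∃ g, u.IsTrace g := by
    obtain ⟨C, hC⟩ := exists_boundedIn_bdryMeasure (p := p) hΩ
    obtain ⟨φ, hφ⟩ := u.exists_approximatedBy hΩ
    obtain ⟨g, hg, hφg⟩ := hφ.exists_tendsto hΩ.isBounded hC
    exact ⟨g, isTrace_iff.2 ⟨hg, φ, hφ, hφg⟩⟩
  rw [trace, dif_pos h]
  exact h.choose_spec

theorem IsTrace.ae_eq_trace [NeZero N] (hΩ : IsBoundedLipschitzDomain Ω) {u : SobolevW1p Ω p}
    {g : EucSp N → ℝ} (h : u.IsTrace g) : g =ᵐ[bdryMeasure Ω] u.trace := by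
  obtain ⟨C, hC⟩ := exists_boundedIn_bdryMeasure (p := p) hΩ
  exact isTrace_unique hC h (u.isTrace_trace hΩ)

theorem trace_add [NeZero N] (hΩ : IsBoundedLipschitzDomain Ω) (u v : SobolevW1p Ω p) :
    (u + v).trace =ᵐ[bdryMeasure Ω] u.trace + v.trace :=
  (((u.isTrace_trace hΩ).add (v.isTrace_trace hΩ)).ae_eq_trace hΩ).symm

theorem trace_smul [NeZero N] (hΩ : IsBoundedLipschitzDomain Ω) (c : ℝ) (u : SobolevW1p Ω p) :
    (c • u).trace =ᵐ[bdryMeasure Ω] c • u.trace :=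
  (((u.isTrace_trace hΩ).const_smul c).ae_eq_trace hΩ).symm

theorem exists_eLpNorm_add_le (Ω : Set (EucSp N)) (p : ℝ) [Fact (1 < p)] :
    ∃ C : ℝ≥0, ∀ u : SobolevW1p Ω p, eLpNorm u.fn (ENNReal.ofReal p) (domMeasure Ω) +
      eLpNorm u.grad (ENNReal.ofReal p) (domMeasure Ω) ≤ C * ‖u‖ₑ := by
  refine ⟨‖split Ω p‖₊ + ‖split Ω p‖₊, fun u => ?_⟩
  have h := (split Ω p).le_opENorm u
  have h1 : ‖(split Ω p u).1‖ₑ ≤ ‖split Ω p u‖ₑ := by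
    simp only [← ofReal_norm]
    exact ENNReal.ofReal_le_ofReal (norm_fst_le _)
  have h2 : ‖(split Ω p u).2‖ₑ ≤ ‖split Ω p u‖ₑ := by
    simp only [← ofReal_norm]
    exact ENNReal.ofReal_le_ofReal (norm_snd_le _)
  rw [ENNReal.coe_add, add_mul]
  refine add_le_add ?_ ?_
  · exact (Lp.enorm_def (split Ω p u).1).symm.le.trans (h1.trans h)
  · exact (Lp.enorm_def (split Ω p u).2).symm.le.trans (h2.trans h)

end SobolevW1p

end Trace

/-! ### Superposition operators from L^p to L^q -/

section Nemytskii

variable {X E G : Type*} [MeasurableSpace X] {m : Measure X} [NormedAddCommGroup E]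
  [NormedAddCommGroup G]

/-- Superposition of a Carathéodory function with a measurable function is measurable. -/
theorem aestronglyMeasurable_superposition {F : X → E → G}
    (hF : ∀ z, AEStronglyMeasurable (fun x => F x z) m) (hc : ∀ᵐ x ∂m, Continuous (F x))
    {g : X → E} (hg : AEStronglyMeasurable g m) :
    AEStronglyMeasurable (fun x => F x (g x)) m := by
  have hsimple : ∀ s : SimpleFunc X E, AEStronglyMeasurable (fun x => F x (s x)) m := by
    intro s
    have e : (fun x => F x (s x)) = ∑ y ∈ s.range, (s ⁻¹' {y}).indicator fun x => F x y := by
      ext x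
      rw [Finset.sum_apply, Finset.sum_eq_single (s x)]
      · rw [Set.indicator_of_mem (show x ∈ s ⁻¹' {s x} from rfl)]
      · intro y _ hy
        rw [Set.indicator_of_notMem]
        exact fun h => hy (Set.mem_singleton_iff.1 h).symm
      · intro h
        exact absurd (s.mem_range_self x) h
    rw [e]
    exact Finset.aestronglyMeasurable_sum _ fun y _ => (hF y).indicator (s.measurableSet_fiber y)
  obtain ⟨g', hg', hgg'⟩ := hg
  have h1 : AEStronglyMeasurable (fun x => F x (g' x)) m := by
    refine aestronglyMeasurable_of_tendsto_ae atTop (fun n => hsimple (hg'.approx n)) ?_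
    filter_upwards [hc] with x hx
    exact (hx.tendsto _).comp (hg'.tendsto_approx x)
  refine h1.congr ?_
  filter_upwards [hgg'] with x hx
  rw [hx]

/-- D ≤ R + min(D, H): the first part tends to 0 in the mean, the second is dominated by H. This
replaces dominated convergence when the majorant varies with n. -/
theorem tendsto_lintegral_zero_of_le_add {D R : ℕ → X → ℝ≥0∞} {H : X → ℝ≥0∞}
    (hD : ∀ n, AEMeasurable (D n) m) (hR : ∀ n, AEMeasurable (R n) m) (hH : AEMeasurable H m)
    (hle : ∀ n, ∀ᵐ x ∂m, D n x ≤ R n x + H x)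
    (hR0 : Tendsto (fun n => ∫⁻ x, R n x ∂m) atTop (𝓝 0)) (hHt : ∫⁻ x, H x ∂m ≠ ⊤)
    (hae : ∀ᵐ x ∂m, Tendsto (fun n => D n x) atTop (𝓝 0)) :
    Tendsto (fun n => ∫⁻ x, D n x ∂m) atTop (𝓝 0) := by
  have h1 : Tendsto (fun n => ∫⁻ x, min (D n x) (H x) ∂m) atTop (𝓝 (∫⁻ _, 0 ∂m)) := by
    refine tendsto_lintegral_of_dominated_convergence' H (fun n => (hD n).min hH)
      (fun n => Eventually.of_forall fun x => min_le_right _ _) hHt ?_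
    filter_upwards [hae] with x hx
    exact tendsto_of_tendsto_of_tendsto_of_le_of_le tendsto_const_nhds hx (fun _ => zero_le)
      fun n => min_le_left _ _
  have h2 := hR0.add h1
  rw [lintegral_zero, add_zero] at h2
  refine tendsto_of_tendsto_of_tendsto_of_le_of_le tendsto_const_nhds h2 (fun _ => zero_le)
    fun n => ?_
  dsimp only
  rw [← lintegral_add_left' (hR n)]
  refine lintegral_mono_ae ?_
  filter_upwards [hle n] with x hx
  rcases le_total (D n x) (H x) with h | h
  · rw [min_eq_left h]; exact le_add_self
  · rw [min_eq_right h]; exact hx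

variable {p q : ℝ}

/-- Uses (p - 1)q = p: growth of order p - 1 is exactly what maps L^p to L^q. -/
theorem superposition_rpow_le (hpq : p.HolderConjugate q) {K a b t : ℝ≥0∞}
    (h : a ≤ K * t ^ (p - 1) + b) : a ^ q ≤ 2 ^ (q - 1) * (K ^ q * t ^ p + b ^ q) := by
  have hq := hpq.symm.lt
  have hq0 : 0 ≤ q := by linarith
  refine (ENNReal.rpow_le_rpow h hq0).trans ((add_rpow_le_two_rpow_mul _ _ hq).trans ?_)
  rw [ENNReal.mul_rpow_of_nonneg _ _ hq0, ← ENNReal.rpow_mul, hpq.sub_one_mul_conj]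

theorem lintegral_rpow_lt_top_of_memLp (hp : 0 < p) {g : X → E} (hg : MemLp g (ENNReal.ofReal p) m) :
    ∫⁻ x, ‖g x‖ₑ ^ p ∂m < ⊤ := by
  have := lintegral_rpow_enorm_lt_top_of_eLpNorm_lt_top (by simpa using hp) ENNReal.ofReal_ne_top
    hg.2
  rwa [ENNReal.toReal_ofReal hp.le] at this

theorem two_rpow_ne_top (hp : 1 < p) : (2 : ℝ≥0∞) ^ (p - 1) ≠ ⊤ :=
  ENNReal.rpow_ne_top_of_nonneg (by linarith) (by simp)

theorem lintegral_superposition_le (hpq : p.HolderConjugate q) {F : X → E → G} {K : ℝ≥0} {c : X → ℝ}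
    (hFb : ∀ᵐ x ∂m, ∀ z, ‖F x z‖ₑ ≤ K * ‖z‖ₑ ^ (p - 1) + ‖c x‖ₑ)
    (hc : MemLp c (ENNReal.ofReal q) m) (g : X → E) :
    ∫⁻ x, ‖F x (g x)‖ₑ ^ q ∂m ≤
      2 ^ (q - 1) * (K ^ q * ∫⁻ x, ‖g x‖ₑ ^ p ∂m + ∫⁻ x, ‖c x‖ₑ ^ q ∂m) := by
  have hq := hpq.symm.lt
  have hKt : (K : ℝ≥0∞) ^ q ≠ ⊤ :=
    ENNReal.rpow_ne_top_of_nonneg (by linarith) ENNReal.coe_ne_top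
  rw [← lintegral_const_mul' _ _ hKt, ← lintegral_add_right' _ (hc.1.enorm.pow_const q),
    ← lintegral_const_mul' _ _ (two_rpow_ne_top hq)]
  refine lintegral_mono_ae ?_
  filter_upwards [hFb] with x hx
  exact superposition_rpow_le hpq (hx _)

theorem memLp_superposition (hpq : p.HolderConjugate q) {F : X → E → G}
    (hF : ∀ z, AEStronglyMeasurable (fun x => F x z) m) (hFc : ∀ᵐ x ∂m, Continuous (F x))
    {K : ℝ≥0} {c : X → ℝ} (hFb : ∀ᵐ x ∂m, ∀ z, ‖F x z‖ₑ ≤ K * ‖z‖ₑ ^ (p - 1) + ‖c x‖ₑ)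
    (hc : MemLp c (ENNReal.ofReal q) m) {g : X → E} (hg : MemLp g (ENNReal.ofReal p) m) :
    MemLp (fun x => F x (g x)) (ENNReal.ofReal q) m := by
  have hq := hpq.symm.lt
  have hq0 : 0 < q := by linarith
  refine ⟨aestronglyMeasurable_superposition hF hFc hg.1, ?_⟩
  rw [eLpNorm_ofReal_eq hq0]
  refine ENNReal.rpow_lt_top_of_nonneg (by positivity) ?_
  refine ((lintegral_superposition_le hpq hFb hc g).trans_lt ?_).ne
  exact ENNReal.mul_lt_top (two_rpow_ne_top hq).lt_top (ENNReal.add_lt_top.2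
    ⟨ENNReal.mul_lt_top (ENNReal.rpow_lt_top_of_nonneg hq0.le ENNReal.coe_ne_top)
      (lintegral_rpow_lt_top_of_memLp hpq.pos hg), lintegral_rpow_lt_top_of_memLp hq0 hc⟩)

/-- The superposition operator of a Carathéodory function from `L^p` to `L^q`. -/
noncomputable def superposition (hpq : p.HolderConjugate q) {F : X → E → G}
    (hF : ∀ z, AEStronglyMeasurable (fun x => F x z) m) (hFc : ∀ᵐ x ∂m, Continuous (F x))
    {K : ℝ≥0} {c : X → ℝ} (hFb : ∀ᵐ x ∂m, ∀ z, ‖F x z‖ₑ ≤ K * ‖z‖ₑ ^ (p - 1) + ‖c x‖ₑ)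
    (hc : MemLp c (ENNReal.ofReal q) m) (g : Lp E (ENNReal.ofReal p) m) :
    Lp G (ENNReal.ofReal q) m :=
  (memLp_superposition hpq hF hFc hFb hc (Lp.memLp g)).toLp _

section

variable (hpq : p.HolderConjugate q) {F : X → E → G}
    (hF : ∀ z, AEStronglyMeasurable (fun x => F x z) m) (hFc : ∀ᵐ x ∂m, Continuous (F x))
    {K : ℝ≥0} {c : X → ℝ} (hFb : ∀ᵐ x ∂m, ∀ z, ‖F x z‖ₑ ≤ K * ‖z‖ₑ ^ (p - 1) + ‖c x‖ₑ)
    (hc : MemLp c (ENNReal.ofReal q) m)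

theorem coeFn_superposition (g : Lp E (ENNReal.ofReal p) m) :
    superposition hpq hF hFc hFb hc g =ᵐ[m] fun x => F x (g x) :=
  MemLp.coeFn_toLp _

theorem exists_norm_superposition_le (R : ℝ) :
    ∃ M : ℝ, ∀ g : Lp E (ENNReal.ofReal p) m, ‖g‖ ≤ R → ‖superposition hpq hF hFc hFb hc g‖ ≤ M := by
  have hq := hpq.symm.lt
  have hq0 : 0 < q := by linarith
  have hp0 := hpq.pos
  set B : ℝ≥0∞ := 2 ^ (q - 1) * (K ^ q * ENNReal.ofReal R ^ p + ∫⁻ x, ‖c x‖ₑ ^ q ∂m) with hB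
  have hBt : B ≠ ⊤ := ENNReal.mul_ne_top (two_rpow_ne_top hq) (ENNReal.add_ne_top.2
    ⟨ENNReal.mul_ne_top (ENNReal.rpow_ne_top_of_nonneg hq0.le ENNReal.coe_ne_top)
      (ENNReal.rpow_ne_top_of_nonneg hp0.le ENNReal.ofReal_ne_top),
      (lintegral_rpow_lt_top_of_memLp hq0 hc).ne⟩)
  refine ⟨(B ^ (1 / q)).toReal, fun g hg => ?_⟩
  rw [Lp.norm_def, eLpNorm_congr_ae (coeFn_superposition hpq hF hFc hFb hc g),
    eLpNorm_ofReal_eq hq0]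
  refine ENNReal.toReal_mono (ENNReal.rpow_ne_top_of_nonneg (by positivity) hBt)
    (ENNReal.rpow_le_rpow ?_ (by positivity))
  refine (lintegral_superposition_le hpq hFb hc g).trans
    (mul_le_mul_right (add_le_add (mul_le_mul_right ?_ _) le_rfl) _)
  have h1 : eLpNorm g (ENNReal.ofReal p) m ≤ ENNReal.ofReal R := by
    rw [← ENNReal.ofReal_toReal (Lp.eLpNorm_ne_top g), ← Lp.norm_def]
    exact ENNReal.ofReal_le_ofReal hg
  rw [eLpNorm_ofReal_eq hp0] at h1
  have h2 := ENNReal.rpow_le_rpow h1 hp0.le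
  rwa [← ENNReal.rpow_mul, one_div_mul_cancel hp0.ne', ENNReal.rpow_one] at h2

theorem continuous_superposition [Fact (1 ≤ ENNReal.ofReal p)] [Fact (1 ≤ ENNReal.ofReal q)] :
    Continuous (superposition hpq hF hFc hFb hc) := by
  have hq := hpq.symm.lt
  have hp := hpq.lt
  have hq0 : 0 < q := by linarith
  have hp0 := hpq.pos
  rw [continuous_iff_seqContinuous]
  intro g₀ g hg₀
  -- Every subsequence has a further one converging almost everywhere, where continuity of F x in z
  -- can be used.
  refine tendsto_of_subseq_tendsto fun ns hns => ?_
  have h1 : Tendsto (fun n => eLpNorm (⇑(g₀ (ns n)) - ⇑g) (ENNReal.ofReal p) m) atTop (𝓝 0) :=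
    (Lp.tendsto_Lp_iff_tendsto_eLpNorm' _ _).1 (hg₀.comp hns)
  obtain ⟨ms, hms, hae⟩ := (tendstoInMeasure_of_tendsto_eLpNorm (by simpa using hp0)
    (fun n => Lp.aestronglyMeasurable (g₀ (ns n))) (Lp.aestronglyMeasurable g)
    h1).exists_seq_tendsto_ae
  refine ⟨ms, (Lp.tendsto_Lp_iff_tendsto_eLpNorm' _ _).2 ?_⟩
  set u : ℕ → Lp E (ENNReal.ofReal p) m := fun n => g₀ (ns (ms n)) with hu
  have hu0 : Tendsto (fun n => ∫⁻ x, ‖u n x - g x‖ₑ ^ p ∂m) atTop (𝓝 0) := by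
    have h2 := (ENNReal.continuous_rpow_const (y := p)).tendsto 0 |>.comp
      (h1.comp hms.tendsto_atTop)
    rw [ENNReal.zero_rpow_of_pos hp0] at h2
    refine h2.congr fun n => ?_
    simp only [Function.comp_apply]
    rw [eLpNorm_ofReal_eq hp0, ← ENNReal.rpow_mul, one_div_mul_cancel hp0.ne', ENNReal.rpow_one]
    rfl
  have hm : ∀ g : Lp E (ENNReal.ofReal p) m, AEStronglyMeasurable (fun x => F x (g x)) m := fun g =>
    (memLp_superposition hpq hF hFc hFb hc (Lp.memLp g)).1
  set D : ℕ → X → ℝ≥0∞ := fun n x => ‖F x (u n x) - F x (g x)‖ₑ ^ q with hD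
  suffices hD0 : Tendsto (fun n => ∫⁻ x, D n x ∂m) atTop (𝓝 0) by
    have h2 := (ENNReal.continuous_rpow_const (y := 1 / q)).tendsto 0 |>.comp hD0
    rw [ENNReal.zero_rpow_of_pos (by positivity)] at h2
    refine h2.congr fun n => ?_
    simp only [Function.comp_apply]
    rw [hD, ← eLpNorm_ofReal_eq hq0]
    refine eLpNorm_congr_ae ?_
    filter_upwards [coeFn_superposition hpq hF hFc hFb hc (u n),
      coeFn_superposition hpq hF hFc hFb hc g] with x hx1 hx2
    rw [Pi.sub_apply, hx1, hx2]
  set c₁ : ℝ≥0∞ := 2 ^ (q - 1) with hc₁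
  set c₂ : ℝ≥0∞ := 2 ^ (p - 1) with hc₂
  have hc₁t : c₁ ≠ ⊤ := two_rpow_ne_top hq
  have hc₂t : c₂ ≠ ⊤ := two_rpow_ne_top hp
  set k : ℝ≥0∞ := (K : ℝ≥0∞) ^ q with hk
  have hkt : k ≠ ⊤ := ENNReal.rpow_ne_top_of_nonneg hq0.le ENNReal.coe_ne_top
  have hgm : AEMeasurable (fun x => ‖g x‖ₑ ^ p) m :=
    (Lp.aestronglyMeasurable g).enorm.pow_const p
  have hcm : AEMeasurable (fun x => ‖c x‖ₑ ^ q) m := hc.1.enorm.pow_const q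
  have hFm : AEMeasurable (fun x => ‖F x (g x)‖ₑ ^ q) m := (hm g).enorm.pow_const q
  have hAt : c₁ * (c₁ * (k * c₂)) ≠ ⊤ :=
    ENNReal.mul_ne_top hc₁t (ENNReal.mul_ne_top hc₁t (ENNReal.mul_ne_top hkt hc₂t))
  -- The growth bound at u n is split by |u n|^p ≤ c₂(|u n - g|^p + |g|^p): the first part vanishes
  -- in the mean, all else is a fixed integrable majorant.
  refine tendsto_lintegral_zero_of_le_add (R := fun n x => c₁ * (c₁ * (k * c₂)) * ‖u n x - g x‖ₑ ^ p)
    (H := fun x => c₁ * (c₁ * (k * c₂)) * ‖g x‖ₑ ^ p + (c₁ * c₁ * ‖c x‖ₑ ^ q +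
      c₁ * ‖F x (g x)‖ₑ ^ q))
    (fun n => ((hm (u n)).sub (hm g)).enorm.pow_const q)
    (fun n => (((Lp.aestronglyMeasurable (u n)).sub (Lp.aestronglyMeasurable g)).enorm.pow_const
      p).const_mul _) ((hgm.const_mul _).add ((hcm.const_mul _).add (hFm.const_mul _))) ?_ ?_ ?_ ?_
  · intro n
    filter_upwards [hFb] with x hx
    calc D n x ≤ (‖F x (u n x)‖ₑ + ‖F x (g x)‖ₑ) ^ q :=
          ENNReal.rpow_le_rpow enorm_sub_le hq0.le
      _ ≤ c₁ * (‖F x (u n x)‖ₑ ^ q + ‖F x (g x)‖ₑ ^ q) := add_rpow_le_two_rpow_mul _ _ hq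
      _ ≤ c₁ * (c₁ * (k * (c₂ * (‖u n x - g x‖ₑ ^ p + ‖g x‖ₑ ^ p)) + ‖c x‖ₑ ^ q) +
            ‖F x (g x)‖ₑ ^ q) := by
          refine mul_le_mul_right (add_le_add ((superposition_rpow_le hpq (hx _)).trans
            (mul_le_mul_right (add_le_add (mul_le_mul_right ?_ _) le_rfl) _)) le_rfl) _
          refine (ENNReal.rpow_le_rpow ?_ hp0.le).trans (add_rpow_le_two_rpow_mul _ _ hp)
          have := enorm_add_le (u n x - g x) (g x)
          rwa [sub_add_cancel] at this
      _ = _ := by ring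
  · have h2 := ENNReal.Tendsto.const_mul (a := c₁ * (c₁ * (k * c₂))) hu0 (Or.inr hAt)
    rw [mul_zero] at h2
    refine h2.congr fun n => ?_
    rw [lintegral_const_mul' _ _ hAt]
  · rw [lintegral_add_left' (hgm.const_mul _), lintegral_add_left' (hcm.const_mul _),
      lintegral_const_mul' _ _ hAt, lintegral_const_mul' _ _ (ENNReal.mul_ne_top hc₁t hc₁t),
      lintegral_const_mul' _ _ hc₁t]
    refine ENNReal.add_ne_top.2 ⟨ENNReal.mul_ne_top hAt
      (lintegral_rpow_lt_top_of_memLp hp0 (Lp.memLp g)).ne, ENNReal.add_ne_top.2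
      ⟨ENNReal.mul_ne_top (ENNReal.mul_ne_top hc₁t hc₁t) (lintegral_rpow_lt_top_of_memLp hq0 hc).ne,
        ENNReal.mul_ne_top hc₁t (lintegral_rpow_lt_top_of_memLp hq0
          (memLp_superposition hpq hF hFc hFb hc (Lp.memLp g))).ne⟩⟩
  · filter_upwards [hae, hFc] with x hx hFx
    have h2 : Tendsto (fun n => F x (u n x) - F x (g x)) atTop (𝓝 0) := by
      have := ((hFx.tendsto _).comp hx).sub_const (F x (g x))
      rwa [sub_self] at this
    have h3 := (ENNReal.continuous_rpow_const (y := q)).tendsto _ |>.comp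
      ((continuous_enorm.tendsto _).comp h2)
    rwa [enorm_zero, ENNReal.zero_rpow_of_pos hq0] at h3

end

end Nemytskii

/-! ### Monotone operators induced by Carathéodory functions -/

section Operator

variable {X E V : Type*} [MeasurableSpace X] [NormedAddCommGroup E] [InnerProductSpace ℝ E]
  [NormedAddCommGroup V] [NormedSpace ℝ V] {p q : ℝ}

/-- A bounded, continuous and monotone operator from a normed space to its dual. -/
structure IsBoundedMonotone (A : V → StrongDual ℝ V) : Prop where
  bounded : ∀ s : Set V, Bornology.IsBounded s → Bornology.IsBounded (A '' s)
  continuous : Continuous A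
  monotone : ∀ u v, 0 ≤ (A u - A v) (u - v)

theorem IsBoundedMonotone.add {A B : V → StrongDual ℝ V} (hA : IsBoundedMonotone A)
    (hB : IsBoundedMonotone B) : IsBoundedMonotone fun u => A u + B u := by
  refine ⟨fun s hs => ?_, hA.continuous.add hB.continuous, fun u v => ?_⟩
  · refine ((hA.bounded s hs).add (hB.bounded s hs)).subset ?_
    rintro _ ⟨u, hu, rfl⟩
    exact Set.add_mem_add ⟨u, hu, rfl⟩ ⟨u, hu, rfl⟩
  · have e : A u + B u - (A v + B v) = (A u - A v) + (B u - B v) := by abel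
    rw [e]
    exact add_nonneg (hA.monotone u v) (hB.monotone u v)

theorem IsBoundedMonotone.comp_clm {W : Type*} [NormedAddCommGroup W] [NormedSpace ℝ W]
    {A : V → StrongDual ℝ V} (hA : IsBoundedMonotone A) (L : W →L[ℝ] V) :
    IsBoundedMonotone fun u => (A (L u)).comp L := by
  refine ⟨fun s hs => ?_, (hA.continuous.comp L.continuous).clm_comp continuous_const,
    fun u v => ?_⟩
  · obtain ⟨R, hR⟩ := hs.exists_norm_le
    obtain ⟨M, hM⟩ := (hA.bounded (L '' s) (L.lipschitz.isBounded_image hs)).exists_norm_le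
    refine isBounded_iff_forall_norm_le.2 ⟨M * ‖L‖, ?_⟩
    rintro _ ⟨u, hu, rfl⟩
    exact (ContinuousLinearMap.opNorm_comp_le _ _).trans (mul_le_mul_of_nonneg_right
      (hM _ ⟨_, ⟨u, hu, rfl⟩, rfl⟩) (norm_nonneg _))
  · have h := hA.monotone (L u) (L v)
    rw [← map_sub] at h
    exact h

theorem isBounded_image_clm_comp {A B V : Type*} [NormedAddCommGroup A] [NormedSpace ℝ A]
    [NormedAddCommGroup B] [NormedSpace ℝ B] [NormedAddCommGroup V] [NormedSpace ℝ V]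
    (L : A →L[ℝ] StrongDual ℝ B) (T : V →L[ℝ] B) {S : V → A} {s : Set V} {M : ℝ}
    (h : ∀ u ∈ s, ‖S u‖ ≤ M) : Bornology.IsBounded ((fun u => (L (S u)).comp T) '' s) := by
  refine isBounded_iff_forall_norm_le.2 ⟨‖L‖ * M * ‖T‖, ?_⟩
  rintro _ ⟨u, hu, rfl⟩
  exact (ContinuousLinearMap.opNorm_comp_le _ _).trans (mul_le_mul_of_nonneg_right
    ((L.le_opNorm _).trans (mul_le_mul_of_nonneg_left (h u hu) (norm_nonneg _))) (norm_nonneg _))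

/-- The operator on `V` induced by a monotone Carathéodory function. -/
theorem exists_operator_of_clm (hpq : p.HolderConjugate q) {m : Measure X} {F : X → E → E}
    (hF : ∀ z, AEStronglyMeasurable (fun x => F x z) m) (hFc : ∀ᵐ x ∂m, Continuous (F x))
    {K : ℝ≥0} {c : X → ℝ} (hFb : ∀ᵐ x ∂m, ∀ z, ‖F x z‖ₑ ≤ K * ‖z‖ₑ ^ (p - 1) + ‖c x‖ₑ)
    (hc : MemLp c (ENNReal.ofReal q) m)
    (hmono : ∀ᵐ x ∂m, ∀ z₁ z₂, 0 ≤ inner ℝ (z₁ - z₂) (F x z₁ - F x z₂))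
    [Fact (1 ≤ ENNReal.ofReal p)] (T : V →L[ℝ] Lp E (ENNReal.ofReal p) m) :
    (∀ u v, Integrable (fun x => inner ℝ (T v x) (F x (T u x))) m) ∧
    ∃ B : V → StrongDual ℝ V,
      (∀ u v, B u v = ∫ x, inner ℝ (T v x) (F x (T u x)) ∂m) ∧
      IsBoundedMonotone B := by
  have hq := hpq.symm.lt
  have : Fact (1 ≤ ENNReal.ofReal q) := ⟨by simpa using hq.le⟩
  have hpq' : ENNReal.HolderConjugate (ENNReal.ofReal q) (ENNReal.ofReal p) :=
    hpq.symm.ennrealOfReal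
  set S := superposition hpq hF hFc hFb hc with hS
  set L : Lp E (ENNReal.ofReal q) m →L[ℝ] StrongDual ℝ (Lp E (ENNReal.ofReal p) m) :=
    (innerSL ℝ (E := E)).lpPairing m (ENNReal.ofReal q) (ENNReal.ofReal p) with hL
  have hint : ∀ u v, Integrable (fun x => inner ℝ (T v x) (F x (T u x))) m := by
    intro u v
    have h1 : MemLp (fun x => F x (T u x)) (ENNReal.ofReal q) m :=
      memLp_superposition hpq hF hFc hFb hc (Lp.memLp (T u))
    refine (MemLp.integrable_mul h1.norm (Lp.memLp (T v)).norm).mono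
      ((Lp.aestronglyMeasurable (T v)).inner h1.1) (Eventually.of_forall fun x => ?_)
    rw [Pi.mul_apply, norm_mul, norm_norm, norm_norm, mul_comm]
    exact norm_inner_le_norm _ _
  have hB : ∀ u v, (L (S (T u))).comp T v = ∫ x, inner ℝ (T v x) (F x (T u x)) ∂m := by
    intro u v
    rw [ContinuousLinearMap.comp_apply, hL, ContinuousLinearMap.lpPairing_eq_integral]
    refine integral_congr_ae ?_
    filter_upwards [coeFn_superposition hpq hF hFc hFb hc (T u)] with x hx
    rw [hS, hx, innerSL_apply_apply, real_inner_comm]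
  refine ⟨hint, fun u => (L (S (T u))).comp T, hB, fun s hs => ?_, ?_, fun u v => ?_⟩
  · obtain ⟨R, hR⟩ := hs.exists_norm_le
    obtain ⟨M, hM⟩ := exists_norm_superposition_le hpq hF hFc hFb hc (‖T‖ * R)
    exact isBounded_image_clm_comp L T fun u hu => hM _ ((T.le_opNorm u).trans
      (mul_le_mul_of_nonneg_left (hR u hu) (norm_nonneg _)))
  · have h1 : Continuous S := continuous_superposition hpq hF hFc hFb hc
    exact (L.continuous.comp (h1.comp T.continuous)).clm_comp continuous_const
  · rw [_root_.sub_apply, hB, hB, ← integral_sub (hint _ _) (hint _ _)]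
    refine integral_nonneg_of_ae ?_
    have h1 : T (u - v) =ᵐ[m] T u - T v := by rw [map_sub]; exact Lp.coeFn_sub _ _
    filter_upwards [h1, hmono] with x hx hm
    rw [hx, Pi.zero_apply, ← inner_sub_right]
    exact hm _ _

/-- The operator on `V` induced by a monotone coefficient with weighted growth. -/
theorem exists_operator (hpq : p.HolderConjugate q) {μ : Measure X} {w : X → ℝ≥0}
    (hw : AEMeasurable w μ) {f : X → E → E} (hf : ∀ z, AEStronglyMeasurable (fun x => f x z) μ)
    (hfc : ∀ᵐ x ∂μ, Continuous (f x)) {K : ℝ≥0} {c : X → ℝ}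
    (hfb : ∀ᵐ x ∂μ, ∀ z, ‖f x z‖ ≤ w x * (K * ‖z‖ ^ (p - 1) + c x))
    (hc : MemLp c (ENNReal.ofReal q) (μ.withDensity fun x => w x))
    (hmono : ∀ᵐ x ∂μ, ∀ z₁ z₂, 0 ≤ inner ℝ (z₁ - z₂) (f x z₁ - f x z₂))
    {τ : V → X → E} (hτm : ∀ u, AEStronglyMeasurable (τ u) (μ.withDensity fun x => w x))
    (hadd : ∀ u v, τ (u + v) =ᵐ[μ.withDensity fun x => w x] τ u + τ v)
    (hsmul : ∀ (a : ℝ) u, τ (a • u) =ᵐ[μ.withDensity fun x => w x] a • τ u) {C : ℝ≥0}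
    (hτ : ∀ u, eLpNorm (τ u) (ENNReal.ofReal p) (μ.withDensity fun x => w x) ≤ C * ‖u‖ₑ) :
    (∀ u v, Integrable (fun x => inner ℝ (τ v x) (f x (τ u x))) μ) ∧
    ∃ B : V → StrongDual ℝ V,
      (∀ u v, B u v = ∫ x, inner ℝ (τ v x) (f x (τ u x)) ∂μ) ∧
      IsBoundedMonotone B := by
  have hp := hpq.lt
  set m := μ.withDensity fun x => (w x : ℝ≥0∞) with hm
  have hmμ : m ≪ μ := withDensity_absolutelyContinuous _ _
  have : Fact (1 ≤ ENNReal.ofReal p) := ⟨by simpa using hp.le⟩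
  have hmem : ∀ u, MemLp (τ u) (ENNReal.ofReal p) m := fun u =>
    ⟨hτm u, (hτ u).trans_lt (ENNReal.mul_lt_top ENNReal.coe_lt_top enorm_lt_top)⟩
  let T₀ : V →ₗ[ℝ] Lp E (ENNReal.ofReal p) m :=
    { toFun := fun u => (hmem u).toLp (τ u)
      map_add' := fun u v => by
        rw [← MemLp.toLp_add]
        exact MemLp.toLp_congr _ _ (hadd u v)
      map_smul' := fun a u => by
        rw [RingHom.id_apply, ← MemLp.toLp_const_smul]
        exact MemLp.toLp_congr _ _ (hsmul a u) }
  let T : V →L[ℝ] Lp E (ENNReal.ofReal p) m := T₀.mkContinuous C fun u => by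
    change ‖(hmem u).toLp (τ u)‖ ≤ C * ‖u‖
    rw [Lp.norm_toLp]
    have := ENNReal.toReal_mono (ENNReal.mul_ne_top ENNReal.coe_ne_top enorm_ne_top) (hτ u)
    rwa [ENNReal.toReal_mul, toReal_enorm, ENNReal.coe_toReal] at this
  have hT : ∀ u, T u =ᵐ[m] τ u := fun u => (hmem u).coeFn_toLp
  have hw0 : ∀ᵐ x ∂m, w x ≠ 0 := by
    rw [hm, ae_withDensity_iff' hw.coe_nnreal_ennreal]
    exact Eventually.of_forall fun x hx => by simpa using hx
  have hwm : AEStronglyMeasurable (fun x => ((w x : ℝ))⁻¹) m :=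
    (hw.coe_nnreal_real.inv.mono_ac hmμ).aestronglyMeasurable
  -- Dividing by the weight gives a function of ordinary growth relative to m, for which w ≠ 0
  -- almost everywhere; positivity of 1/w preserves monotonicity.
  obtain ⟨hint, B, hB, hBm⟩ := exists_operator_of_clm hpq (m := m)
    (F := fun x z => (w x : ℝ)⁻¹ • f x z) (fun z => hwm.smul ((hf z).mono_ac hmμ))
    (by filter_upwards [hmμ.ae_le hfc] with x hx using hx.const_smul _) (K := K) (c := c)
    (by
      filter_upwards [hmμ.ae_le hfb, hw0] with x hx hwx z
      have hwp : (0 : ℝ) < w x := by positivity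
      have h1 : ‖(w x : ℝ)⁻¹ • f x z‖ ≤ K * ‖z‖ ^ (p - 1) + ‖c x‖ := by
        rw [norm_smul, norm_inv, Real.norm_eq_abs, abs_of_pos hwp, inv_mul_le_iff₀ hwp]
        exact (hx z).trans (mul_le_mul_of_nonneg_left
          (add_le_add le_rfl (Real.le_norm_self _)) hwp.le)
      rw [← ofReal_norm]
      refine (ENNReal.ofReal_le_ofReal h1).trans (ENNReal.ofReal_add_le.trans ?_)
      rw [ofReal_norm, ENNReal.ofReal_mul K.coe_nonneg, ENNReal.ofReal_coe_nnreal,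
        ← ENNReal.ofReal_rpow_of_nonneg (norm_nonneg _) (by linarith), ofReal_norm])
    hc (by
      filter_upwards [hmμ.ae_le hmono] with x hx z₁ z₂
      rw [← smul_sub, real_inner_smul_right]
      exact mul_nonneg (by positivity) (hx _ _)) T
  have hkey : ∀ u v, (fun x => w x • (inner ℝ (T v x) ((w x : ℝ)⁻¹ • f x (T u x)) : ℝ)) =ᵐ[μ]
      fun x => inner ℝ (τ v x) (f x (τ u x)) := by
    intro u v
    have h1 := (ae_withDensity_iff' hw.coe_nnreal_ennreal).1 (hT u)
    have h2 := (ae_withDensity_iff' hw.coe_nnreal_ennreal).1 (hT v)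
    filter_upwards [h1, h2, hfb] with x hx1 hx2 hx3
    -- Where the weight vanishes, the growth bound forces f x = 0, so passing to w dμ loses nothing
    -- of the μ-integral.
    by_cases hwx : w x = 0
    · have h4 := hx3 (τ u x)
      rw [hwx, NNReal.coe_zero, zero_mul] at h4
      rw [hwx, zero_smul, norm_le_zero_iff.1 h4, inner_zero_right]
    · have hwx' : (w x : ℝ≥0∞) ≠ 0 := by simpa using hwx
      rw [hx1 hwx', hx2 hwx', real_inner_smul_right, NNReal.smul_def, smul_eq_mul, ← mul_assoc,
        mul_inv_cancel₀ (by simpa using hwx), one_mul]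
  refine ⟨fun u v => ?_, B, fun u v => ?_, hBm⟩
  · exact ((integrable_withDensity_iff_integrable_smul₀ hw).1 (hint u v)).congr (hkey u v)
  · rw [hB]
    exact (integral_withDensity_eq_integral_smul₀ hw _).trans (integral_congr_ae (hkey u v))

end Operator

/-! ### The structure conditions and the three terms of the operator -/

section StructureConditions

variable {N : ℕ} {Ω : Set (EucSp N)} {p : ℝ} [hp : Fact (1 < p)] {ψ₁ ψ₂ ψ₄ : EucSp N → ℝ}

/-- For p ≤ N the exponent gives N(1 - 1/s) = N - p + ε. For p > N the choice s = 1 gives 0 > N - p.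
-/
theorem StructureFunctions.exists_memLp_domain [NeZero N] (h : StructureFunctions Ω p ψ₁ ψ₂ ψ₄) :
    ∃ s : ℝ, 1 ≤ s ∧ (N : ℝ) - p < N * (1 - 1 / s) ∧
      MemLp ψ₁ (ENNReal.ofReal s) (domMeasure Ω) := by
  have hp1 := hp.out
  have hN : (1 : ℝ) ≤ N := by exact_mod_cast NeZero.one_le
  obtain ⟨-, -, -, h1, h2, h3⟩ := h
  rcases lt_trichotomy p N with hpN | hpN | hpN
  · obtain ⟨ε, hε, -, hε2, hψ, -⟩ := h1 hpN
    have hd : 0 < p - ε := by linarith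
    refine ⟨N / (p - ε), ?_, ?_, hψ⟩
    · rw [le_div_iff₀ hd]; linarith
    · rw [one_div_div, mul_sub, mul_div_cancel₀ _ (by linarith)]; linarith
  · obtain ⟨ε, hε, hε2, hψ, -⟩ := h2 hpN
    have hd : 0 < (N : ℝ) - ε := by linarith
    refine ⟨N / (N - ε), ?_, ?_, hψ⟩
    · rw [le_div_iff₀ hd]; linarith
    · rw [one_div_div, mul_sub, mul_div_cancel₀ _ (by linarith)]; linarith
  · refine ⟨1, le_rfl, ?_, by rw [ENNReal.ofReal_one]; exact (h3 hpN).1⟩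
    simp only [div_one, sub_self, mul_zero]
    linarith

/-- For p ≤ N again (N-1)(1 - 1/s) = N - p + ε: the lower dimension of ∂Ω is offset by p - 1 - ε in
the exponent. For p > N, s = 1 suffices. -/
theorem StructureFunctions.exists_memLp_boundary (h : StructureFunctions Ω p ψ₁ ψ₂ ψ₄) :
    ∃ s : ℝ, 1 ≤ s ∧ (N : ℝ) - p < ((N : ℝ) - 1) * (1 - 1 / s) ∧
      MemLp ψ₄ (ENNReal.ofReal s) (bdryMeasure Ω) := by
  have hp1 := hp.out
  obtain ⟨-, -, -, h1, h2, h3⟩ := h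
  rcases lt_trichotomy p N with hpN | hpN | hpN
  · obtain ⟨ε, hε, -, hε2, -, -, hψ⟩ := h1 hpN
    have hd : 0 < p - 1 - ε := by linarith
    refine ⟨(N - 1) / (p - 1 - ε), ?_, ?_, hψ⟩
    · rw [le_div_iff₀ hd]; linarith
    · rw [one_div_div, mul_sub, mul_div_cancel₀ _ (by linarith)]; linarith
  · obtain ⟨ε, hε, hε2, -, -, hψ⟩ := h2 hpN
    have hN : (2 : ℝ) ≤ N := by
      have : 1 < N := by
        have : (1 : ℝ) < N := hpN ▸ hp1
        exact_mod_cast this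
      exact_mod_cast this
    have hd : 0 < (N : ℝ) - 1 - ε := by linarith
    refine ⟨(N - 1) / (N - 1 - ε), ?_, ?_, hψ⟩
    · rw [le_div_iff₀ hd]; linarith
    · rw [one_div_div, mul_sub, mul_div_cancel₀ _ (by linarith)]; linarith
  · refine ⟨1, le_rfl, ?_, by rw [ENNReal.ofReal_one]; exact (h3 hpN).2.2⟩
    simp only [div_one, sub_self, mul_zero]
    linarith

/-- Ω has finite measure, and for p ≤ N the exponent assumed for ψ₂ is at least p/(p - 1). -/
theorem StructureFunctions.memLp_two (hb : Bornology.IsBounded Ω)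
    (h : StructureFunctions Ω p ψ₁ ψ₂ ψ₄) :
    MemLp ψ₂ (ENNReal.ofReal p.conjExponent) (domMeasure Ω) := by
  have hp1 := hp.out
  have := isFiniteMeasure_domMeasure hb
  obtain ⟨-, -, -, h1, h2, h3⟩ := h
  rw [Real.conjExponent]
  rcases lt_trichotomy p N with hpN | hpN | hpN
  · obtain ⟨ε, hε, -, hε2, -, hψ, -⟩ := h1 hpN
    refine hψ.mono_exponent (ENNReal.ofReal_le_ofReal ?_)
    exact div_le_div_of_nonneg_right hpN.le (by linarith)
  · obtain ⟨ε, hε, hε2, -, hψ, -⟩ := h2 hpN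
    refine hψ.mono_exponent (ENNReal.ofReal_le_ofReal ?_)
    have hN : (2 : ℝ) ≤ N := by
      have : 1 < N := by
        have : (1 : ℝ) < N := hpN ▸ hp1
        exact_mod_cast this
      exact_mod_cast this
    rw [hpN]
    exact div_le_div_of_nonneg_left (by linarith) (by linarith) (by linarith)
  · exact (h3 hpN).2.1

theorem exists_boundedIn_withDensity [NeZero N] (hΩ : IsBoundedLipschitzDomain Ω)
    {σ : Measure (EucSp N)} [IsFiniteMeasure σ] (hσΩ : σ (closure Ω)ᶜ = 0) {d : ℝ}
    (hσ : ∀ W, ∀ c : LipChart Ω W, ∃ C : ℝ≥0, ∀ z, ∀ r : ℝ, 0 < r →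
      σ ((W ∩ closure Ω) ∩ {x | dist (c.P x) z ≤ r}) ≤ C * ENNReal.ofReal (r ^ d))
    {s : ℝ} (hs : 1 ≤ s) (hds : (N : ℝ) - p < d * (1 - 1 / s)) {ψ : EucSp N → ℝ}
    (hψ : MemLp ψ (ENNReal.ofReal s) σ) :
    IsFiniteMeasure (σ.withDensity fun x => ‖ψ x‖₊) ∧
      ∃ C, SobolevW1p.BoundedIn Ω p (σ.withDensity fun x => ‖ψ x‖₊) C := by
  refine ⟨isFiniteMeasure_withDensity ((hψ.integrable (by simpa using hs)).2.ne), ?_⟩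
  obtain ⟨C, hC⟩ := exists_lintegral_withDensity_le hΩ hp.out hσΩ hσ hs hds hψ
  exact ⟨_, SobolevW1p.boundedIn_of_lintegral_le hC⟩

theorem real_inner_eq_mul (s t : ℝ) : inner ℝ s t = s * t := by simp [mul_comm]

variable {a : EucSp N → EucSp N → EucSp N} {b h : EucSp N → ℝ → ℝ}

/-- The case of weight 1: the gradient maps into plain L^p(Ω) and ψ₂ in L^{p'} is the additive term,
so no embedding theorem is involved. -/
theorem exists_operator_gradient (hΩ : IsOpen Ω) (hb : Bornology.IsBounded Ω)
    (hS : StructureFunctions Ω p ψ₁ ψ₂ ψ₄)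
    (hmeas : ∀ z, AEStronglyMeasurable (fun x => a x z) (domMeasure Ω))
    (hcont : ∀ x ∈ Ω, Continuous (a x)) {μ : ℝ} (hμ : 0 ≤ μ)
    (hbd : ∀ x ∈ Ω, ∀ z, ‖a x z‖ ≤ μ * ‖z‖ ^ (p - 1) + ψ₂ x)
    (hmono : ∀ x ∈ Ω, ∀ z₁ z₂, 0 ≤ inner ℝ (z₁ - z₂) (a x z₁ - a x z₂)) :
    (∀ u v : SobolevW1p Ω p,
      Integrable (fun x => inner ℝ (v.grad x) (a x (u.grad x))) (domMeasure Ω)) ∧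
    ∃ B : SobolevW1p Ω p → StrongDual ℝ (SobolevW1p Ω p),
      (∀ u v, B u v = ∫ x, inner ℝ (v.grad x) (a x (u.grad x)) ∂(domMeasure Ω)) ∧
      IsBoundedMonotone B := by
  have hm : (domMeasure Ω).withDensity (fun _ => ((1 : ℝ≥0) : ℝ≥0∞)) = domMeasure Ω := by
    simp only [ENNReal.coe_one]
    exact withDensity_one
  have hae : ∀ᵐ x ∂(domMeasure Ω), x ∈ Ω := ae_restrict_mem hΩ.measurableSet
  obtain ⟨C, hC⟩ := SobolevW1p.exists_eLpNorm_add_le Ω p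
  refine exists_operator (w := fun _ => 1) (K := ⟨μ, hμ⟩) (c := ψ₂) (τ := fun u : SobolevW1p Ω p => u.grad) (C := C)
    (Real.HolderConjugate.conjExponent hp.out) aemeasurable_const hmeas
    (hae.mono hcont) (hae.mono fun x hx z => ?_) ?_ (hae.mono hmono) ?_ ?_ ?_ ?_
  · rw [NNReal.coe_one, one_mul]
    exact hbd x hx z
  · rw [hm]
    exact hS.memLp_two hb
  · intro u
    rw [hm]
    exact u.memLp_grad.1
  · intro u v
    rw [hm]
    exact SobolevW1p.grad_add u v
  · intro t u
    rw [hm]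
    exact SobolevW1p.grad_smul t u
  · intro u
    rw [hm]
    exact le_add_self.trans (hC u)

/-- The case of weight ψ₁ with K = 1 and c = 1, since the bound is ψ₁(|t|^(p-1) + 1). The inclusion
into L^p(ψ₁ dx) is the weighted Sobolev inequality, carried from C¹ functions to u by approximation.
-/
theorem exists_operator_domain [NeZero N] (hΩ : IsBoundedLipschitzDomain Ω)
    (hS : StructureFunctions Ω p ψ₁ ψ₂ ψ₄)
    (hmeas : ∀ t, AEStronglyMeasurable (fun x => b x t) (domMeasure Ω))
    (hcont : ∀ x ∈ Ω, Continuous (b x))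
    (hbd : ∀ x ∈ Ω, ∀ t, |b x t| ≤ ψ₁ x * |t| ^ (p - 1) + ψ₁ x)
    (hmono : ∀ x ∈ Ω, ∀ t₁ t₂, 0 ≤ (t₁ - t₂) * (b x t₁ - b x t₂)) :
    (∀ u v : SobolevW1p Ω p, Integrable (fun x => v.fn x * b x (u.fn x)) (domMeasure Ω)) ∧
    ∃ B : SobolevW1p Ω p → StrongDual ℝ (SobolevW1p Ω p),
      (∀ u v, B u v = ∫ x, v.fn x * b x (u.fn x) ∂(domMeasure Ω)) ∧
      IsBoundedMonotone B := by
  have := isFiniteMeasure_domMeasure hΩ.isBounded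
  have hae : ∀ᵐ x ∂(domMeasure Ω), x ∈ Ω := ae_restrict_mem hΩ.isOpen.measurableSet
  obtain ⟨s, hs, hds, hψ⟩ := hS.exists_memLp_domain
  obtain ⟨hfin, C₁, hC₁⟩ := exists_boundedIn_withDensity (p := p) hΩ (domMeasure_compl_closure)
    (fun W c => c.growth_domMeasure) hs hds hψ
  obtain ⟨C, hC⟩ := SobolevW1p.exists_eLpNorm_add_le Ω p
  have hac : ((domMeasure Ω).withDensity fun x => (‖ψ₁ x‖₊ : ℝ≥0∞)) ≪ domMeasure Ω :=
    withDensity_absolutelyContinuous _ _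
  simp_rw [← real_inner_eq_mul]
  refine exists_operator (w := fun x => ‖ψ₁ x‖₊) (K := 1) (c := fun _ => 1) (τ := fun u : SobolevW1p Ω p => u.fn)
    (C := C₁ * C) (Real.HolderConjugate.conjExponent hp.out) hψ.1.nnnorm.aemeasurable hmeas
    (hae.mono hcont) (hae.mono fun x hx t => ?_) (memLp_const _) (hae.mono fun x hx t₁ t₂ => ?_)
    ?_ ?_ ?_ ?_
  · rw [coe_nnnorm, Real.norm_of_nonneg (hS.1 x hx), NNReal.coe_one, one_mul, mul_add, mul_one]
    exact hbd x hx t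
  · rw [real_inner_eq_mul]
    exact hmono x hx t₁ t₂
  · exact fun u => u.memLp_fn.1.mono_ac hac
  · exact fun u v => hac.ae_le (SobolevW1p.fn_add u v)
  · exact fun t u => hac.ae_le (SobolevW1p.fn_smul t u)
  · intro u
    obtain ⟨φ, hφ⟩ := u.exists_approximatedBy hΩ
    refine (hφ.eLpNorm_le hac hC₁ u.memLp_fn.1 hφ.tendsto_fn).trans ?_
    rw [ENNReal.coe_mul, mul_assoc]
    exact mul_le_mul_right (hC u) _

/-- The same with weight ψ₄ on ∂Ω. The trace is linear only almost everywhere, as it is a chosen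
representative; that suffices because the weighted measure is absolutely continuous with respect to
σ. -/
theorem exists_operator_boundary [NeZero N] (hΩ : IsBoundedLipschitzDomain Ω)
    (hS : StructureFunctions Ω p ψ₁ ψ₂ ψ₄)
    (hmeas : ∀ t, AEStronglyMeasurable (fun x => h x t) (bdryMeasure Ω))
    (hcont : ∀ x ∈ frontier Ω, Continuous (h x))
    (hbd : ∀ x ∈ frontier Ω, ∀ t, |h x t| ≤ ψ₄ x * |t| ^ (p - 1) + ψ₄ x)
    (hmono : ∀ x ∈ frontier Ω, ∀ t₁ t₂, 0 ≤ (t₁ - t₂) * (h x t₁ - h x t₂)) :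
    (∀ u v : SobolevW1p Ω p, Integrable (fun x => v.trace x * h x (u.trace x)) (bdryMeasure Ω)) ∧
    ∃ B : SobolevW1p Ω p → StrongDual ℝ (SobolevW1p Ω p),
      (∀ u v, B u v = ∫ x, v.trace x * h x (u.trace x) ∂(bdryMeasure Ω)) ∧
      IsBoundedMonotone B := by
  have := isFiniteMeasure_bdryMeasure hΩ
  have hae : ∀ᵐ x ∂(bdryMeasure Ω), x ∈ frontier Ω :=
    ae_restrict_mem isClosed_frontier.measurableSet
  obtain ⟨s, hs, hds, hψ⟩ := hS.exists_memLp_boundary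
  obtain ⟨hfin, C₁, hC₁⟩ := exists_boundedIn_withDensity (p := p) hΩ (bdryMeasure_compl_closure)
    (fun W c => c.growth_bdryMeasure) hs hds hψ
  obtain ⟨C, hC⟩ := SobolevW1p.exists_eLpNorm_add_le Ω p
  have hac : ((bdryMeasure Ω).withDensity fun x => (‖ψ₄ x‖₊ : ℝ≥0∞)) ≪ bdryMeasure Ω :=
    withDensity_absolutelyContinuous _ _
  simp_rw [← real_inner_eq_mul]
  refine exists_operator (w := fun x => ‖ψ₄ x‖₊) (K := 1) (c := fun _ => 1) (τ := fun u : SobolevW1p Ω p => u.trace)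
    (C := C₁ * C) (Real.HolderConjugate.conjExponent hp.out) hψ.1.nnnorm.aemeasurable hmeas
    (hae.mono hcont) (hae.mono fun x hx t => ?_) (memLp_const _) (hae.mono fun x hx t₁ t₂ => ?_)
    ?_ ?_ ?_ ?_
  · rw [coe_nnnorm, Real.norm_of_nonneg (hS.2.2.1 x hx), NNReal.coe_one, one_mul, mul_add, mul_one]
    exact hbd x hx t
  · rw [real_inner_eq_mul]
    exact hmono x hx t₁ t₂
  · exact fun u => (u.isTrace_trace hΩ).1.1.mono_ac hac
  · exact fun u v => hac.ae_le (SobolevW1p.trace_add hΩ u v)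
  · exact fun t u => hac.ae_le (SobolevW1p.trace_smul hΩ t u)
  · intro u
    obtain ⟨hm, φ, hφ, hφt⟩ := SobolevW1p.isTrace_iff.1 (u.isTrace_trace hΩ)
    refine (hφ.eLpNorm_le hac hC₁ hm.1 hφt).trans ?_
    rw [ENNReal.coe_mul, mul_assoc]
    exact mul_le_mul_right (hC u) _

theorem IsBoundedMonotone.exists_pullback {V W : Type*} [NormedAddCommGroup V] [NormedSpace ℝ V]
    [NormedAddCommGroup W] [NormedSpace ℝ W] {A : V → StrongDual ℝ V} (hA : IsBoundedMonotone A)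
    (L : W →L[ℝ] V) :
    ∃ B : W → StrongDual ℝ W, (∀ u v, B u v = A (L u) (L v)) ∧ IsBoundedMonotone B :=
  ⟨_, fun _ _ => rfl, hA.comp_clm L⟩

theorem exists_operator_sobolev [NeZero N] (hΩ : IsBoundedLipschitzDomain Ω)
    (hC : CaratheodoryCoeffs Ω a b h) (hS : StructureConditions Ω p a b h)
    (hM : MonotoneCoeffs Ω a b h) :
    (∀ u v : SobolevW1p Ω p,
      Integrable (fun x => inner ℝ (v.grad x) (a x (u.grad x))) (domMeasure Ω) ∧
      Integrable (fun x => v.fn x * b x (u.fn x)) (domMeasure Ω) ∧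
      Integrable (fun x => v.trace x * h x (u.trace x)) (bdryMeasure Ω)) ∧
    ∃ A : SobolevW1p Ω p → StrongDual ℝ (SobolevW1p Ω p),
      (∀ u v, A u v =
        (∫ x, inner ℝ (v.grad x) (a x (u.grad x)) ∂(domMeasure Ω))
        + (∫ x, v.fn x * b x (u.fn x) ∂(domMeasure Ω))
        + (∫ x, v.trace x * h x (u.trace x) ∂(bdryMeasure Ω))) ∧
      IsBoundedMonotone A := by
  obtain ⟨ν, μ, ψ₁, ψ₂, ψ₄, hν, hνμ, hψ, -, ha, hb, hh⟩ := hS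
  obtain ⟨hint₁, B₁, hB₁, hm₁⟩ := exists_operator_gradient hΩ.isOpen hΩ.isBounded hψ
    hC.meas_a hC.cont_a (hν.le.trans hνμ) ha hM.mono_a
  obtain ⟨hint₂, B₂, hB₂, hm₂⟩ := exists_operator_domain hΩ hψ hC.meas_b hC.cont_b hb hM.mono_b
  obtain ⟨hint₃, B₃, hB₃, hm₃⟩ := exists_operator_boundary hΩ hψ hC.meas_h hC.cont_h hh hM.mono_h
  refine ⟨fun u v => ⟨hint₁ u v, hint₂ u v, hint₃ u v⟩, _, fun u v => ?_, (hm₁.add hm₂).add hm₃⟩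
  rw [_root_.add_apply, _root_.add_apply, hB₁, hB₂, hB₃]

/-- An operator on `W^{1,p}(Ω)` induces an operator on `V`. -/
theorem SpaceV.exists_operator {A : SobolevW1p Ω p → StrongDual ℝ (SobolevW1p Ω p)}
    (hA : IsBoundedMonotone A) : ∃ B : SpaceV Ω p → StrongDual ℝ (SpaceV Ω p),
      (∀ u v, B u v = A u.toW1p v.toW1p) ∧
      (∀ s : Set (SpaceV Ω p), Bornology.IsBounded s → Bornology.IsBounded (B '' s)) ∧
      Continuous B ∧ ∀ u v, 0 ≤ (B u - B v) (u - v) := by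
  -- V enters only through this projection; the L² component plays no part in the operator.
  let L : SpaceV Ω p →L[ℝ] SobolevW1p Ω p :=
    (ContinuousLinearMap.fst ℝ _ _).comp (SpaceV.split Ω p)
  obtain ⟨B, hB, hBm⟩ := @IsBoundedMonotone.exists_pullback (SobolevW1p Ω p) (SpaceV Ω p) _ _
    (Submodule.normedAddCommGroup _) (Submodule.normedSpace _) A hA L
  exact ⟨B, hB, hBm.bounded, hBm.continuous, hBm.monotone⟩

end StructureConditions

/-! ### The theorem -/

theorem mainTheorem9 (N : ℕ) [NeZero N] (Ω : Set (EucSp N)) (hΩ : IsBoundedLipschitzDomain Ω)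
    (p : ℝ) [Fact (1 < p)] :
    -- `V` is a separable, reflexive Banach space
    (CompleteSpace (SpaceV Ω p) ∧ TopologicalSpace.SeparableSpace (SpaceV Ω p) ∧
      Function.Surjective (NormedSpace.inclusionInDoubleDual ℝ (SpaceV Ω p))) ∧
    -- every `u ∈ W^{1,p}(Ω)` has a trace, unique up to `σ`-null sets
    (∀ u : SobolevW1p Ω p, u.IsTrace u.trace ∧
      ∀ g, u.IsTrace g → g =ᵐ[bdryMeasure Ω] u.trace) ∧
    ∀ (a : EucSp N → EucSp N → EucSp N) (b h : EucSp N → ℝ → ℝ),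
      CaratheodoryCoeffs Ω a b h → StructureConditions Ω p a b h → MonotoneCoeffs Ω a b h →
      -- the integrals that define the form exist
      (∀ u v : SpaceV Ω p,
        Integrable (fun x => inner ℝ (v.grad x) (a x (u.grad x))) (domMeasure Ω) ∧
        Integrable (fun x => v.fn x * b x (u.fn x)) (domMeasure Ω) ∧
        Integrable (fun x => v.trace x * h x (u.trace x)) (bdryMeasure Ω)) ∧
      -- the form defines an operator `V → V'` that is bounded, continuous and monotone
      ∃ A : SpaceV Ω p → StrongDual ℝ (SpaceV Ω p),
        (∀ u v, A u v =
          (∫ x, inner ℝ (v.grad x) (a x (u.grad x)) ∂(domMeasure Ω))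
          + (∫ x, v.fn x * b x (u.fn x) ∂(domMeasure Ω))
          + (∫ x, v.trace x * h x (u.trace x) ∂(bdryMeasure Ω))) ∧
        (∀ s : Set (SpaceV Ω p), Bornology.IsBounded s → Bornology.IsBounded (A '' s)) ∧
        Continuous A ∧
        ∀ u v, 0 ≤ (A u - A v) (u - v) := by
  refine ⟨⟨completeSpace_spaceV hΩ.isOpen, separableSpace_spaceV hΩ.isBounded,
    isReflexiveSpace_spaceV hΩ.isOpen hΩ.isBounded⟩,
    fun u => ⟨u.isTrace_trace hΩ, fun g hg => hg.ae_eq_trace hΩ⟩, ?_⟩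
  intro a b h hC hS hM
  obtain ⟨hint, A₀, hA₀, hm⟩ := exists_operator_sobolev hΩ hC hS hM
  obtain ⟨A, hA, hAm⟩ := SpaceV.exists_operator hm
  exact ⟨fun u v => hint u.toW1p v.toW1p, A,
    fun u v => (hA u v).trans (hA₀ u.toW1p v.toW1p), hAm⟩
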